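/- Let $J\ge 1$ and $E=\{1,\dots,J-1\}$. For $\boldsymbol\theta=(\theta_{2(1)},\dots,\theta_{2(J-1)},\theta_{12(11)},\dots,\theta_{12(1,J-1)})\in\mathbb R^{2(J-1)}$ and sample sizes $n_1,n_2$, $n=n_1+n_2$, put $\theta_{2(J)}=\theta_{12(1J)}=\theta_{12(2j)}=0$, $$\pi_{ij}(\boldsymbol\theta)=\frac{\exp(\theta_{2(j)}+\theta_{12(ij)})}{\sum_{l=1}^J\exp(\theta_{2(l)}+\theta_{12(il)})},\qquad p_{ij}(\boldsymbol\theta)=\frac{n_i}{n}\,\pi_{ij}(\boldsymbol\theta)\qquad(i=1,2,\ j=1,\dots,J),$$ (the saturated loglinear model for a $2\times J$ table), and let $\vartheta_j=\pi_{1j}\pi_{2,j+1}/(\pi_{2j}\pi_{1,j+1})$, $j\in E$, be the local odds ratios, so that $\log\vartheta_j=\theta_{12(1j)}-\theta_{12(1,j+1)}$. Let $\Theta_0=\{\boldsymbol\theta:\log\vartheta_j=0\ \forall j\in E\}$ and $\Theta=\{\boldsymbol\theta:\log\vartheta_j\ge0\ \forall j\in E\}$. Let $\boldsymbol N_i=(N_{i1},\dots,N_{iJ})\sim\mathcal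 M(n_i,\boldsymbol\pi_i(\boldsymbol\theta_0))$, $i=1,2$, be independent multinomial vectors, where the fixed true parameter $\boldsymbol\theta_0$ satisfies $H_0$: $\vartheta_j=1$ for all $j\in E$; write $\pi_j=\pi_{1j}(\boldsymbol\theta_0)=\pi_{2j}(\boldsymbol\theta_0)$. Let $\widehat{\boldsymbol\theta}$ and $\widetilde{\boldsymbol\theta}$ be maximum likelihood estimators over $\Theta_0$ and $\Theta$, i.e. maximizers over these sets of $\ell(\boldsymbol N;\boldsymbol\theta)=\sum_{i,j}N_{ij}\log p_{ij}(\boldsymbol\theta)$ whenever a maximizer exists (with arbitrary values for the tables for which there is none). Let $\phi:(0,\infty)\to\mathbb R$ be convex with $\phi(1)=\phi'(1)=0$ and $\phi''(1)>0$ (with an arbitrary real value assigned to $\phi(0)$), let $d_\phi(\boldsymbol p,\boldsymbol q)=\sum_{i,j}q_{ij}\,\phi(p_{ij}/q_{ij})$, $\overline p_{ij}=N_{ij}/n$, and $$T_\phi=\frac{2n}{\phi''(1)}\bigl(d_\phi(\overline{\boldsymbol p},\boldsymbol p(\widehat{\boldsymbol\theta}))-d_\phi(\overline{\boldsymbol p},\boldsymbol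 p(\widetilde{\boldsymbol\theta}))\bigr),\qquad S_\phi=\frac{2n}{\phi''(1)}\,d_\phi(\boldsymbol p(\widetilde{\boldsymbol\theta}),\boldsymbol p(\widehat{\boldsymbol\theta})).$$ Then, as $n_1,n_2\to\infty$ with $n_i/n\to\nu_i>0$, for every $x\in\mathbb R$, $$\lim\Pr(S_\phi\le x)=\lim\Pr(T_\phi\le x)=\sum_{j=0}^{J-1}w_j(\boldsymbol\theta_0)\,\Pr\bigl(\chi^2_{(J-1)-j}\le x\bigr),$$ where $\chi^2_0=0$ a.s., $\sum_{j=0}^{J-1}w_j(\boldsymbol\theta_0)=1$ and $$w_j(\boldsymbol\theta_0)=\sum_{S\subseteq E,\ |S|=j}\Pr(\boldsymbol Z_1(S)\ge\boldsymbol 0)\,\Pr(\boldsymbol Z_2(S)\ge\boldsymbol 0)$$ with centred Gaussian vectors (componentwise inequalities; the probability is $1$ for an empty vector) $$\boldsymbol Z_1(S)\sim\mathcal N\bigl(\boldsymbol0,\boldsymbol H(S,S)^{-1}\bigr),\qquad \boldsymbol Z_2(S)\sim\mathcal N\bigl(\boldsymbol0,\ \boldsymbol H(S^C,S^C)-\boldsymbol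 H(S^C,S)\boldsymbol H(S,S)^{-1}\boldsymbol H(S^C,S)^T\bigr),$$ $S^C=E\setminus S$. Here $\boldsymbol H$ is the symmetric tridiagonal $(J-1)\times(J-1)$ matrix with $H_{jj}=\frac{1}{\nu_1\nu_2}\frac{\pi_j+\pi_{j+1}}{\pi_j\pi_{j+1}}$ and $H_{j,j+1}=H_{j+1,j}=-\frac{1}{\nu_1\nu_2}\frac1{\pi_{j+1}}$, and $\boldsymbol H(S_1,S_2)$ is its submatrix with rows in $S_1$ and columns in $S_2$. -/

import Mathlib

open MeasureTheory ProbabilityTheory Filter Topology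
open scoped BigOperators

noncomputable section

namespace LROrder

/-! Throughout, `m = J - 1`: there are `J = m + 1` response categories, indexed by `Fin (m + 1)`,
two treatments, indexed by `Fin 2` (`0` is treatment 1, `1` is treatment 2), and the constraints
are indexed by `E = Fin m`. -/

/-- A `2 × J` table of counts. -/
abbrev Table (m : ℕ) := Fin 2 → Fin (m + 1) → ℕ

/-- The free parameters `(θ₂, θ₁₂)` of the saturated loglinear model; `θ₁₂` is the first row of
interactions. -/
abbrev Param (m : ℕ) := (Fin m → ℝ) × (Fin m → ℝ)

/-- A vector indexed by the first `J - 1` categories, extended by `0` in the last category. -/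
def extendZero {m : ℕ} (v : Fin m → ℝ) (j : Fin (m + 1)) : ℝ :=
  if h : (j : ℕ) < m then v ⟨j, h⟩ else 0

/-- The linear predictor `θ_{2(j)} + θ_{12(ij)}`, with `θ_{2(J)} = 0`, `θ_{12(1J)} = 0` and
`θ_{12(2j)} = 0`. -/
def linPred {m : ℕ} (θ : Param m) (i : Fin 2) (j : Fin (m + 1)) : ℝ :=
  extendZero θ.1 j + if i = 0 then extendZero θ.2 j else 0

/-- The conditional probabilities `π_{ij}(θ) = Pr(Y = j | X = i)`. -/
def condProb {m : ℕ} (θ : Param m) (i : Fin 2) (j : Fin (m + 1)) : ℝ :=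
  Real.exp (linPred θ i j) / ∑ l, Real.exp (linPred θ i l)

/-- The total sample size `n = n₁ + n₂`. -/
def total (n : Fin 2 → ℕ) : ℝ := ∑ i, (n i : ℝ)

/-- The joint probabilities `p_{ij}(θ) = (n_i / n) π_{ij}(θ)`. -/
def jointProb {m : ℕ} (n : Fin 2 → ℕ) (θ : Param m) (i : Fin 2) (j : Fin (m + 1)) : ℝ :=
  (n i : ℝ) / total n * condProb θ i j

theorem condProb_pos {m : ℕ} (θ : Param m) (i : Fin 2) (j : Fin (m + 1)) :
    0 < condProb θ i j := by
  unfold condProb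
  positivity

theorem sum_condProb {m : ℕ} (θ : Param m) (i : Fin 2) : ∑ j, condProb θ i j = 1 := by
  unfold condProb
  rw [← Finset.sum_div]
  exact div_self (by positivity)

theorem jointProb_pos {m : ℕ} (n : Fin 2 → ℕ) (hn : ∀ i, 0 < n i) (θ : Param m) (i : Fin 2)
    (j : Fin (m + 1)) : 0 < jointProb n θ i j := by
  have h0 : ∀ i, (0 : ℝ) < n i := fun i => Nat.cast_pos.mpr (hn i)
  have ht : 0 < total n := Finset.sum_pos (fun i _ => h0 i) Finset.univ_nonempty
  exact mul_pos (div_pos (h0 i) ht) (condProb_pos θ i j)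

theorem sum_exp_extendZero {m : ℕ} (v : Fin m → ℝ) :
    ∑ l, Real.exp (extendZero v l) = 1 + ∑ l, Real.exp (v l) := by
  rw [Fin.sum_univ_castSucc]
  simp [extendZero, add_comm]

/-- `jointProb` is the saturated loglinear model: `log p_{ij} = u + u_{1(i)} + θ_{2(j)} + θ_{12(ij)}`
with `u_{1(2)} = 0`, where `u` and `u_{1(1)}` are determined by the row totals `n_i / n`. -/
theorem log_jointProb {m : ℕ} (n : Fin 2 → ℕ) (hn : ∀ i, 0 < n i) (θ : Param m) (i : Fin 2)
    (j : Fin (m + 1)) :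
    Real.log (jointProb n θ i j) =
      (Real.log (n 1) - Real.log (total n) - Real.log (1 + ∑ l, Real.exp (θ.1 l))) +
      (if i = 0 then Real.log ((n 0 : ℝ) / n 1) +
        Real.log ((1 + ∑ l, Real.exp (θ.1 l)) / (1 + ∑ l, Real.exp (θ.1 l + θ.2 l))) else 0) +
      linPred θ i j := by
  have h0 : ∀ i, (0 : ℝ) < n i := fun i => Nat.cast_pos.mpr (hn i)
  have ht : 0 < total n := Finset.sum_pos (fun i _ => h0 i) Finset.univ_nonempty
  have hs : ∀ v : Fin m → ℝ, 0 < 1 + ∑ l, Real.exp (v l) := fun v => by positivity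
  have hs1 := hs θ.1
  have hs2 := hs (fun l => θ.1 l + θ.2 l)
  have e1 : ∑ l, Real.exp (linPred θ 1 l) = 1 + ∑ l, Real.exp (θ.1 l) := by
    simp [linPred, sum_exp_extendZero]
  have e0 : ∑ l, Real.exp (linPred θ 0 l) = 1 + ∑ l, Real.exp (θ.1 l + θ.2 l) := by
    rw [← sum_exp_extendZero (fun l => θ.1 l + θ.2 l)]
    refine Finset.sum_congr rfl fun l _ => ?_
    simp only [linPred, extendZero]
    split_ifs <;> simp_all
  have hd : 0 < ∑ l, Real.exp (linPred θ i l) := by positivity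
  unfold jointProb condProb
  rw [Real.log_mul (by have := h0 i; positivity) (by positivity),
    Real.log_div (h0 i).ne' ht.ne', Real.log_div (Real.exp_pos _).ne' hd.ne', Real.log_exp]
  fin_cases i
  · simp only [Fin.zero_eta, if_true]
    rw [e0, Real.log_div (h0 0).ne' (h0 1).ne', Real.log_div hs1.ne' hs2.ne']
    ring
  · simp only [Fin.mk_one, one_ne_zero, if_false]
    rw [e1]
    ring

/-- The local odds ratio `ϑ_j = π_{1j} π_{2,j+1} / (π_{2j} π_{1,j+1})`. -/
def localOddsRatio {m : ℕ} (q : Fin 2 → Fin (m + 1) → ℝ) (j : Fin m) : ℝ :=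
  (q 0 j.castSucc * q 1 j.succ) / (q 1 j.castSucc * q 0 j.succ)

/-- The matrix with `1` on the diagonal and `-1` on the first superdiagonal. -/
def diffMatrix (m : ℕ) : Matrix (Fin m) (Fin m) ℝ :=
  fun i j => if j = i then 1 else if (j : ℕ) = i + 1 then -1 else 0

/-- `R θ`, for `R = (0, G)` with `G` the matrix `diffMatrix`. -/
def constraint {m : ℕ} (θ : Param m) : Fin m → ℝ := (diffMatrix m).mulVec θ.2

/-- The parameter space `Θ₀ = {θ : R θ = 0}` of the null hypothesis. -/
def nullSpace (m : ℕ) : Set (Param m) := {θ | ∀ j, constraint θ j = 0}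

/-- The overall parameter space `Θ = {θ : R θ ≥ 0}`. -/
def orderSpace (m : ℕ) : Set (Param m) := {θ | ∀ j, 0 ≤ constraint θ j}

theorem constraint_apply {m : ℕ} (θ : Param m) (j : Fin m) :
    constraint θ j = θ.2 j - extendZero θ.2 j.succ := by
  unfold constraint diffMatrix Matrix.mulVec dotProduct extendZero
  have key : ∀ x : Fin m, ((if x = j then (1 : ℝ) else if (x : ℕ) = j + 1 then -1 else 0) * θ.2 x)
      = (if x = j then θ.2 x else 0) - (if (x : ℕ) = j + 1 then θ.2 x else 0) := by
    intro x
    by_cases h1 : x = j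
    · subst h1; simp
    · by_cases h2 : (x : ℕ) = j + 1 <;> simp [h1, h2]
  simp only [key, Finset.sum_sub_distrib, Finset.sum_ite_eq', Finset.mem_univ, if_true,
    Fin.val_succ]
  congr 1
  by_cases h : (j : ℕ) + 1 < m
  · rw [dif_pos h, Finset.sum_eq_single (⟨j + 1, h⟩ : Fin m)]
    · simp
    · intro b _ hb
      rw [if_neg]
      intro h'
      exact hb (Fin.ext h')
    · simp
  · rw [dif_neg h]
    refine Finset.sum_eq_zero fun x _ => if_neg ?_
    have := x.isLt
    omega

/-- `R θ` is the vector of log local odds ratios, so `nullSpace` is `ϑ = 1` and `orderSpace` is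
`ϑ ≥ 1`. -/
theorem log_localOddsRatio {m : ℕ} (θ : Param m) (j : Fin m) :
    Real.log (localOddsRatio (condProb θ) j) = constraint θ j := by
  have hp := condProb_pos θ
  have hl : ∀ i l, Real.log (condProb θ i l) =
      linPred θ i l - Real.log (∑ l, Real.exp (linPred θ i l)) := by
    intro i l
    unfold condProb
    rw [Real.log_div (Real.exp_pos _).ne' (by positivity), Real.log_exp]
  have hc : extendZero θ.2 j.castSucc = θ.2 j := by simp [extendZero]
  unfold localOddsRatio
  rw [Real.log_div (mul_pos (hp _ _) (hp _ _)).ne' (mul_pos (hp _ _) (hp _ _)).ne',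
    Real.log_mul (hp _ _).ne' (hp _ _).ne', Real.log_mul (hp _ _).ne' (hp _ _).ne',
    hl, hl, hl, hl, constraint_apply]
  simp only [linPred, if_true, one_ne_zero, if_false, hc]
  ring

/-- The kernel `ℓ(N; θ) = ∑ N_{ij} log p_{ij}(θ)` of the loglikelihood. -/
def logLik {m : ℕ} (n : Fin 2 → ℕ) (N : Table m) (θ : Param m) : ℝ :=
  ∑ i, ∑ j, (N i j : ℝ) * Real.log (jointProb n θ i j)

/-- `θ` maximizes the loglikelihood over `K`. -/
def IsMLE {m : ℕ} (K : Set (Param m)) (n : Fin 2 → ℕ) (N : Table m) (θ : Param m) : Prop :=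
  θ ∈ K ∧ IsMaxOn (logLik n N) K θ

/-- `est` is a maximum likelihood estimator over `K`: for sample sizes `n` and table `N` it returns
a maximizer of the loglikelihood over `K` whenever there is one. Its value is arbitrary for the
tables (some of those with an empty cell) whose loglikelihood has no maximizer over `K`. -/
def IsMLEstimator {m : ℕ} (K : Set (Param m)) (est : (Fin 2 → ℕ) → Table m → Param m) : Prop :=
  ∀ n N, (∃ θ, IsMLE K n N θ) → IsMLE K n N (est n N)

/-- The conditions on the function `φ : (0, ∞) → ℝ`. Positivity of `deriv (deriv φ) 1` includes
the existence of the second derivative at `1`. The value of `φ` at `0` is arbitrary. -/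
structure IsPhi (φ : ℝ → ℝ) : Prop where
  convex : ConvexOn ℝ (Set.Ioi 0) φ
  map_one : φ 1 = 0
  deriv_one : HasDerivAt φ 0 1
  deriv_two_pos : 0 < deriv (deriv φ) 1

/-- The `φ`-divergence `d_φ(p, q) = ∑ q_{ij} φ(p_{ij} / q_{ij})`, with the conventions
`0 φ(0 / 0) = 0` and `0 φ(p / 0) = p lim φ(u) / u`. (These concern `q_{ij} = 0`, which does not
occur for `q = p(θ)`, see `jointProb_pos`.) -/
def phiDiv {m : ℕ} (φ : ℝ → ℝ) (p q : Fin 2 → Fin (m + 1) → ℝ) : ℝ :=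
  ∑ i, ∑ j, if q i j = 0 then p i j * limUnder atTop (fun u => φ u / u)
    else q i j * φ (p i j / q i j)

/-- The relative frequencies `N_{ij} / n`. -/
def relFreq {m : ℕ} (n : Fin 2 → ℕ) (N : Table m) (i : Fin 2) (j : Fin (m + 1)) : ℝ :=
  (N i j : ℝ) / total n

/-- The statistic `T_φ`, for the order-restricted estimate `θt` and the null estimate `θh`. -/
def statT {m : ℕ} (φ : ℝ → ℝ) (n : Fin 2 → ℕ) (N : Table m) (θt θh : Param m) : ℝ :=
  2 * total n / deriv (deriv φ) 1 *
    (phiDiv φ (relFreq n N) (jointProb n θh) - phiDiv φ (relFreq n N) (jointProb n θt))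

/-- The statistic `S_φ`, for the order-restricted estimate `θt` and the null estimate `θh`. -/
def statS {m : ℕ} (φ : ℝ → ℝ) (n : Fin 2 → ℕ) (θt θh : Param m) : ℝ :=
  2 * total n / deriv (deriv φ) 1 * phiDiv φ (jointProb n θt) (jointProb n θh)

/-- The distribution on a finite set with point probabilities `q`. -/
def categorical {ι : Type*} [Fintype ι] [MeasurableSpace ι] (q : ι → ℝ) : Measure ι :=
  ∑ j, ENNReal.ofReal (q j) • Measure.dirac j

/-- The multinomial distribution with `n` trials and cell probabilities `q`: the law of the vector
of cell counts of `n` independent draws from `q`. -/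
def multinomial {m : ℕ} (n : ℕ) (q : Fin (m + 1) → ℝ) : Measure (Fin (m + 1) → ℕ) :=
  (Measure.pi fun _ : Fin n => categorical q).map
    fun y j => (Finset.univ.filter fun a => y a = j).card

/-- The chi-squared distribution with `d` degrees of freedom: the law of the sum of squares of `d`
independent standard normal variables (the point mass at `0` if `d = 0`). -/
def chiSq (d : ℕ) : Measure ℝ :=
  (Measure.pi fun _ : Fin d => gaussianReal 0 1).map fun z => ∑ i, z i ^ 2

/-- The tridiagonal matrix `H`, for limiting sampling fractions `ν` and category probabilities `q`;
its rows and columns are indexed by `E`. -/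
def matH {m : ℕ} (ν : Fin 2 → ℝ) (q : Fin (m + 1) → ℝ) : Matrix (Fin m) (Fin m) ℝ :=
  fun i j => 1 / (ν 0 * ν 1) *
    (if i = j then (q i.castSucc + q i.succ) / (q i.castSucc * q i.succ)
     else if (j : ℕ) = i + 1 then -(1 / q j.castSucc)
     else if (i : ℕ) = j + 1 then -(1 / q i.castSucc)
     else 0)

/-- The submatrix `H(S₁, S₂)` with the rows in `S₁` and the columns in `S₂`. -/
def sub {m : ℕ} (H : Matrix (Fin m) (Fin m) ℝ) (S₁ S₂ : Finset (Fin m)) : Matrix S₁ S₂ ℝ :=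
  H.submatrix Subtype.val Subtype.val

/-- `Pr(Z ≥ 0)` (componentwise) for a centred Gaussian vector `Z` with covariance matrix `V`. -/
def orthantProb {ι : Type*} [Fintype ι] [DecidableEq ι] (V : Matrix ι ι ℝ) : ℝ :=
  (multivariateGaussian 0 V).real {z | ∀ i, 0 ≤ z i}

/-- The weight `w_j`, for the matrix `H`. -/
def weight {m : ℕ} (H : Matrix (Fin m) (Fin m) ℝ) (j : ℕ) : ℝ :=
  ∑ S ∈ (Finset.univ : Finset (Fin m)).powersetCard j,
    orthantProb (sub H S S)⁻¹ *
      orthantProb (sub H Sᶜ Sᶜ - sub H Sᶜ S * (sub H S S)⁻¹ * (sub H Sᶜ S).transpose)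

end LROrder

end

open LROrder

/-!
The proof has an exact finite-sample part, a Gaussian part, and a limit theorem joining them.

*The estimates.* By Gibbs' inequality (`isMLE_of_variational`), a parameter that reproduces the
column totals and satisfies the variational inequality of the constraint set maximizes the
likelihood, and its fitted probabilities are the only maximizing ones. The pooled table has these
properties for the null hypothesis. For the order restriction, the fitted proportion of the first
treatment in each column is `n₁ / n + u_j / √n`, where `u` is the isotonic regression, with the
column frequencies as weights, of the normalized deviations of the first row from its expectation
(`jointProb_mle_order`). This is valid as soon as those proportions are strictly between `0` and
`1`, which is the case with probability tending to one.

*The projection.* In terms of the partial sums `L` of the deviations, the Karush-Kuhn-Tucker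
conditions of isotonic regression are the linear complementarity problem for the matrix `H` and the
vector `H L`, that is, the projection of `H L` on the nonnegative orthant in the norm of `H⁻¹`
(`IsIsotonic.projNormSq_eq`). Expanding `φ` at `1` to the second order, both statistics converge to
the squared norm of that projection along any convergent tables (`tendsto_stat`), so they are
uniformly close to it for bounded `H L` (`exists_stat_close`).

*The law of the projection.* For `η` Gaussian with covariance `H`, the space is the union of `2 ^ m`
closed faces, according to the set `S` of the active constraints. The multipliers and the slacks on
a face are independent Gaussian vectors with covariances `H(S, S)⁻¹` and the Schur complement
(`map_face_prod`). The squared norm of the projection is a quadratic form in the slacks, chi-squared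
and independent of their signs, because the norm of a standard Gaussian vector is independent of its
direction (`stdGaussian_cone_inter_norm`). Summing over the faces gives the mixture
(`measure_projNormSq`); total mass one gives the sum of the weights.

*The limit.* Characteristic functions and Lévy's theorem give the law `N(0, H)` for `H L`
(`tendsto_score`) and the convergence of the column frequencies. By Slutsky's theorem the statistics
converge in distribution. The limit law has an atom at `0`, where convergence of the distribution
functions needs more: if all the entries of `L` are nonpositive, the order restricted estimate is
the null estimate and both statistics vanish exactly (`stat_eq_zero_of_cumDev_nonpos`).
-/

namespace LROrder

/-! ### The radial part of a Gaussian vector -/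

section Radial

variable {E : Type*} [NormedAddCommGroup E] [InnerProductSpace ℝ E] [FiniteDimensional ℝ E]
  [MeasurableSpace E] [BorelSpace E]

/-- The standard Gaussian measure has a density that only depends on the norm. -/
theorem stdGaussian_eq_withDensity :
    ∃ f : ℝ → ENNReal, Measurable f ∧
      stdGaussian E = (volume : Measure E).withDensity fun v => f ‖v‖ := by
  set d : ℝ := (Module.finrank ℝ E : ℝ) / 2
  set C : ℝ := (2 * Real.pi) ^ (-d)
  have hC : 0 < C := by positivity
  refine ⟨fun r => ENNReal.ofReal (C * Real.exp (-(1 / 2) * r ^ 2)), by fun_prop, ?_⟩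
  have hint : Integrable (fun v : E => C * Real.exp (-(1 / 2) * ‖v‖ ^ 2)) := by
    refine Integrable.const_mul ?_ _
    have h := (GaussianFourier.integrable_cexp_neg_mul_sq_norm_add (V := E) (b := 1 / 2)
      (by norm_num) 0 0).norm
    refine h.congr (.of_forall fun v => ?_)
    simp [Complex.norm_exp, ← Complex.ofReal_pow]
  have : IsFiniteMeasure ((volume : Measure E).withDensity
      fun v => ENNReal.ofReal (C * Real.exp (-(1 / 2) * ‖v‖ ^ 2))) :=
    isFiniteMeasure_withDensity_ofReal hint.2
  refine Measure.ext_of_charFun ?_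
  ext t
  rw [charFun_stdGaussian, charFun_apply,
    integral_withDensity_eq_integral_toReal_smul (by fun_prop) (by simp)]
  have h := GaussianFourier.integral_cexp_neg_mul_sq_norm_add (V := E) (b := 1 / 2)
      (by norm_num) Complex.I t
  have e : ∀ v : E, (ENNReal.ofReal (C * Real.exp (-(1 / 2) * ‖v‖ ^ 2))).toReal •
      Complex.exp (inner ℝ v t * Complex.I) =
      C * Complex.exp (-(1 / 2) * ‖v‖ ^ 2 + Complex.I * inner ℝ t v) := by
    intro v
    rw [ENNReal.toReal_ofReal (by positivity), real_inner_comm, Complex.exp_add,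
      Complex.real_smul]
    push_cast
    ring_nf
  simp_rw [e]
  rw [integral_const_mul, h, ← mul_assoc]
  have e2 : ((C : ℝ) : ℂ) * ((Real.pi : ℂ) / (1 / 2)) ^ ((Module.finrank ℝ E : ℂ) / 2) = 1 := by
    have : ((Real.pi : ℂ) / (1 / 2)) ^ ((Module.finrank ℝ E : ℂ) / 2)
        = (((2 * Real.pi) ^ d : ℝ) : ℂ) := by
      rw [Complex.ofReal_cpow (by positivity)]
      simp only [d]
      push_cast
      congr 1
      ring
    rw [this, ← Complex.ofReal_mul, ← Real.rpow_add (by positivity)]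
    simp
  rw [e2, one_mul]
  congr 1
  rw [Complex.I_sq]
  ring

/-- The image under the norm of Lebesgue measure on a cone is that of Lebesgue measure on the whole
space, up to a constant factor: both are homogeneous of the same degree. -/
theorem map_norm_restrict_cone [Nontrivial E] {C : Set E}
    (hcone : ∀ r : ℝ, 0 < r → ∀ v, r • v ∈ C ↔ v ∈ C) :
    ∃ c : ENNReal,
      ((volume : Measure E).restrict C).map norm = c • (volume : Measure E).map norm := by
  set B : Set E := Metric.closedBall 0 1
  have hB0 : (volume : Measure E) B ≠ 0 := (Metric.measure_closedBall_pos _ _ one_pos).ne'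
  have hBt : (volume : Measure E) B ≠ ⊤ := measure_closedBall_lt_top.ne
  have hcap : ∀ D : Set E, (∀ r : ℝ, 0 < r → ∀ v, r • v ∈ D ↔ v ∈ D) → ∀ r : ℝ, 0 ≤ r →
      (volume : Measure E) (norm ⁻¹' Set.Iic r ∩ D) =
        ENNReal.ofReal (r ^ Module.finrank ℝ E) * (volume : Measure E) (B ∩ D) := by
    intro D hD r hr
    rcases hr.eq_or_lt with rfl | hr
    · have h0 : (norm ⁻¹' Set.Iic (0 : ℝ) ∩ D) ⊆ {(0 : E)} := by
        intro v hv
        simpa using hv.1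
      rw [measure_mono_null h0 (by simp), zero_pow Module.finrank_pos.ne']
      simp
    · rw [← abs_of_nonneg (pow_nonneg hr.le _), ← Measure.addHaar_smul]
      congr 1
      ext v
      rw [Set.mem_smul_set_iff_inv_smul_mem₀ hr.ne']
      simp only [Set.mem_inter_iff, Set.mem_preimage, Set.mem_Iic, B, mem_closedBall_zero_iff,
        norm_smul, norm_inv, Real.norm_eq_abs, abs_of_pos hr, hD _ (inv_pos.mpr hr)]
      rw [inv_mul_le_iff₀ hr, mul_one]
  refine ⟨volume (B ∩ C) / volume B, ?_⟩
  have hloc : IsLocallyFiniteMeasure (((volume : Measure E).restrict C).map norm) := by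
    refine ⟨fun x => ⟨Set.Iio (x + 1), Iio_mem_nhds (by linarith), ?_⟩⟩
    rw [Measure.map_apply measurable_norm measurableSet_Iio]
    refine (Measure.restrict_apply_le _ _).trans_lt ?_
    have : (norm ⁻¹' Set.Iio (x + 1) : Set E) ⊆ Metric.closedBall 0 (x + 1) := by
      intro v hv
      simpa using (Set.mem_Iio.mp hv).le
    exact (measure_mono this).trans_lt measure_closedBall_lt_top
  have key : ∀ r : ℝ, (((volume : Measure E).restrict C).map norm) (Set.Iic r) =
      ((volume (B ∩ C) / volume B) • (volume : Measure E).map norm) (Set.Iic r) := by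
    intro r
    rw [Measure.smul_apply, Measure.map_apply measurable_norm measurableSet_Iic,
      Measure.map_apply measurable_norm measurableSet_Iic,
      Measure.restrict_apply (measurable_norm measurableSet_Iic)]
    rcases lt_or_ge r 0 with hr | hr
    · have : (norm ⁻¹' Set.Iic r : Set E) = ∅ := by
        ext v
        simpa using hr.trans_le (norm_nonneg v)
      simp [this]
    · have h1 := hcap C hcone r hr
      have h2 := hcap Set.univ (by simp) r hr
      rw [Set.inter_univ, Set.inter_univ] at h2
      rw [h1, h2, smul_eq_mul, mul_left_comm, ENNReal.div_mul_cancel hB0 hBt]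
  have hfin : ∀ r : ℝ, (((volume : Measure E).restrict C).map norm) (Set.Iic r) ≠ ⊤ := by
    intro r
    rw [Measure.map_apply measurable_norm measurableSet_Iic]
    refine ((Measure.restrict_apply_le _ _).trans_lt ?_).ne
    have : (norm ⁻¹' Set.Iic r : Set E) = Metric.closedBall 0 r := by
      ext v
      simp
    rw [this]
    exact measure_closedBall_lt_top
  refine Measure.ext_of_Ioc _ _ fun a b hab => ?_
  have hd : Set.Ioc a b = Set.Iic b \ Set.Iic a := by
    ext x
    simp [and_comm]
  rw [hd, measure_sdiff (Set.Iic_subset_Iic.mpr hab.le) measurableSet_Iic.nullMeasurableSet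
    (hfin a), measure_sdiff (Set.Iic_subset_Iic.mpr hab.le) measurableSet_Iic.nullMeasurableSet
    (key a ▸ hfin a), key, key]

/-- The norm of a standard Gaussian vector is independent of the events that only depend on its
direction. -/
theorem stdGaussian_cone_inter_norm {C : Set E} (hC : MeasurableSet C) (h0 : (0 : E) ∈ C)
    (hcone : ∀ r : ℝ, 0 < r → ∀ v, r • v ∈ C ↔ v ∈ C) {A : Set ℝ} (hA : MeasurableSet A) :
    stdGaussian E (C ∩ norm ⁻¹' A) = stdGaussian E C * stdGaussian E (norm ⁻¹' A) := by
  rcases subsingleton_or_nontrivial E with hE | hE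
  · have : C = Set.univ := Set.eq_univ_of_forall fun v => Subsingleton.elim 0 v ▸ h0
    simp [this]
  obtain ⟨f, hf, hd⟩ := stdGaussian_eq_withDensity (E := E)
  obtain ⟨c, hc⟩ := map_norm_restrict_cone hcone
  have main : ∀ A : Set ℝ, MeasurableSet A →
      stdGaussian E (C ∩ norm ⁻¹' A) = c * stdGaussian E (norm ⁻¹' A) := by
    intro A hA
    have hA' : MeasurableSet (norm ⁻¹' A : Set E) := measurable_norm hA
    rw [hd, withDensity_apply _ (hC.inter hA'), withDensity_apply _ hA', Set.inter_comm,
      ← Measure.restrict_restrict hA']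
    have e : ∀ μ : Measure E, ∫⁻ v in norm ⁻¹' A, f ‖v‖ ∂μ = ∫⁻ r in A, f r ∂(μ.map norm) := by
      intro μ
      rw [setLIntegral_map hA hf measurable_norm]
    rw [e, e, hc, Measure.restrict_smul, lintegral_smul_measure, smul_eq_mul]
  have h1 := main Set.univ .univ
  simp only [Set.preimage_univ, Set.inter_univ, measure_univ, mul_one] at h1
  rw [main A hA, h1]

/-- The chi-squared law is that of the squared norm of a standard Gaussian vector, with the
coordinates indexed by an arbitrary finite type. -/
theorem chiSq_apply {ι : Type*} [Fintype ι] {A : Set ℝ} (hA : MeasurableSet A) :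
    chiSq (Fintype.card ι) A = stdGaussian (EuclideanSpace ℝ ι) ((fun v => ‖v‖ ^ 2) ⁻¹' A) := by
  have hm : Measurable fun v : EuclideanSpace ℝ ι => ‖v‖ ^ 2 := by fun_prop
  have e := measurePreserving_piCongrLeft (fun _ : Fin (Fintype.card ι) => gaussianReal 0 1)
    (Fintype.equivFin ι)
  unfold chiSq
  rw [← map_pi_eq_stdGaussian, Measure.map_apply (by fun_prop) hA,
    Measure.map_apply (by fun_prop) (hm hA), ← e.measure_preimage_equiv]
  congr 1
  ext z
  simp only [Set.mem_preimage, EuclideanSpace.real_norm_sq_eq]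
  rw [← (Fintype.equivFin ι).sum_comp]
  simp [MeasurableEquiv.piCongrLeft, Equiv.piCongrLeft_apply_apply]

instance isProbabilityMeasure_chiSq (d : ℕ) : IsProbabilityMeasure (chiSq d) :=
  Measure.isProbabilityMeasure_map (Measurable.aemeasurable (by fun_prop))

theorem chiSq_singleton (d : ℕ) {x : ℝ} (hx : 0 < x) : chiSq d {x} = 0 := by
  have h := chiSq_apply (ι := Fin d) (measurableSet_singleton x)
  rw [Fintype.card_fin] at h
  rw [h]
  obtain ⟨f, -, hd⟩ := stdGaussian_eq_withDensity (E := EuclideanSpace ℝ (Fin d))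
  rw [hd]
  refine withDensity_absolutelyContinuous _ _ ?_
  refine measure_mono_null (fun v hv => ?_)
    (Measure.addHaar_sphere_of_ne_zero volume 0 (Real.sqrt_pos.mpr hx).ne')
  have : ‖v‖ ^ 2 = x := hv
  simp [← this]

end Radial

/-! ### Gaussian vectors: orthants, hyperplanes -/

section Gauss

open Matrix
open scoped MatrixOrder

variable {ι : Type*} [Fintype ι] [DecidableEq ι]

/-- For a Gaussian vector with covariance `V`, the quadratic form of `V⁻¹` is chi-squared and
independent of the event that the vector is in the nonnegative orthant: after standardization, the
form is the squared norm and the orthant becomes a cone. -/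
theorem multivariateGaussian_orthant_inter {V : Matrix ι ι ℝ} (hV : V.PosDef) {A : Set ℝ}
    (hA : MeasurableSet A) :
    multivariateGaussian 0 V {z | (∀ i, 0 ≤ z i) ∧ z.ofLp ⬝ᵥ V⁻¹ *ᵥ z.ofLp ∈ A} =
      multivariateGaussian 0 V {z | ∀ i, 0 ≤ z i} * chiSq (Fintype.card ι) A := by
  set R : Matrix ι ι ℝ := CFC.sqrt V
  have hRR : R * R = V := CFC.sqrt_mul_sqrt_self V hV.posSemidef.nonneg
  have hRs : Rᵀ = R := by
    have : IsSelfAdjoint R := (CFC.sqrt_nonneg V).isSelfAdjoint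
    have h2 : star R = R := this
    rwa [star_eq_conjTranspose, conjTranspose_eq_transpose_of_trivial] at h2
  have hdet : IsUnit R.det := by
    have h1 : IsUnit V.det := hV.det_pos.ne'.isUnit
    rw [← hRR, det_mul] at h1
    exact isUnit_of_mul_isUnit_left h1
  have hRVR : R * V⁻¹ * R = 1 := by
    rw [← hRR, Matrix.mul_inv_rev, ← Matrix.mul_assoc, mul_nonsing_inv _ hdet, Matrix.one_mul,
      nonsing_inv_mul _ hdet]
  have hq : ∀ g : ι → ℝ, (R *ᵥ g) ⬝ᵥ V⁻¹ *ᵥ (R *ᵥ g) = g ⬝ᵥ g := by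
    intro g
    have h1 : R *ᵥ g = g ᵥ* R := by rw [← mulVec_transpose, hRs]
    rw [h1, ← dotProduct_mulVec, ← h1, mulVec_mulVec, mulVec_mulVec, hRVR,
      one_mulVec]
  have hmeas : Measurable fun g : EuclideanSpace ℝ ι =>
      (0 : EuclideanSpace ℝ ι) + toEuclideanCLM (𝕜 := ℝ) R g := by fun_prop
  have ho : MeasurableSet {z : EuclideanSpace ℝ ι | ∀ i, 0 ≤ z i} := by
    simp only [Set.ofPred_forall]
    exact MeasurableSet.iInter fun i => measurableSet_le measurable_const (by fun_prop)
  have hqm : Measurable fun z : EuclideanSpace ℝ ι => z.ofLp ⬝ᵥ V⁻¹ *ᵥ z.ofLp := by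
    apply Continuous.measurable
    fun_prop
  have hA' : MeasurableSet ((fun r : ℝ => r ^ 2) ⁻¹' A) := (by fun_prop : Measurable _) hA
  set C : Set (EuclideanSpace ℝ ι) := {g | ∀ i, 0 ≤ (R *ᵥ g.ofLp) i}
  have hpre : ∀ g : EuclideanSpace ℝ ι,
      ((0 : EuclideanSpace ℝ ι) + toEuclideanCLM (𝕜 := ℝ) R g).ofLp = R *ᵥ g.ofLp := by
    intro g
    rw [zero_add, ofLp_toEuclideanCLM]
  have hC : MeasurableSet C := by
    have := hmeas ho
    convert this using 1
    ext g
    simp only [C, Set.mem_preimage, Set.mem_ofPred_eq, hpre]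
  have hM : multivariateGaussian 0 V = (stdGaussian (EuclideanSpace ℝ ι)).map
      fun g => (0 : EuclideanSpace ℝ ι) + toEuclideanCLM (𝕜 := ℝ) R g := rfl
  have hoA : MeasurableSet
      {z : EuclideanSpace ℝ ι | (∀ i, 0 ≤ z i) ∧ z.ofLp ⬝ᵥ V⁻¹ *ᵥ z.ofLp ∈ A} :=
    ho.inter (hqm hA)
  rw [hM, Measure.map_apply hmeas hoA, Measure.map_apply hmeas ho]
  have e1 : (fun g : EuclideanSpace ℝ ι => (0 : EuclideanSpace ℝ ι) +
      toEuclideanCLM (𝕜 := ℝ) R g) ⁻¹' {z | (∀ i, 0 ≤ z i) ∧ z.ofLp ⬝ᵥ V⁻¹ *ᵥ z.ofLp ∈ A} =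
      C ∩ norm ⁻¹' ((fun r : ℝ => r ^ 2) ⁻¹' A) := by
    ext g
    simp only [C, Set.mem_preimage, Set.mem_ofPred_eq, hpre, Set.mem_inter_iff, hq]
    rw [EuclideanSpace.real_norm_sq_eq]
    simp [dotProduct, sq]
  have e2 : (fun g : EuclideanSpace ℝ ι => (0 : EuclideanSpace ℝ ι) +
      toEuclideanCLM (𝕜 := ℝ) R g) ⁻¹' {z | ∀ i, 0 ≤ z i} = C := by
    ext g
    simp only [C, Set.mem_preimage, Set.mem_ofPred_eq, hpre]
  have h := stdGaussian_cone_inter_norm hC (by simp [C]) (fun r hr v => by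
    simp only [C, Set.mem_ofPred_eq, WithLp.ofLp_smul, mulVec_smul, Pi.smul_apply, smul_eq_mul]
    exact forall_congr' fun i => mul_nonneg_iff_of_pos_left hr) hA'
  rw [e1, e2, h, chiSq_apply hA]
  rfl

theorem multivariateGaussian_hyperplane {V : Matrix ι ι ℝ} (hV : V.PosDef) {a : ι → ℝ}
    (ha : a ≠ 0) : multivariateGaussian 0 V {z | a ⬝ᵥ z.ofLp = 0} = 0 := by
  have hv : 0 < a ⬝ᵥ V *ᵥ a := by simpa using hV.dotProduct_mulVec_pos ha
  have hm : Measurable fun z : EuclideanSpace ℝ ι => a ⬝ᵥ z.ofLp := by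
    apply Continuous.measurable
    fun_prop
  have hlaw : (multivariateGaussian 0 V).map (fun z => a ⬝ᵥ z.ofLp) =
      gaussianReal 0 (a ⬝ᵥ V *ᵥ a).toNNReal := by
    have : IsProbabilityMeasure ((multivariateGaussian 0 V).map fun z => a ⬝ᵥ z.ofLp) :=
      Measure.isProbabilityMeasure_map hm.aemeasurable
    refine Measure.ext_of_charFun ?_
    ext s
    have h := charFun_multivariateGaussian (μ := 0) hV.posSemidef (WithLp.toLp 2 (s • a))
    rw [charFun_apply] at h
    rw [charFun_apply, integral_map hm.aemeasurable (by fun_prop), charFun_gaussianReal,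
      Real.coe_toNNReal _ hv.le]
    have e : ∀ z : EuclideanSpace ℝ ι, inner ℝ z (WithLp.toLp 2 (s • a)) =
        inner ℝ (a ⬝ᵥ z.ofLp) s := by
      intro z
      simp only [EuclideanSpace.inner_eq_star_dotProduct, star_trivial, smul_dotProduct]
      simp
    simp_rw [e] at h
    rw [h]
    simp only [inner_zero_right, mulVec_smul, dotProduct_smul, smul_dotProduct, smul_eq_mul]
    push_cast
    congr 1
    ring
  have h0 : (a ⬝ᵥ V *ᵥ a).toNNReal ≠ 0 := by simpa using hv
  have := nullSingletonClass_gaussianReal (μ := 0) h0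
  have h1 : (multivariateGaussian 0 V).map (fun z => a ⬝ᵥ z.ofLp) {0} = 0 := by
    rw [hlaw]
    exact measure_singleton 0
  rwa [Measure.map_apply hm (measurableSet_singleton 0)] at h1

end Gauss

/-! ### The linear complementarity problem -/

section LCP

open Matrix

variable {m : ℕ}

/-- `lam` solves the linear complementarity problem for the matrix `H` and the vector `η`:
`lam ≥ 0`, `η + H lam ≥ 0`, and in each coordinate one of the two vanishes.  Then `η + H lam` is
the projection of `η` on the nonnegative orthant, in the norm of `H⁻¹`. -/
structure IsLCP (H : Matrix (Fin m) (Fin m) ℝ) (η lam : Fin m → ℝ) : Prop where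
  nonneg : ∀ i, 0 ≤ lam i
  primal : ∀ i, 0 ≤ η i + (H *ᵥ lam) i
  compl : ∀ i, lam i * (η i + (H *ᵥ lam) i) = 0

theorem transpose_eq_of_posDef {H : Matrix (Fin m) (Fin m) ℝ} (hH : H.PosDef) : Hᵀ = H := by
  have := hH.isHermitian.eq
  rwa [conjTranspose_eq_transpose_of_trivial] at this

theorem dotProduct_mulVec_symm {H : Matrix (Fin m) (Fin m) ℝ} (hH : H.PosDef) (v w : Fin m → ℝ) :
    v ⬝ᵥ H *ᵥ w = w ⬝ᵥ H *ᵥ v := by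
  rw [dotProduct_mulVec, ← mulVec_transpose, transpose_eq_of_posDef hH, dotProduct_comm]

theorem quadForm_coercive {H : Matrix (Fin m) (Fin m) ℝ} (hH : H.PosDef) :
    ∃ c : ℝ, 0 < c ∧ ∀ v : Fin m → ℝ, c * ‖v‖ ^ 2 ≤ v ⬝ᵥ H *ᵥ v := by
  have hc : Continuous fun v : Fin m → ℝ => v ⬝ᵥ H *ᵥ v := by fun_prop
  rcases (Metric.sphere (0 : Fin m → ℝ) 1).eq_empty_or_nonempty with he | hne
  · refine ⟨1, one_pos, fun v => ?_⟩
    have : v = 0 := by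
      by_contra hv
      have : ‖v‖⁻¹ • v ∈ Metric.sphere (0 : Fin m → ℝ) 1 := by
        rw [mem_sphere_zero_iff_norm, norm_smul, norm_inv, norm_norm,
          inv_mul_cancel₀ (norm_ne_zero_iff.mpr hv)]
      rw [he] at this
      exact this
    simp [this]
  · obtain ⟨u, hu, hmin⟩ := (isCompact_sphere (0 : Fin m → ℝ) 1).exists_isMinOn hne hc.continuousOn
    have hu0 : u ≠ 0 := by
      rintro rfl
      simp at hu
    refine ⟨u ⬝ᵥ H *ᵥ u, by simpa using hH.dotProduct_mulVec_pos hu0, fun v => ?_⟩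
    rcases eq_or_ne v 0 with rfl | hv
    · simp
    have hn : 0 < ‖v‖ := norm_pos_iff.mpr hv
    have hs : ‖v‖⁻¹ • v ∈ Metric.sphere (0 : Fin m → ℝ) 1 := by
      rw [mem_sphere_zero_iff_norm, norm_smul, norm_inv, norm_norm, inv_mul_cancel₀ hn.ne']
    have h := hmin hs
    simp only [Set.mem_ofPred_eq, mulVec_smul, dotProduct_smul, smul_dotProduct, smul_eq_mul] at h
    calc u ⬝ᵥ H *ᵥ u * ‖v‖ ^ 2 ≤ (‖v‖⁻¹ * (‖v‖⁻¹ * (v ⬝ᵥ H *ᵥ v))) * ‖v‖ ^ 2 := by gcongr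
      _ = v ⬝ᵥ H *ᵥ v := by field_simp

/-- A solution exists: a minimizer of `lam ↦ lam · H lam / 2 + η · lam` over the nonnegative orthant
is one. -/
theorem exists_isLCP {H : Matrix (Fin m) (Fin m) ℝ} (hH : H.PosDef) (η : Fin m → ℝ) :
    ∃ lam, IsLCP H η lam := by
  obtain ⟨c, hc, hcoer⟩ := quadForm_coercive hH
  set f : (Fin m → ℝ) → ℝ := fun v => v ⬝ᵥ H *ᵥ v / 2 + η ⬝ᵥ v
  have hf : Continuous f := by fun_prop
  set K : ℝ := ∑ i, |η i|
  have hlin : ∀ v : Fin m → ℝ, -(K * ‖v‖) ≤ η ⬝ᵥ v := by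
    intro v
    have : |η ⬝ᵥ v| ≤ K * ‖v‖ := by
      simp only [dotProduct, K, Finset.sum_mul]
      refine (Finset.abs_sum_le_sum_abs _ _).trans (Finset.sum_le_sum fun i _ => ?_)
      rw [abs_mul]
      gcongr
      exact norm_le_pi_norm v i
    exact (abs_le.mp this).1
  set R : ℝ := 2 * K / c
  have hK : 0 ≤ K := Finset.sum_nonneg fun i _ => abs_nonneg _
  have hR : 0 ≤ R := by positivity
  have hcomp : IsCompact (Metric.closedBall (0 : Fin m → ℝ) R ∩ Set.Ici 0) :=
    (isCompact_closedBall _ _).inter_right isClosed_Ici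
  obtain ⟨lam, ⟨-, hl0⟩, hmin⟩ :=
    hcomp.exists_isMinOn ⟨0, by simpa using hR, by simp⟩ hf.continuousOn
  have hmin' : ∀ v : Fin m → ℝ, 0 ≤ v → f lam ≤ f v := by
    intro v hv
    by_cases hb : ‖v‖ ≤ R
    · exact hmin ⟨by simpa using hb, hv⟩
    · have h0 : f lam ≤ f 0 := hmin ⟨by simpa using hR, by simp⟩
      have : f 0 = 0 := by simp [f]
      have hRv : 2 * K < c * ‖v‖ := by
        rw [← div_lt_iff₀' hc]
        exact not_le.mp hb
      have h1 := hcoer v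
      have h2 := hlin v
      have : 0 ≤ f v := by
        simp only [f]
        nlinarith [norm_nonneg v]
      linarith
  have hl : ∀ i, 0 ≤ lam i := hl0
  -- Minimality of `lam` against a step `t` in the `i`th coordinate.
  have hvar : ∀ (i : Fin m) (t : ℝ), 0 ≤ lam i + t →
      0 ≤ t * (η i + (H *ᵥ lam) i) + t ^ 2 * (H i i / 2) := by
    intro i t ht
    have h := hmin' (lam + t • Pi.single i 1) (fun j => by
      rcases eq_or_ne j i with rfl | hj
      · simpa using ht
      · simpa [hj] using hl j)
    simp only [f, mulVec_add, mulVec_smul, dotProduct_add, add_dotProduct, smul_dotProduct,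
      dotProduct_smul, smul_eq_mul, dotProduct_mulVec_symm hH lam (Pi.single i 1)] at h
    simp only [single_one_dotProduct, dotProduct_single_one, mulVec_single_one,
      Matrix.col_apply] at h
    linarith
  have hd : ∀ i, 0 < H i i := fun i => hH.diag_pos
  have hprim : ∀ i, 0 ≤ η i + (H *ᵥ lam) i := by
    intro i
    by_contra! hneg
    set g := η i + (H *ᵥ lam) i
    have h := hvar i (-g / H i i) (add_nonneg (hl i) (div_nonneg (by linarith) (hd i).le))
    have : -g / H i i * g + (-g / H i i) ^ 2 * (H i i / 2) = -(g ^ 2 / (2 * H i i)) := by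
      field_simp [(hd i).ne']
      ring
    rw [this] at h
    have : 0 < g ^ 2 / (2 * H i i) := div_pos (by nlinarith) (by linarith [hd i])
    linarith
  refine ⟨lam, hl, hprim, fun i => ?_⟩
  by_contra hne
  set g := η i + (H *ᵥ lam) i
  have hlpos : 0 < lam i := lt_of_le_of_ne (hl i) fun h => hne (by rw [← h, zero_mul])
  have hgpos : 0 < g := lt_of_le_of_ne (hprim i) fun h => hne (by rw [← h, mul_zero])
  -- A step down by `s` is feasible and decreases the objective.
  set s := min (lam i) (g / H i i)
  have hs : 0 < s := lt_min hlpos (div_pos hgpos (hd i))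
  have h := hvar i (-s) (by linarith [min_le_left (lam i) (g / H i i)])
  have h2 : s * H i i ≤ g := by
    rw [← le_div_iff₀ (hd i)]
    exact min_le_right _ _
  nlinarith

theorem IsLCP.unique {H : Matrix (Fin m) (Fin m) ℝ} (hH : H.PosDef) {η l₁ l₂ : Fin m → ℝ}
    (h₁ : IsLCP H η l₁) (h₂ : IsLCP H η l₂) : l₁ = l₂ := by
  by_contra hne
  have hpos := hH.dotProduct_mulVec_pos (sub_ne_zero.mpr hne)
  simp only [star_trivial, mulVec_sub, dotProduct, Pi.sub_apply] at hpos
  have : ∑ i, (l₁ i - l₂ i) * ((H *ᵥ l₁) i - (H *ᵥ l₂) i) ≤ 0 := by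
    refine Finset.sum_nonpos fun i _ => ?_
    have a := h₁.compl i
    have b := h₂.compl i
    have c := mul_nonneg (h₁.nonneg i) (h₂.primal i)
    have d := mul_nonneg (h₂.nonneg i) (h₁.primal i)
    linarith
  linarith

/-- The solution of the linear complementarity problem, chosen arbitrarily if there is none. -/
noncomputable def lcpSol (H : Matrix (Fin m) (Fin m) ℝ) (η : Fin m → ℝ) : Fin m → ℝ :=
  Classical.epsilon fun lam => IsLCP H η lam

theorem isLCP_lcpSol {H : Matrix (Fin m) (Fin m) ℝ} (hH : H.PosDef) (η : Fin m → ℝ) :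
    IsLCP H η (lcpSol H η) :=
  Classical.epsilon_spec (exists_isLCP hH η)

/-- The squared norm, in the metric of `H⁻¹`, of the projection of `η` on the nonnegative
orthant. -/
noncomputable def projNormSq (H : Matrix (Fin m) (Fin m) ℝ) (η : Fin m → ℝ) : ℝ :=
  (η + H *ᵥ lcpSol H η) ⬝ᵥ H⁻¹ *ᵥ (η + H *ᵥ lcpSol H η)

theorem IsLCP.projNormSq_eq {H : Matrix (Fin m) (Fin m) ℝ} (hH : H.PosDef) {η lam : Fin m → ℝ}
    (h : IsLCP H η lam) : projNormSq H η = (η + H *ᵥ lam) ⬝ᵥ H⁻¹ *ᵥ (η + H *ᵥ lam) := by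
  rw [projNormSq, (isLCP_lcpSol hH η).unique hH h]

theorem projNormSq_nonneg {H : Matrix (Fin m) (Fin m) ℝ} (hH : H.PosDef) (η : Fin m → ℝ) :
    0 ≤ projNormSq H η := by
  exact hH.inv.posSemidef.dotProduct_mulVec_nonneg (η + H *ᵥ lcpSol H η)

end LCP

/-! ### Faces and the chi-bar-squared law -/

section ChiBar

open Matrix
open scoped MatrixOrder

variable {m : ℕ}

/-- Extension by zero of a vector indexed by `S`. -/
def extendSet (S : Finset (Fin m)) (a : S → ℝ) (i : Fin m) : ℝ :=
  if h : i ∈ S then a ⟨i, h⟩ else 0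

theorem extendSet_of_mem {S : Finset (Fin m)} (a : S → ℝ) (i : S) :
    extendSet S a i = a i := by
  simp [extendSet]

theorem extendSet_of_notMem {S : Finset (Fin m)} (a : S → ℝ) {i : Fin m} (h : i ∉ S) :
    extendSet S a i = 0 := by
  simp [extendSet, h]

theorem dotProduct_extendSet (S : Finset (Fin m)) (t : Fin m → ℝ) (a : S → ℝ) :
    t ⬝ᵥ extendSet S a = (fun i : S => t i) ⬝ᵥ a := by
  simp only [dotProduct]
  rw [← Finset.sum_subset (Finset.subset_univ S), ← Finset.sum_coe_sort S]
  · exact Finset.sum_congr rfl fun i _ => by rw [extendSet_of_mem]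
  · intro i _ hi
    rw [extendSet_of_notMem a hi, mul_zero]

/-- Applying the submatrix `H(S₁, S₂)` is extending by zero from `S₂`, applying `H` and restricting
to `S₁`. -/
theorem mulVec_restrict (H : Matrix (Fin m) (Fin m) ℝ) (S₁ S₂ : Finset (Fin m)) (a : S₂ → ℝ) :
    sub H S₁ S₂ *ᵥ a = fun i : S₁ => (H *ᵥ extendSet S₂ a) i := by
  ext i
  simp only [mulVec, dotProduct_extendSet]
  rfl

theorem extendSet_add_extendSet_compl (S : Finset (Fin m)) (t : Fin m → ℝ) :
    extendSet S (fun i => t i) + extendSet Sᶜ (fun i => t i) = t := by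
  ext i
  by_cases h : i ∈ S <;> simp [extendSet, h]

theorem extendSet_nonneg {S : Finset (Fin m)} {a : S → ℝ} (ha : ∀ i, 0 ≤ a i) (i : Fin m) :
    0 ≤ extendSet S a i := by
  unfold extendSet
  split_ifs
  · exact ha _
  · exact le_rfl

theorem continuous_extendSet (S : Finset (Fin m)) : Continuous fun a : S → ℝ => extendSet S a := by
  refine continuous_pi fun i => ?_
  unfold extendSet
  split_ifs <;> fun_prop

variable {H : Matrix (Fin m) (Fin m) ℝ}

theorem posDef_sub (hH : H.PosDef) (S : Finset (Fin m)) : (sub H S S).PosDef :=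
  hH.submatrix Subtype.val_injective

theorem sub_transpose (hH : H.PosDef) (S T : Finset (Fin m)) : (sub H S T)ᵀ = sub H T S := by
  conv_rhs => rw [← transpose_eq_of_posDef hH]
  rfl

/-- The Schur complement `H(Sᶜ, Sᶜ) - H(Sᶜ, S) H(S, S)⁻¹ H(Sᶜ, S)ᵀ`. -/
noncomputable def schur (H : Matrix (Fin m) (Fin m) ℝ) (S : Finset (Fin m)) :
    Matrix (Sᶜ : Finset (Fin m)) (Sᶜ : Finset (Fin m)) ℝ :=
  sub H Sᶜ Sᶜ - sub H Sᶜ S * (sub H S S)⁻¹ * (sub H Sᶜ S)ᵀ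

/-- The multiplier on the face where the constraints in `S` are active. -/
noncomputable def faceMult (H : Matrix (Fin m) (Fin m) ℝ) (S : Finset (Fin m)) (η : Fin m → ℝ) :
    S → ℝ :=
  -((sub H S S)⁻¹ *ᵥ fun i => η i)

/-- The inactive coordinates of the projection on the face where the constraints in `S` are
active. -/
noncomputable def faceSlack (H : Matrix (Fin m) (Fin m) ℝ) (S : Finset (Fin m)) (η : Fin m → ℝ) :
    (Sᶜ : Finset (Fin m)) → ℝ :=
  (fun i : (Sᶜ : Finset (Fin m)) => η i) + sub H Sᶜ S *ᵥ faceMult H S η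

theorem add_mulVec_faceMult (hH : H.PosDef) (S : Finset (Fin m)) (η : Fin m → ℝ) :
    η + H *ᵥ extendSet S (faceMult H S η) = extendSet Sᶜ (faceSlack H S η) := by
  have hdet : IsUnit (sub H S S).det := (posDef_sub hH S).det_pos.ne'.isUnit
  ext i
  by_cases h : i ∈ S
  · have h1 := congrFun (mulVec_restrict H S S (faceMult H S η)) ⟨i, h⟩
    have h2 : sub H S S *ᵥ faceMult H S η = -fun i : S => η i := by
      rw [faceMult, mulVec_neg, mulVec_mulVec, mul_nonsing_inv _ hdet, one_mulVec]
    rw [h2] at h1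
    rw [extendSet_of_notMem _ (by simpa using h), Pi.add_apply, ← h1]
    simp
  · have h1 := congrFun (mulVec_restrict H Sᶜ S (faceMult H S η)) ⟨i, by simpa using h⟩
    rw [extendSet_of_mem _ (⟨i, by simpa using h⟩ : (Sᶜ : Finset (Fin m))), Pi.add_apply, ← h1]
    simp [faceSlack]

/-- The multipliers and the slacks are coordinates on the whole space, for each `S`. -/
theorem faceMult_eq (hH : H.PosDef) {S : Finset (Fin m)} {η : Fin m → ℝ} {a : S → ℝ}
    {b : (Sᶜ : Finset (Fin m)) → ℝ} (h : η = extendSet Sᶜ b - H *ᵥ extendSet S a) :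
    faceMult H S η = a ∧ faceSlack H S η = b := by
  have hdet : IsUnit (sub H S S).det := (posDef_sub hH S).det_pos.ne'.isUnit
  have h1 : (fun i : S => η i) = -(sub H S S *ᵥ a) := by
    rw [mulVec_restrict]
    ext i
    simp [h, extendSet]
  have ha : faceMult H S η = a := by
    rw [faceMult, h1, mulVec_neg, neg_neg, mulVec_mulVec, nonsing_inv_mul _ hdet, one_mulVec]
  refine ⟨ha, ?_⟩
  rw [faceSlack, ha, mulVec_restrict]
  ext i
  simp [h, extendSet_of_mem]

/-- If `H κ` vanishes on `S`, then it is the Schur complement applied to `κ` on the complement. -/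
theorem schur_mulVec (hH : H.PosDef) {S : Finset (Fin m)} {κ : Fin m → ℝ}
    (h : ∀ i ∈ S, (H *ᵥ κ) i = 0) :
    schur H S *ᵥ (fun i => κ i) = fun i : (Sᶜ : Finset (Fin m)) => (H *ᵥ κ) i := by
  have hdet : IsUnit (sub H S S).det := (posDef_sub hH S).det_pos.ne'.isUnit
  have hk := extendSet_add_extendSet_compl S κ
  have h0 : sub H S S *ᵥ (fun i => κ i) + sub H S Sᶜ *ᵥ (fun i => κ i) = 0 := by
    rw [mulVec_restrict, mulVec_restrict]
    ext i
    have := h i i.2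
    rw [← hk, mulVec_add] at this
    exact this
  have h1 : (sub H S S)⁻¹ *ᵥ (sub H S Sᶜ *ᵥ fun i => κ i) = -fun i : S => κ i := by
    rw [eq_neg_of_add_eq_zero_right h0, mulVec_neg, mulVec_mulVec, nonsing_inv_mul _ hdet,
      one_mulVec]
  rw [schur, sub_transpose hH, Matrix.sub_mulVec, Matrix.mul_assoc, ← mulVec_mulVec,
    ← mulVec_mulVec, h1, mulVec_neg, sub_neg_eq_add, mulVec_restrict, mulVec_restrict]
  ext i
  conv_rhs => rw [← hk, mulVec_add]
  simp [add_comm]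

theorem posDef_schur (hH : H.PosDef) (S : Finset (Fin m)) : (schur H S).PosDef := by
  have hdet : IsUnit (sub H S S).det := (posDef_sub hH S).det_pos.ne'.isUnit
  refine PosDef.of_dotProduct_mulVec_pos ?_ fun b hb => ?_
  · rw [IsHermitian, conjTranspose_eq_transpose_of_trivial, schur, transpose_sub, transpose_mul,
      transpose_mul, transpose_transpose, transpose_nonsing_inv, sub_transpose hH,
      sub_transpose hH, Matrix.mul_assoc]
  -- The quadratic form of the Schur complement at `b` is that of `H` at the vector `κ` which
  -- extends `b` and makes `H κ` vanish on `S`.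
  · set κ : Fin m → ℝ := extendSet S (-((sub H S S)⁻¹ *ᵥ (sub H S Sᶜ *ᵥ b))) + extendSet Sᶜ b
    have hκS : ∀ i ∈ S, (H *ᵥ κ) i = 0 := by
      intro i hi
      have h1 := congrFun (mulVec_restrict H S S (-((sub H S S)⁻¹ *ᵥ (sub H S Sᶜ *ᵥ b)))) ⟨i, hi⟩
      have h2 := congrFun (mulVec_restrict H S Sᶜ b) ⟨i, hi⟩
      rw [mulVec_neg, mulVec_mulVec, mul_nonsing_inv _ hdet, one_mulVec] at h1
      simp only [κ, mulVec_add, Pi.add_apply]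
      rw [← h1, ← h2]
      simp
    have hκb : (fun i : (Sᶜ : Finset (Fin m)) => κ i) = b := by
      ext i
      have : (i : Fin m) ∉ S := Finset.mem_compl.mp i.2
      simp [κ, extendSet_of_notMem _ this, extendSet_of_mem]
    have hs := schur_mulVec hH hκS
    rw [hκb] at hs
    have hκ0 : κ ≠ 0 := by
      intro h0
      apply hb
      rw [← hκb, h0]
      rfl
    have hpos := hH.dotProduct_mulVec_pos hκ0
    have hx : H *ᵥ κ = extendSet Sᶜ (fun i => (H *ᵥ κ) i) := by
      have := extendSet_add_extendSet_compl S (H *ᵥ κ)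
      have h0 : extendSet S (fun i => (H *ᵥ κ) i) = 0 := by
        ext i
        by_cases h : i ∈ S
        · simp [extendSet, hκS i h]
        · simp [extendSet, h]
      rw [h0, zero_add] at this
      exact this.symm
    rw [star_trivial, hx, dotProduct_extendSet, hκb] at hpos
    rwa [star_trivial, hs]

theorem isLCP_of_face (hH : H.PosDef) {S : Finset (Fin m)} {η : Fin m → ℝ}
    (ha : ∀ i, 0 ≤ faceMult H S η i) (hb : ∀ i, 0 ≤ faceSlack H S η i) :
    IsLCP H η (extendSet S (faceMult H S η)) := by
  have hx : ∀ i, η i + (H *ᵥ extendSet S (faceMult H S η)) i =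
      extendSet Sᶜ (faceSlack H S η) i := congrFun (add_mulVec_faceMult hH S η)
  refine ⟨extendSet_nonneg ha, fun i => ?_, fun i => ?_⟩
  · rw [hx]
    exact extendSet_nonneg hb i
  · rw [hx]
    by_cases h : i ∈ S <;> simp [extendSet, h]

/-- On a face, the squared norm of the projection is a quadratic form in the slacks only. -/
theorem projNormSq_of_face (hH : H.PosDef) {S : Finset (Fin m)} {η : Fin m → ℝ}
    (ha : ∀ i, 0 ≤ faceMult H S η i) (hb : ∀ i, 0 ≤ faceSlack H S η i) :
    projNormSq H η = faceSlack H S η ⬝ᵥ (schur H S)⁻¹ *ᵥ faceSlack H S η := by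
  have hdet : IsUnit H.det := hH.det_pos.ne'.isUnit
  have hdet2 : IsUnit (schur H S).det := (posDef_schur hH S).det_pos.ne'.isUnit
  rw [(isLCP_of_face hH ha hb).projNormSq_eq hH, add_mulVec_faceMult hH]
  set b := faceSlack H S η
  set κ := H⁻¹ *ᵥ extendSet Sᶜ b
  have hκ : H *ᵥ κ = extendSet Sᶜ b := by
    rw [mulVec_mulVec, mul_nonsing_inv _ hdet, one_mulVec]
  have hs := schur_mulVec (S := S) (κ := κ) hH fun i hi => by
    rw [hκ, extendSet_of_notMem _ (by simpa using hi)]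
  have hb' : (fun i : (Sᶜ : Finset (Fin m)) => (H *ᵥ κ) i) = b := by
    ext i
    rw [hκ, extendSet_of_mem]
  rw [hb'] at hs
  rw [dotProduct_comm, dotProduct_extendSet, ← hs, mulVec_mulVec, nonsing_inv_mul _ hdet2,
    one_mulVec, dotProduct_comm]

/-- The vectors whose projection has active constraints `S` and inactive constraints `Sᶜ`.  The
inequalities are weak, so the faces are closed and overlap in their boundaries. -/
def face (H : Matrix (Fin m) (Fin m) ℝ) (S : Finset (Fin m)) : Set (EuclideanSpace ℝ (Fin m)) :=
  {η | (∀ i, 0 ≤ faceMult H S η.ofLp i) ∧ ∀ i, 0 ≤ faceSlack H S η.ofLp i}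

theorem continuous_faceMult (S : Finset (Fin m)) :
    Continuous fun η : EuclideanSpace ℝ (Fin m) => faceMult H S η.ofLp := by
  unfold faceMult
  fun_prop

theorem continuous_faceSlack (S : Finset (Fin m)) :
    Continuous fun η : EuclideanSpace ℝ (Fin m) => faceSlack H S η.ofLp := by
  unfold faceSlack
  have := continuous_faceMult (H := H) S
  fun_prop

theorem isClosed_face (S : Finset (Fin m)) : IsClosed (face H S) := by
  have h1 := continuous_faceMult (H := H) S
  have h2 := continuous_faceSlack (H := H) S
  have : face H S = (fun η : EuclideanSpace ℝ (Fin m) => faceMult H S η.ofLp) ⁻¹' Set.Ici 0 ∩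
      (fun η : EuclideanSpace ℝ (Fin m) => faceSlack H S η.ofLp) ⁻¹' Set.Ici 0 := rfl
  rw [this]
  exact (isClosed_Ici.preimage h1).inter (isClosed_Ici.preimage h2)

/-- Each vector is in the face of the active constraints of its projection. -/
theorem iUnion_face (hH : H.PosDef) : ⋃ S, face H S = Set.univ := by
  classical
  refine Set.eq_univ_of_forall fun η => Set.mem_iUnion.mpr ?_
  obtain ⟨lam, h⟩ := exists_isLCP hH η.ofLp
  set S : Finset (Fin m) := Finset.univ.filter fun i => η.ofLp i + (H *ᵥ lam) i = 0
  have hl : extendSet S (fun i => lam i) = lam := by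
    ext i
    by_cases hi : i ∈ S
    · simp [extendSet, hi]
    · rw [extendSet_of_notMem _ hi]
      have hne : η.ofLp i + (H *ᵥ lam) i ≠ 0 := by simpa [S] using hi
      exact ((mul_eq_zero.mp (h.compl i)).resolve_right hne).symm
  have hx : extendSet Sᶜ (fun i => (η.ofLp + H *ᵥ lam) i) = η.ofLp + H *ᵥ lam := by
    ext i
    by_cases hi : i ∈ S
    · rw [extendSet_of_notMem _ (by simpa using hi)]
      have : η.ofLp i + (H *ᵥ lam) i = 0 := by simpa [S] using hi
      exact this.symm
    · simp [extendSet, hi]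
  obtain ⟨ha, hb⟩ := faceMult_eq hH (S := S) (η := η.ofLp) (a := fun i => lam i)
    (b := fun i => (η.ofLp + H *ᵥ lam) i) (by rw [hl, hx]; simp)
  refine ⟨S, ?_, ?_⟩
  · rw [ha]
    exact fun i => h.nonneg i
  · rw [hb]
    exact fun i => h.primal i

/-- The squared norm of the projection is continuous, as it is on each of the finitely many closed
faces. -/
theorem continuous_projNormSq (hH : H.PosDef) :
    Continuous fun η : EuclideanSpace ℝ (Fin m) => projNormSq H η.ofLp := by
  refine (locallyFinite_of_finite (face H)).continuous (iUnion_face hH) isClosed_face fun S => ?_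
  have h2 := continuous_faceSlack (H := H) S
  refine ContinuousOn.congr (f := fun η : EuclideanSpace ℝ (Fin m) =>
    faceSlack H S η.ofLp ⬝ᵥ (schur H S)⁻¹ *ᵥ faceSlack H S η.ofLp) ?_ ?_
  · apply Continuous.continuousOn
    fun_prop
  · exact fun η hη => projNormSq_of_face hH hη.1 hη.2

/-- The multipliers and the slacks of a face are independent Gaussian vectors, with the covariance
matrices `H(S, S)⁻¹` and the Schur complement: this is stated as a decomposition of the law of `η`,
and read off from the characteristic functions. -/
theorem map_face_prod (hH : H.PosDef) (S : Finset (Fin m)) :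
    ((multivariateGaussian 0 (sub H S S)⁻¹).prod (multivariateGaussian 0 (schur H S))).map
      (fun p => WithLp.toLp 2 (extendSet Sᶜ p.2.ofLp - H *ᵥ extendSet S p.1.ofLp)) =
    multivariateGaussian 0 H := by
  have h1 := continuous_extendSet S
  have h2 := continuous_extendSet Sᶜ
  have hm : Measurable fun p : EuclideanSpace ℝ S × EuclideanSpace ℝ (Sᶜ : Finset (Fin m)) =>
      WithLp.toLp 2 (extendSet Sᶜ p.2.ofLp - H *ᵥ extendSet S p.1.ofLp) := by
    apply Continuous.measurable
    fun_prop
  have : IsProbabilityMeasure (((multivariateGaussian 0 (sub H S S)⁻¹).prod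
      (multivariateGaussian 0 (schur H S))).map (fun p =>
        WithLp.toLp 2 (extendSet Sᶜ p.2.ofLp - H *ᵥ extendSet S p.1.ofLp))) :=
    Measure.isProbabilityMeasure_map hm.aemeasurable
  have hdet : IsUnit (sub H S S).det := (posDef_sub hH S).det_pos.ne'.isUnit
  refine Measure.ext_of_charFun ?_
  ext t
  set α : S → ℝ := fun i => (H *ᵥ t.ofLp) i
  set β : (Sᶜ : Finset (Fin m)) → ℝ := fun i => t.ofLp i
  have hin : ∀ (a : EuclideanSpace ℝ S) (b : EuclideanSpace ℝ (Sᶜ : Finset (Fin m))),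
      inner ℝ (WithLp.toLp 2 (extendSet Sᶜ b.ofLp - H *ᵥ extendSet S a.ofLp)) t =
      inner ℝ a (WithLp.toLp 2 (-α)) + inner ℝ b (WithLp.toLp 2 β) := by
    intro a b
    simp only [EuclideanSpace.inner_eq_star_dotProduct, star_trivial, neg_dotProduct]
    rw [dotProduct_sub, dotProduct_extendSet, dotProduct_mulVec_symm hH,
      dotProduct_comm (extendSet S _), dotProduct_extendSet]
    ring
  rw [charFun_multivariateGaussian hH.posSemidef, charFun_apply,
    integral_map hm.aemeasurable (by fun_prop)]
  simp_rw [hin, Complex.ofReal_add, add_mul, Complex.exp_add]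
  rw [integral_prod_mul (f := fun a : EuclideanSpace ℝ S =>
      Complex.exp ((inner ℝ a (WithLp.toLp 2 (-α)) : ℝ) * Complex.I))
    (g := fun b : EuclideanSpace ℝ (Sᶜ : Finset (Fin m)) =>
      Complex.exp ((inner ℝ b (WithLp.toLp 2 β) : ℝ) * Complex.I)), ← charFun_apply,
    ← charFun_apply, charFun_multivariateGaussian (posDef_sub hH S).inv.posSemidef,
    charFun_multivariateGaussian (posDef_schur hH S).posSemidef, ← Complex.exp_add]
  -- Completing the square: `α = H(S,S) t_S + H(S,Sᶜ) β`.
  have hα : α = sub H S S *ᵥ (fun i => t.ofLp i) + sub H S Sᶜ *ᵥ β := by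
    rw [mulVec_restrict, mulVec_restrict]
    ext i
    have := congrFun (congrArg (H *ᵥ ·) (extendSet_add_extendSet_compl S t.ofLp)) i
    simp only [mulVec_add] at this
    exact this.symm
  have hinv : (sub H S S)⁻¹ *ᵥ α =
      (fun i : S => t.ofLp i) + (sub H S S)⁻¹ *ᵥ (sub H S Sᶜ *ᵥ β) := by
    rw [hα, mulVec_add, mulVec_mulVec, nonsing_inv_mul _ hdet, one_mulVec]
  have hβ : sub H Sᶜ S *ᵥ ((sub H S S)⁻¹ *ᵥ α) + schur H S *ᵥ β =
      fun i : (Sᶜ : Finset (Fin m)) => (H *ᵥ t.ofLp) i := by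
    rw [hinv, schur, sub_transpose hH, Matrix.sub_mulVec, mulVec_add, Matrix.mul_assoc,
      ← mulVec_mulVec, ← mulVec_mulVec, mulVec_restrict, mulVec_restrict H Sᶜ Sᶜ]
    ext i
    have := congrFun (congrArg (H *ᵥ ·) (extendSet_add_extendSet_compl S t.ofLp)) i
    simp only [mulVec_add] at this
    simp only [Pi.add_apply, Pi.sub_apply] at this ⊢
    rw [← this]
    ring
  have hq : α ⬝ᵥ (sub H S S)⁻¹ *ᵥ α + β ⬝ᵥ schur H S *ᵥ β = t.ofLp ⬝ᵥ H *ᵥ t.ofLp := by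
    have e1 : t.ofLp ⬝ᵥ H *ᵥ t.ofLp = (fun i : S => t.ofLp i) ⬝ᵥ α +
        β ⬝ᵥ fun i : (Sᶜ : Finset (Fin m)) => (H *ᵥ t.ofLp) i := by
      conv_lhs => rw [← extendSet_add_extendSet_compl S (H *ᵥ t.ofLp)]
      rw [dotProduct_add, dotProduct_extendSet, dotProduct_extendSet]
    have e2 : β ⬝ᵥ sub H Sᶜ S *ᵥ ((sub H S S)⁻¹ *ᵥ α) =
        α ⬝ᵥ (sub H S S)⁻¹ *ᵥ α - (fun i : S => t.ofLp i) ⬝ᵥ α := by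
      rw [dotProduct_mulVec, ← mulVec_transpose, sub_transpose hH]
      have e3 : sub H S Sᶜ *ᵥ β = α - sub H S S *ᵥ fun i => t.ofLp i := by
        rw [hα]
        simp
      rw [e3, sub_dotProduct]
      congr 1
      rw [dotProduct_comm, dotProduct_mulVec, ← mulVec_transpose, sub_transpose hH, mulVec_mulVec,
        mul_nonsing_inv _ hdet, one_mulVec, dotProduct_comm]
    rw [e1, ← hβ, dotProduct_add, e2]
    ring
  simp only [inner_zero_right, mulVec_neg, neg_dotProduct, dotProduct_neg, neg_neg]
  rw [← hq]
  push_cast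
  congr 1
  ring

/-- A face contributes the probability that its multipliers and its slacks are nonnegative, times a
chi-squared probability with as many degrees of freedom as there are slacks. -/
theorem measure_face_inter (hH : H.PosDef) (S : Finset (Fin m)) {A : Set ℝ}
    (hA : MeasurableSet A) :
    multivariateGaussian 0 H (face H S ∩ (fun η => projNormSq H η.ofLp) ⁻¹' A) =
      multivariateGaussian 0 (sub H S S)⁻¹ {z | ∀ i, 0 ≤ z i} *
        (multivariateGaussian 0 (schur H S) {z | ∀ i, 0 ≤ z i} * chiSq (m - S.card) A) := by
  have hcard : Fintype.card (Sᶜ : Finset (Fin m)) = m - S.card := by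
    rw [Fintype.card_coe, Finset.card_compl, Fintype.card_fin]
  rw [← hcard, ← multivariateGaussian_orthant_inter (posDef_schur hH S) hA, ← Measure.prod_prod,
    ← map_face_prod hH S]
  have h1 := continuous_extendSet S
  have h2 := continuous_extendSet Sᶜ
  have hm : Measurable fun p : EuclideanSpace ℝ S × EuclideanSpace ℝ (Sᶜ : Finset (Fin m)) =>
      WithLp.toLp 2 (extendSet Sᶜ p.2.ofLp - H *ᵥ extendSet S p.1.ofLp) := by
    apply Continuous.measurable
    fun_prop
  rw [Measure.map_apply hm ((isClosed_face S).measurableSet.inter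
    ((continuous_projNormSq hH).measurable hA))]
  congr 1
  ext p
  obtain ⟨ha, hb⟩ := faceMult_eq hH (S := S) (a := p.1.ofLp) (b := p.2.ofLp)
    (η := extendSet Sᶜ p.2.ofLp - H *ᵥ extendSet S p.1.ofLp) rfl
  simp only [Set.mem_preimage, Set.mem_inter_iff, face, Set.mem_ofPred_eq, ha, hb, Set.mem_prod]
  constructor
  · rintro ⟨⟨h1, h2⟩, h3⟩
    refine ⟨h1, h2, ?_⟩
    rwa [projNormSq_of_face hH (S := S) (by rwa [ha]) (by rwa [hb]), hb] at h3
  · rintro ⟨h1, h2, h3⟩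
    refine ⟨⟨h1, h2⟩, ?_⟩
    rwa [projNormSq_of_face hH (S := S) (by rwa [ha]) (by rwa [hb]), hb]

/-- Two faces overlap in a null set: where they do, some multiplier of one of them vanishes. -/
theorem measure_face_inter_face (hH : H.PosDef) {S T : Finset (Fin m)} (h : ¬ S ⊆ T) :
    multivariateGaussian 0 H (face H S ∩ face H T) = 0 := by
  obtain ⟨i, hiS, hiT⟩ := Finset.not_subset.mp h
  set a : Fin m → ℝ := extendSet S ((sub H S S)⁻¹.row ⟨i, hiS⟩)
  have hval : ∀ η : Fin m → ℝ, faceMult H S η ⟨i, hiS⟩ = -(a ⬝ᵥ η) := by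
    intro η
    rw [dotProduct_comm, dotProduct_extendSet, dotProduct_comm]
    rfl
  have ha : a ≠ 0 := by
    intro h0
    have h1 := (posDef_sub hH S).inv.diag_pos (i := ⟨i, hiS⟩)
    have h2 : a i = (sub H S S)⁻¹ ⟨i, hiS⟩ ⟨i, hiS⟩ :=
      extendSet_of_mem (S := S) _ (⟨i, hiS⟩ : S)
    rw [← h2, h0] at h1
    exact lt_irrefl _ h1
  refine measure_mono_null (fun η hη => ?_) (multivariateGaussian_hyperplane hH ha)
  have e := (isLCP_of_face hH hη.1.1 hη.1.2).unique hH (isLCP_of_face hH hη.2.1 hη.2.2)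
  have e1 := congrFun e i
  rw [extendSet_of_mem (S := S) _ (⟨i, hiS⟩ : S), extendSet_of_notMem _ hiT, hval] at e1
  exact neg_eq_zero.mp e1

/-- The squared norm of the projection of a Gaussian vector with covariance `H` follows the mixture
of chi-squared laws with the weights `weight H`. -/
theorem measure_projNormSq (hH : H.PosDef) {A : Set ℝ} (hA : MeasurableSet A) :
    (multivariateGaussian 0 H).real ((fun η => projNormSq H η.ofLp) ⁻¹' A) =
      ∑ j ∈ Finset.range (m + 1), weight H j * (chiSq (m - j)).real A := by
  set Q : EuclideanSpace ℝ (Fin m) → ℝ := fun η => projNormSq H η.ofLp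
  have hQ : MeasurableSet (Q ⁻¹' A) := (continuous_projNormSq hH).measurable hA
  have hun : Q ⁻¹' A = ⋃ S ∈ (Finset.univ : Finset (Finset (Fin m))), face H S ∩ Q ⁻¹' A := by
    simp only [Finset.mem_univ, Set.iUnion_true, ← Set.iUnion_inter, iUnion_face hH,
      Set.univ_inter]
  have hd : ((Finset.univ : Finset (Finset (Fin m))) : Set (Finset (Fin m))).Pairwise
      (Function.onFun (AEDisjoint (multivariateGaussian 0 H)) fun S => face H S ∩ Q ⁻¹' A) := by
    intro S _ T _ hne
    have : ¬ S ⊆ T ∨ ¬ T ⊆ S := by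
      by_contra! hc
      exact hne (hc.1.antisymm hc.2)
    refine measure_mono_null (t := face H S ∩ face H T) (fun η hη => ⟨hη.1.1, hη.2.1⟩) ?_
    rcases this with h | h
    · exact measure_face_inter_face hH h
    · rw [Set.inter_comm]
      exact measure_face_inter_face hH h
  have hsum : multivariateGaussian 0 H (Q ⁻¹' A) =
      ∑ S : Finset (Fin m), multivariateGaussian 0 H (face H S ∩ Q ⁻¹' A) := by
    conv_lhs => rw [hun]
    exact measure_biUnion_finset₀ hd fun S _ =>
      ((isClosed_face S).measurableSet.inter hQ).nullMeasurableSet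
  have hreal : (multivariateGaussian 0 H).real (Q ⁻¹' A) = ∑ S : Finset (Fin m),
      orthantProb (sub H S S)⁻¹ * orthantProb (schur H S) * (chiSq (m - S.card)).real A := by
    rw [Measure.real, hsum, ENNReal.toReal_sum fun S _ => measure_ne_top _ _]
    refine Finset.sum_congr rfl fun S _ => ?_
    rw [measure_face_inter hH S hA, ENNReal.toReal_mul, ENNReal.toReal_mul, mul_assoc]
    rfl
  rw [hreal, ← Finset.powerset_univ, Finset.sum_powerset, Finset.card_univ, Fintype.card_fin]
  refine Finset.sum_congr rfl fun j _ => ?_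
  rw [weight, Finset.sum_mul]
  refine Finset.sum_congr rfl fun S hS => ?_
  rw [(Finset.mem_powersetCard.mp hS).2]
  rfl

theorem sum_weight (hH : H.PosDef) : ∑ j ∈ Finset.range (m + 1), weight H j = 1 := by
  have h := measure_projNormSq hH .univ
  simpa using h.symm

theorem measure_projNormSq_eq_zero (hH : H.PosDef) {x : ℝ} (hx : 0 < x) :
    (multivariateGaussian 0 H).real {η | projNormSq H η.ofLp = x} = 0 := by
  have h := measure_projNormSq hH (measurableSet_singleton x)
  rw [Finset.sum_eq_zero fun j _ => by rw [Measure.real, chiSq_singleton _ hx]; simp] at h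
  exact h

/-- Up to a null set, the projection vanishes only in the interior of the polar cone, where all
the multipliers are positive. -/
theorem measure_projNormSq_nonpos (hH : H.PosDef) :
    (multivariateGaussian 0 H).real {η | projNormSq H η.ofLp ≤ 0} ≤
      (multivariateGaussian 0 H).real {η | ∀ i, (H⁻¹ *ᵥ η.ofLp) i < 0} := by
  have hdet : IsUnit H.det := hH.det_pos.ne'.isUnit
  have hnull : multivariateGaussian 0 H
      (⋃ i, {η : EuclideanSpace ℝ (Fin m) | H⁻¹.row i ⬝ᵥ η.ofLp = 0}) = 0 := by
    refine measure_iUnion_null fun i => multivariateGaussian_hyperplane hH fun h0 => ?_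
    have h1 := hH.inv.diag_pos (i := i)
    have h2 : H⁻¹ i i = 0 := congrFun h0 i
    exact h1.ne' h2
  have hsub : {η : EuclideanSpace ℝ (Fin m) | projNormSq H η.ofLp ≤ 0} ⊆
      {η | ∀ i, (H⁻¹ *ᵥ η.ofLp) i < 0} ∪
        ⋃ i, {η : EuclideanSpace ℝ (Fin m) | H⁻¹.row i ⬝ᵥ η.ofLp = 0} := by
    intro η hη
    have hη' : projNormSq H η.ofLp ≤ 0 := hη
    have hsol := isLCP_lcpSol hH η.ofLp
    set lam := lcpSol H η.ofLp
    have hx : η.ofLp + H *ᵥ lam = 0 := by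
      by_contra hne
      have := hH.inv.dotProduct_mulVec_pos hne
      rw [star_trivial, ← hsol.projNormSq_eq hH] at this
      linarith
    have hl : H⁻¹ *ᵥ η.ofLp = -lam := by
      rw [eq_neg_of_add_eq_zero_left hx, mulVec_neg, mulVec_mulVec, nonsing_inv_mul _ hdet,
        one_mulVec]
    by_cases hz : ∃ i, lam i = 0
    · right
      obtain ⟨i, hi⟩ := hz
      refine Set.mem_iUnion.mpr ⟨i, ?_⟩
      have := congrFun hl i
      rw [Pi.neg_apply, hi, neg_zero] at this
      exact this
    · left
      push Not at hz
      intro i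
      rw [hl, Pi.neg_apply, neg_lt_zero]
      exact lt_of_le_of_ne (hsol.nonneg i) (hz i).symm
  calc (multivariateGaussian 0 H).real {η | projNormSq H η.ofLp ≤ 0}
      ≤ _ := measureReal_mono hsub
    _ ≤ _ := measureReal_union_le _ _
    _ = _ := by
      rw [measureReal_def (multivariateGaussian 0 H) (⋃ i, _), hnull, ENNReal.toReal_zero,
        add_zero]

end ChiBar

/-! ### Weighted isotonic regression -/

section Isotonic

open Matrix

variable {m : ℕ}

/-- The vector of the successive differences `u_l - u_{l+1}`. -/
def diffOp (u : Fin (m + 1) → ℝ) (l : Fin m) : ℝ :=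
  u l.castSucc - u l.succ

/-- The adjoint of `diffOp`, with entries `lam_j - lam_{j-1}` where `lam_{-1} = lam_m = 0`. -/
def diffAdj (lam : Fin m → ℝ) (j : Fin (m + 1)) : ℝ :=
  extendZero lam j - Fin.cases (motive := fun _ => ℝ) 0 lam j

theorem extendZero_castSucc (v : Fin m → ℝ) (l : Fin m) : extendZero v l.castSucc = v l := by
  simp [extendZero]

theorem extendZero_last (v : Fin m → ℝ) : extendZero v (Fin.last m) = 0 := by
  simp [extendZero]

theorem sum_diffAdj_mul (lam : Fin m → ℝ) (c : Fin (m + 1) → ℝ) :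
    ∑ j, diffAdj lam j * c j = ∑ l, lam l * diffOp c l := by
  simp only [diffAdj, sub_mul, Finset.sum_sub_distrib, diffOp, mul_sub]
  rw [Fin.sum_univ_castSucc,
    Fin.sum_univ_succ (fun j => Fin.cases (motive := fun _ => ℝ) 0 lam j * c j)]
  simp [extendZero_castSucc, extendZero_last]

theorem sum_diffAdj (lam : Fin m → ℝ) : ∑ j, diffAdj lam j = 0 := by
  have := sum_diffAdj_mul lam fun _ => 1
  simpa [diffOp] using this

theorem diffAdj_add (a b : Fin m → ℝ) (j : Fin (m + 1)) :
    diffAdj (a + b) j = diffAdj a j + diffAdj b j := by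
  have h1 : extendZero (a + b) j = extendZero a j + extendZero b j := by
    unfold extendZero
    split_ifs <;> simp
  have h2 : Fin.cases (motive := fun _ => ℝ) 0 (a + b) j =
      Fin.cases (motive := fun _ => ℝ) 0 a j + Fin.cases (motive := fun _ => ℝ) 0 b j := by
    refine Fin.cases ?_ (fun l => ?_) j <;> simp
  rw [diffAdj, diffAdj, diffAdj, h1, h2]
  ring

theorem continuous_diffAdj (j : Fin (m + 1)) : Continuous fun lam : Fin m → ℝ => diffAdj lam j := by
  refine Continuous.sub ?_ ?_
  · unfold extendZero
    split_ifs <;> fun_prop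
  · refine Fin.cases ?_ (fun l => ?_) j
    · exact continuous_const
    · exact continuous_apply l

theorem sum_diffAdj_le (lam : Fin m → ℝ) (l : Fin m) :
    ∑ j, diffAdj lam j * (if j ≤ l.castSucc then 1 else 0) = lam l := by
  rw [sum_diffAdj_mul, Finset.sum_eq_single l]
  · simp [diffOp]
  · intro i _ hi
    have : (i.castSucc ≤ l.castSucc) ↔ (i.succ ≤ l.castSucc) := by
      rw [Fin.le_def, Fin.le_def]
      have : (i : ℕ) ≠ l := fun h => hi (Fin.ext h)
      simp only [Fin.val_castSucc, Fin.val_succ]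
      omega
    simp [diffOp, this]
  · simp

/-- On the vectors with sum zero, taking partial sums inverts `diffAdj`. -/
theorem diffAdj_partialSum {V : Fin (m + 1) → ℝ} (hV : ∑ j, V j = 0) (j : Fin (m + 1)) :
    diffAdj (fun l => ∑ i, if i ≤ l.castSucc then V i else 0) j = V j := by
  have h1 : ∀ j : Fin (m + 1),
      extendZero (fun l : Fin m => ∑ i, if i ≤ l.castSucc then V i else 0) j =
      ∑ i, if i ≤ j then V i else 0 := by
    intro j
    refine Fin.lastCases ?_ (fun l => ?_) j
    · rw [extendZero_last]
      simp [Fin.le_last, hV]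
    · rw [extendZero_castSucc]
  have h2 : ∀ j : Fin (m + 1), Fin.cases (motive := fun _ => ℝ) 0
      (fun l : Fin m => ∑ i, if i ≤ l.castSucc then V i else 0) j =
      ∑ i, if i < j then V i else 0 := by
    intro j
    refine Fin.cases ?_ (fun l => ?_) j
    · simp
    · simp [Fin.le_castSucc_iff]
  rw [diffAdj, h1, h2, ← Finset.sum_sub_distrib, Finset.sum_eq_single j]
  · simp
  · intro i _ hi
    have : i ≤ j ↔ i < j := ⟨fun h => lt_of_le_of_ne h hi, le_of_lt⟩
    simp [this]
  · simp

theorem diffAdj_neg_partialSum {V : Fin (m + 1) → ℝ} (hV : ∑ j, V j = 0) (j : Fin (m + 1)) :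
    diffAdj (-fun l => ∑ i, if i ≤ l.castSucc then V i else 0) j = -V j := by
  set L : Fin m → ℝ := fun l => ∑ i, if i ≤ l.castSucc then V i else 0
  have h := diffAdj_add (-L) L j
  have h0 : diffAdj (0 : Fin m → ℝ) j = 0 := by
    have h1 := diffAdj_add (0 : Fin m → ℝ) 0 j
    rw [add_zero] at h1
    linarith
  rw [neg_add_cancel, h0, diffAdj_partialSum hV] at h
  linarith

/-- `matH` is, up to the factor, `D diag(1/q) Dᵀ` for the difference operator `D`. -/
theorem matH_mulVec (ν : Fin 2 → ℝ) {q : Fin (m + 1) → ℝ} (hq : ∀ j, 0 < q j) (t : Fin m → ℝ)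
    (l : Fin m) :
    (matH ν q *ᵥ t) l = 1 / (ν 0 * ν 1) * diffOp (fun j => diffAdj t j / q j) l := by
  have key : ∀ x : Fin m, matH ν q l x * t x = 1 / (ν 0 * ν 1) *
      ((if x = l then (q l.castSucc + q l.succ) / (q l.castSucc * q l.succ) * t l else 0) -
        (if (x : ℕ) = l + 1 then t x / q l.succ else 0) -
        (if (l : ℕ) = x + 1 then t x / q l.castSucc else 0)) := by
    intro x
    unfold matH
    rcases lt_trichotomy (x : ℕ) (l : ℕ) with h | h | h
    · have h1 : l ≠ x := fun e => by simp [e] at h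
      have h2 : (x : ℕ) ≠ l + 1 := by omega
      simp only [h1, h1.symm, h2, if_false]
      split_ifs <;> ring
    · have h1 : x = l := Fin.ext h
      subst h1
      simp
      ring
    · have h1 : l ≠ x := fun e => by simp [e] at h
      have h2 : (l : ℕ) ≠ x + 1 := by omega
      simp only [h1, h1.symm, h2, if_false]
      by_cases h3 : (x : ℕ) = l + 1
      · have h4 : x.castSucc = l.succ := Fin.ext (by simp [h3])
        simp only [h3, h4, if_true]
        ring
      · simp [h3]
  have hnext : (∑ x : Fin m, if (x : ℕ) = l + 1 then t x / q l.succ else 0) =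
      extendZero t l.succ / q l.succ := by
    unfold extendZero
    by_cases h : ((l.succ : Fin (m + 1)) : ℕ) < m
    · have h' : (l : ℕ) + 1 < m := by simpa using h
      rw [dif_pos h, Finset.sum_eq_single (⟨l + 1, h'⟩ : Fin m)]
      · simp
      · intro b _ hb
        exact if_neg fun e => hb (Fin.ext e)
      · simp
    · rw [dif_neg h, zero_div]
      refine Finset.sum_eq_zero fun x _ => if_neg ?_
      have h' : ¬ (l : ℕ) + 1 < m := by simpa using h
      have := x.isLt
      omega
  have hprev : (∑ x : Fin m, if (l : ℕ) = x + 1 then t x / q l.castSucc else 0) =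
      Fin.cases (motive := fun _ => ℝ) 0 t l.castSucc / q l.castSucc := by
    rcases Nat.eq_zero_or_pos (l : ℕ) with h | h
    · have h0 : l.castSucc = 0 := Fin.ext h
      rw [Finset.sum_eq_zero fun x _ => if_neg (by omega), h0]
      simp
    · have hl : (l : ℕ) - 1 < m := by have := l.isLt; omega
      have h0 : l.castSucc = (⟨l - 1, hl⟩ : Fin m).succ := Fin.ext (by simp; omega)
      rw [Finset.sum_eq_single (⟨l - 1, hl⟩ : Fin m)]
      · rw [h0]
        have : (l : ℕ) = ((⟨l - 1, hl⟩ : Fin m) : ℕ) + 1 := by simp; omega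
        rw [if_pos this, Fin.cases_succ]
      · intro b _ hb
        refine if_neg fun e => hb (Fin.ext ?_)
        simp
        omega
      · simp
  unfold mulVec dotProduct
  simp only [key, ← Finset.mul_sum, Finset.sum_sub_distrib, Finset.sum_ite_eq', Finset.mem_univ,
    if_true, hnext, hprev, diffOp, diffAdj, extendZero_castSucc, Fin.cases_succ]
  have h1 := (hq l.castSucc).ne'
  have h2 := (hq l.succ).ne'
  field_simp
  ring

theorem dotProduct_matH_mulVec (ν : Fin 2 → ℝ) {q : Fin (m + 1) → ℝ} (hq : ∀ j, 0 < q j)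
    (s t : Fin m → ℝ) :
    s ⬝ᵥ matH ν q *ᵥ t = 1 / (ν 0 * ν 1) * ∑ j, diffAdj s j * diffAdj t j / q j := by
  have h := sum_diffAdj_mul s fun j => diffAdj t j / q j
  simp only [mul_div_assoc, h, dotProduct, matH_mulVec ν hq, Finset.mul_sum]
  exact Finset.sum_congr rfl fun l _ => by ring

theorem posDef_matH {ν : Fin 2 → ℝ} (hν : ∀ i, 0 < ν i) {q : Fin (m + 1) → ℝ}
    (hq : ∀ j, 0 < q j) : (matH ν q).PosDef := by
  have hnn : 0 < 1 / (ν 0 * ν 1) := by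
    have := hν 0
    have := hν 1
    positivity
  refine PosDef.of_dotProduct_mulVec_pos ?_ fun t ht => ?_
  · rw [IsHermitian, conjTranspose_eq_transpose_of_trivial]
    ext i j
    have h1 := dotProduct_matH_mulVec ν hq (Pi.single i 1) (Pi.single j 1)
    have h2 := dotProduct_matH_mulVec ν hq (Pi.single j 1) (Pi.single i 1)
    simp only [single_one_dotProduct, mulVec_single_one, Matrix.col_apply] at h1 h2
    rw [transpose_apply, h1, h2]
    congr 1
    exact Finset.sum_congr rfl fun l _ => by rw [mul_comm (diffAdj _ l)]
  · rw [star_trivial, dotProduct_matH_mulVec ν hq]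
    refine mul_pos hnn (lt_of_le_of_ne
      (Finset.sum_nonneg fun j _ => div_nonneg (mul_self_nonneg _) (hq j).le) fun h0 => ht ?_)
    rw [eq_comm, Finset.sum_eq_zero_iff_of_nonneg
      fun j _ => div_nonneg (mul_self_nonneg _) (hq j).le] at h0
    have hz : ∀ j, diffAdj t j = 0 := by
      intro j
      have := h0 j (Finset.mem_univ j)
      rw [div_eq_zero_iff, or_iff_left (hq j).ne', mul_self_eq_zero] at this
      exact this
    ext l
    rw [← sum_diffAdj_le t l]
    simp [hz]

/-- The Karush-Kuhn-Tucker conditions for `u` to minimize `∑ w_j (u_j - V_j / w_j) ^ 2` over the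
vectors with `u_1 ≥ ⋯ ≥ u_J`; the multipliers are `lam`. -/
structure IsIsotonic (w V u : Fin (m + 1) → ℝ) (lam : Fin m → ℝ) : Prop where
  stationary : ∀ j, w j * u j = V j + diffAdj lam j
  nonneg : ∀ l, 0 ≤ lam l
  primal : ∀ l, 0 ≤ diffOp u l
  compl : ∀ l, lam l * diffOp u l = 0

/-- The Karush-Kuhn-Tucker conditions are a linear complementarity problem for `lam`. -/
theorem exists_isIsotonic {w : Fin (m + 1) → ℝ} (hw : ∀ j, 0 < w j) (V : Fin (m + 1) → ℝ) :
    ∃ u lam, IsIsotonic w V u lam := by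
  obtain ⟨lam, h⟩ := exists_isLCP (posDef_matH (ν := fun _ => 1) (fun _ => one_pos) hw)
    (diffOp fun j => V j / w j)
  have hd : ∀ l, diffOp (fun j => V j / w j) l + (matH (fun _ => 1) w *ᵥ lam) l =
      diffOp (fun j => (V j + diffAdj lam j) / w j) l := by
    intro l
    rw [matH_mulVec _ hw]
    simp only [diffOp]
    ring
  refine ⟨fun j => (V j + diffAdj lam j) / w j, lam, fun j => ?_, h.nonneg, fun l => ?_,
    fun l => ?_⟩
  · have := (hw j).ne'
    field_simp
  · rw [← hd]
    exact h.primal l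
  · rw [← hd]
    exact h.compl l

theorem IsIsotonic.sum_mul_sq {w V u : Fin (m + 1) → ℝ} {lam : Fin m → ℝ}
    (h : IsIsotonic w V u lam) : ∑ j, w j * u j ^ 2 = ∑ j, V j * u j := by
  have h1 := sum_diffAdj_mul lam u
  rw [Finset.sum_eq_zero fun l _ => h.compl l] at h1
  calc ∑ j, w j * u j ^ 2 = ∑ j, (V j * u j + diffAdj lam j * u j) :=
        Finset.sum_congr rfl fun j _ => by rw [← add_mul, ← h.stationary j]; ring
    _ = _ := by rw [Finset.sum_add_distrib, h1, add_zero]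

/-- The multipliers are determined by the fit, as partial sums of the residuals. -/
theorem IsIsotonic.multiplier_eq {w V u : Fin (m + 1) → ℝ} {lam : Fin m → ℝ}
    (h : IsIsotonic w V u lam) (l : Fin m) :
    lam l = ∑ j, (w j * u j - V j) * (if j ≤ l.castSucc then 1 else 0) := by
  rw [← sum_diffAdj_le lam l]
  exact Finset.sum_congr rfl fun j _ => by rw [h.stationary j]; ring

theorem IsIsotonic.isLCP {ν : Fin 2 → ℝ} (hν : ∀ i, 0 < ν i) {q u : Fin (m + 1) → ℝ}
    (hq : ∀ j, 0 < q j) {L lam : Fin m → ℝ} (h : IsIsotonic q (diffAdj L) u lam) :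
    IsLCP (matH ν q) (matH ν q *ᵥ L) lam := by
  have hnn : 0 < 1 / (ν 0 * ν 1) := by
    have := hν 0
    have := hν 1
    positivity
  have hx : (matH ν q *ᵥ (L + lam)) = fun l => 1 / (ν 0 * ν 1) * diffOp u l := by
    ext l
    rw [matH_mulVec ν hq]
    have : (fun j => diffAdj (L + lam) j / q j) = u := by
      ext j
      rw [diffAdj_add, ← h.stationary j, mul_div_cancel_left₀ _ (hq j).ne']
    rw [this]
  have hx' : ∀ l, (matH ν q *ᵥ L) l + (matH ν q *ᵥ lam) l = 1 / (ν 0 * ν 1) * diffOp u l := by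
    intro l
    rw [← congrFun hx l, mulVec_add, Pi.add_apply]
  refine ⟨h.nonneg, fun l => ?_, fun l => ?_⟩
  · rw [hx']
    exact mul_nonneg hnn.le (h.primal l)
  · rw [hx', mul_left_comm, h.compl, mul_zero]

/-- In the coordinates of the partial sums of `V`, isotonic regression is the projection of
`matH ν q L` on the nonnegative orthant. -/
theorem IsIsotonic.projNormSq_eq {ν : Fin 2 → ℝ} (hν : ∀ i, 0 < ν i) {q u : Fin (m + 1) → ℝ}
    (hq : ∀ j, 0 < q j) {L lam : Fin m → ℝ} (h : IsIsotonic q (diffAdj L) u lam) :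
    projNormSq (matH ν q) (matH ν q *ᵥ L) = 1 / (ν 0 * ν 1) * ∑ j, q j * u j ^ 2 := by
  have hH := posDef_matH hν hq
  have h1 := h.isLCP hν hq
  rw [h1.projNormSq_eq hH, ← mulVec_add, mulVec_mulVec,
    nonsing_inv_mul _ hH.det_pos.ne'.isUnit, one_mulVec, dotProduct_comm,
    dotProduct_matH_mulVec ν hq]
  congr 1
  refine Finset.sum_congr rfl fun j _ => ?_
  rw [diffAdj_add, ← h.stationary j]
  have := (hq j).ne'
  field_simp

end Isotonic

/-! ### Maximum likelihood estimates -/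

section MLE

variable {m : ℕ}

theorem constraint_eq_diffOp (θ : Param m) : constraint θ = diffOp (extendZero θ.2) := by
  ext l
  rw [constraint_apply, diffOp, extendZero_castSucc]

theorem log_condProb (θ : Param m) (i : Fin 2) (j : Fin (m + 1)) :
    Real.log (condProb θ i j) = linPred θ i j - Real.log (∑ l, Real.exp (linPred θ i l)) := by
  unfold condProb
  rw [Real.log_div (Real.exp_pos _).ne' (by positivity), Real.log_exp]

/-- The loglinear model is saturated: all pairs of positive probability vectors occur. -/
theorem exists_param {q : Fin 2 → Fin (m + 1) → ℝ} (hq : ∀ i j, 0 < q i j)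
    (hsum : ∀ i, ∑ j, q i j = 1) :
    ∃ θ : Param m, condProb θ = q ∧ ∀ j, extendZero θ.2 j =
      Real.log (q 0 j) - Real.log (q 1 j) -
        (Real.log (q 0 (Fin.last m)) - Real.log (q 1 (Fin.last m))) := by
  set lg : Fin 2 → Fin (m + 1) → ℝ := fun i j => Real.log (q i j) - Real.log (q i (Fin.last m))
  have hext : ∀ f : Fin (m + 1) → ℝ, f (Fin.last m) = 0 → ∀ j,
      extendZero (fun l : Fin m => f l.castSucc) j = f j := by
    intro f hf j
    refine Fin.lastCases ?_ (fun l => ?_) j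
    · rw [extendZero_last, hf]
    · rw [extendZero_castSucc]
  set θ : Param m := (fun l => lg 1 l.castSucc, fun l => lg 0 l.castSucc - lg 1 l.castSucc)
  have h1 : ∀ j, extendZero θ.1 j = lg 1 j := hext (lg 1) (by simp [lg])
  have h2 : ∀ j, extendZero θ.2 j = lg 0 j - lg 1 j :=
    hext (fun j => lg 0 j - lg 1 j) (by simp [lg])
  have hlin : ∀ i j, linPred θ i j = lg i j := by
    intro i j
    rw [linPred, h1, h2]
    fin_cases i <;> simp
  refine ⟨θ, ?_, fun j => ?_⟩
  · ext i j
    have he : ∀ j, Real.exp (linPred θ i j) = q i j / q i (Fin.last m) := by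
      intro j
      rw [hlin, Real.exp_sub, Real.exp_log (hq i j), Real.exp_log (hq i _)]
    unfold condProb
    simp only [he, ← Finset.sum_div, hsum]
    have := (hq i (Fin.last m)).ne'
    field_simp
  · rw [h2]
    simp only [lg]
    ring

/-- A parameter whose fitted column totals are the observed ones, and that satisfies the
variational inequality of the likelihood, is a maximum likelihood estimate; the fitted
probabilities are unique.  This is Gibbs' inequality. -/
theorem isMLE_of_variational {K : Set (Param m)} {n : Fin 2 → ℕ} (hn : ∀ i, 0 < n i)
    {N : Table m} (hrow : ∀ i, ∑ j, N i j = n i) {θ : Param m} (hθ : θ ∈ K)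
    (hcol : ∀ j, ∑ i, (n i : ℝ) * condProb θ i j = ∑ i, (N i j : ℝ))
    (hvar : ∀ θ' ∈ K, ∑ j, ((N 0 j : ℝ) - n 0 * condProb θ 0 j) *
      (extendZero θ'.2 j - extendZero θ.2 j) ≤ 0) :
    IsMLE K n N θ ∧ ∀ θ', IsMLE K n N θ' → condProb θ' = condProb θ := by
  have h0 : ∀ i, (0 : ℝ) < n i := fun i => Nat.cast_pos.mpr (hn i)
  have ht : 0 < total n := Finset.sum_pos (fun i _ => h0 i) Finset.univ_nonempty
  have hrow' : ∀ i, ∑ j, (N i j : ℝ) = n i := fun i => by rw [← hrow i]; push_cast; rfl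
  set r : Param m → Fin 2 → Fin (m + 1) → ℝ := fun θ' i j =>
    Real.log (condProb θ' i j) - Real.log (condProb θ i j)
  have hG : ∀ j, (N 1 j : ℝ) - n 1 * condProb θ 1 j = -((N 0 j : ℝ) - n 0 * condProb θ 0 j) := by
    intro j
    have := hcol j
    simp only [Fin.sum_univ_two] at this
    linarith
  have hG0 : ∀ i, ∑ j, ((N i j : ℝ) - n i * condProb θ i j) = 0 := by
    intro i
    rw [Finset.sum_sub_distrib, ← Finset.mul_sum, sum_condProb, hrow']
    ring
  have hdiff : ∀ θ', logLik n N θ' - logLik n N θ = ∑ i, ∑ j, (N i j : ℝ) * r θ' i j := by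
    intro θ'
    simp only [logLik, ← Finset.sum_sub_distrib, ← mul_sub, r]
    refine Finset.sum_congr rfl fun i _ => Finset.sum_congr rfl fun j _ => ?_
    have hc := (div_pos (h0 i) ht).ne'
    rw [jointProb, jointProb, Real.log_mul hc (condProb_pos _ _ _).ne',
      Real.log_mul hc (condProb_pos _ _ _).ne']
    ring
  -- The loglikelihood ratio is a linear form in `θ'`, the one of `hvar`, minus nonnegative
  -- Kullback-Leibler divergences.
  have hdecomp : ∀ θ', logLik n N θ' - logLik n N θ =
      ∑ j, ((N 0 j : ℝ) - n 0 * condProb θ 0 j) * (extendZero θ'.2 j - extendZero θ.2 j) +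
        ∑ i, (n i : ℝ) * ∑ j, condProb θ i j * r θ' i j := by
    intro θ'
    set c : ℝ := r θ' 0 0 - r θ' 1 0 - (extendZero θ'.2 0 - extendZero θ.2 0)
    have hr : ∀ j, r θ' 0 j - r θ' 1 j = extendZero θ'.2 j - extendZero θ.2 j + c := by
      intro j
      simp only [r, c, log_condProb, linPred, if_true, one_ne_zero, if_false]
      ring
    have e1 : ∑ j, ((N 0 j : ℝ) - n 0 * condProb θ 0 j) * (extendZero θ'.2 j - extendZero θ.2 j) =
        ∑ j, ((N 0 j : ℝ) - n 0 * condProb θ 0 j) * (r θ' 0 j - r θ' 1 j) := by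
      simp only [hr, mul_add, Finset.sum_add_distrib, ← Finset.sum_mul, hG0, zero_mul, add_zero]
    rw [hdiff, e1, Fin.sum_univ_two, Fin.sum_univ_two, Finset.mul_sum, Finset.mul_sum,
      ← Finset.sum_add_distrib, ← Finset.sum_add_distrib, ← Finset.sum_add_distrib]
    refine Finset.sum_congr rfl fun j _ => ?_
    have := hG j
    linear_combination (r θ' 1 j) * this
  have hexp : ∀ θ' i j, condProb θ i j * Real.exp (r θ' i j) = condProb θ' i j := by
    intro θ' i j
    simp only [r]
    rw [Real.exp_sub, Real.exp_log (condProb_pos _ _ _), Real.exp_log (condProb_pos _ _ _)]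
    have := (condProb_pos θ i j).ne'
    field_simp
  have hterm : ∀ θ' i j, 0 ≤ condProb θ i j * (Real.exp (r θ' i j) - 1 - r θ' i j) := by
    intro θ' i j
    refine mul_nonneg (condProb_pos _ _ _).le ?_
    linarith [Real.add_one_le_exp (r θ' i j)]
  have hgibbs : ∀ θ' i, ∑ j, condProb θ i j * r θ' i j =
      -∑ j, condProb θ i j * (Real.exp (r θ' i j) - 1 - r θ' i j) := by
    intro θ' i
    have : ∀ j, condProb θ i j * (Real.exp (r θ' i j) - 1 - r θ' i j) =
        condProb θ' i j - condProb θ i j - condProb θ i j * r θ' i j := by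
      intro j
      rw [← hexp θ' i j]
      ring
    simp only [this, Finset.sum_sub_distrib, sum_condProb]
    ring
  have hle : ∀ θ' i, (n i : ℝ) * ∑ j, condProb θ i j * r θ' i j ≤ 0 := by
    intro θ' i
    rw [hgibbs]
    exact mul_nonpos_of_nonneg_of_nonpos (h0 i).le
      (neg_nonpos.mpr (Finset.sum_nonneg fun j _ => hterm θ' i j))
  refine ⟨⟨hθ, fun θ' hθ' => ?_⟩, fun θ' hθ' => ?_⟩
  · have h1 := hdecomp θ'
    have h2 := hvar θ' hθ'
    have h3 := hle θ'
    rw [Fin.sum_univ_two] at h1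
    change logLik n N θ' ≤ logLik n N θ
    linarith [h3 0, h3 1]
  · have h1 := hdecomp θ'
    have h2 := hvar θ' hθ'.1
    have h3 := hle θ'
    have h4 : logLik n N θ ≤ logLik n N θ' := hθ'.2 hθ
    have h5 : ∀ i, (n i : ℝ) * ∑ j, condProb θ i j * r θ' i j = 0 := by
      rw [Fin.sum_univ_two] at h1
      intro i
      fin_cases i
      · change (n 0 : ℝ) * ∑ j, condProb θ 0 j * r θ' 0 j = 0
        linarith [h3 0, h3 1]
      · change (n 1 : ℝ) * ∑ j, condProb θ 1 j * r θ' 1 j = 0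
        linarith [h3 0, h3 1]
    ext i j
    have h6 := (mul_eq_zero.mp (h5 i)).resolve_left (h0 i).ne'
    rw [hgibbs, neg_eq_zero, Finset.sum_eq_zero_iff_of_nonneg fun j _ => hterm θ' i j] at h6
    have h7 := (mul_eq_zero.mp (h6 j (Finset.mem_univ j))).resolve_left (condProb_pos θ i j).ne'
    have h8 : r θ' i j = 0 := by
      by_contra hne
      have := Real.add_one_lt_exp hne
      linarith
    rw [← hexp θ' i j, h8, Real.exp_zero, mul_one]

/-- The fraction of the observations under the first treatment. -/
noncomputable def frac (n : Fin 2 → ℕ) : ℝ := (n 0 : ℝ) / total n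

/-- The observed proportion of each response category, both treatments together. -/
noncomputable def colFreq (n : Fin 2 → ℕ) (N : Table m) (j : Fin (m + 1)) : ℝ :=
  ((N 0 j : ℝ) + N 1 j) / total n

/-- The normalized deviation of the first row of the table from its expectation given the column
totals, if the rows have the same distribution. -/
noncomputable def deviation (n : Fin 2 → ℕ) (N : Table m) (j : Fin (m + 1)) : ℝ :=
  ((1 - frac n) * N 0 j - frac n * N 1 j) / √(total n)

section Fit

variable {n : Fin 2 → ℕ} (hn : ∀ i, 0 < n i) {N : Table m} (hrow : ∀ i, ∑ j, N i j = n i)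

include hn

theorem total_pos : 0 < total n :=
  Finset.sum_pos (fun i _ => Nat.cast_pos.mpr (hn i)) Finset.univ_nonempty

theorem frac_pos : 0 < frac n := div_pos (Nat.cast_pos.mpr (hn 0)) (total_pos hn)

theorem one_sub_frac : 1 - frac n = (n 1 : ℝ) / total n := by
  have := (total_pos hn).ne'
  rw [frac, eq_div_iff this, sub_mul, div_mul_cancel₀ _ this]
  simp only [total, Fin.sum_univ_two]
  ring

theorem one_sub_frac_pos : 0 < 1 - frac n := by
  rw [one_sub_frac hn]
  exact div_pos (Nat.cast_pos.mpr (hn 1)) (total_pos hn)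

/-- The column frequencies and the deviations determine the first row of the table; `cell_one` is
the same for the second row. -/
theorem cell_zero (j : Fin (m + 1)) :
    (N 0 j : ℝ) = total n * (frac n * colFreq n N j) + √(total n) * deviation n N j := by
  have h1 := (total_pos hn).ne'
  have h2 := (Real.sqrt_pos.mpr (total_pos hn)).ne'
  unfold colFreq deviation
  field_simp
  ring

theorem cell_one (j : Fin (m + 1)) :
    (N 1 j : ℝ) = total n * ((1 - frac n) * colFreq n N j) - √(total n) * deviation n N j := by
  have h1 := (total_pos hn).ne'
  have h2 := (Real.sqrt_pos.mpr (total_pos hn)).ne'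
  unfold colFreq deviation
  field_simp
  ring

include hrow

theorem sum_colFreq : ∑ j, colFreq n N j = 1 := by
  have h1 := (total_pos hn).ne'
  unfold colFreq
  rw [← Finset.sum_div, Finset.sum_add_distrib, div_eq_one_iff_eq h1, total, Fin.sum_univ_two,
    ← hrow 0, ← hrow 1]
  push_cast
  rfl

theorem sum_deviation : ∑ j, deviation n N j = 0 := by
  have h1 := (total_pos hn).ne'
  have hrow' : ∀ i, ∑ j, (N i j : ℝ) = n i := fun i => by rw [← hrow i]; push_cast; rfl
  unfold deviation
  rw [← Finset.sum_div, Finset.sum_sub_distrib, ← Finset.mul_sum, ← Finset.mul_sum, hrow', hrow',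
    one_sub_frac hn, frac]
  field_simp
  ring

/-- The maximum likelihood estimate under the order restriction fits the observed column totals,
and the proportions of the first treatment in the columns are given by isotonic regression.  The
hypotheses `hpos` and `hlt` say that these proportions are strictly between `0` and `1`, so that the
estimate exists. -/
theorem jointProb_mle_order {u : Fin (m + 1) → ℝ} {lam : Fin m → ℝ}
    (hw : ∀ j, 0 < colFreq n N j)
    (h : IsIsotonic (colFreq n N) (deviation n N) u lam)
    (hpos : ∀ j, 0 < frac n + u j / √(total n)) (hlt : ∀ j, 0 < 1 - frac n - u j / √(total n))
    {est : (Fin 2 → ℕ) → Table m → Param m} (hest : IsMLEstimator (orderSpace m) est)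
    (j : Fin (m + 1)) :
    jointProb n (est n N) 0 j = colFreq n N j * (frac n + u j / √(total n)) ∧
      jointProb n (est n N) 1 j = colFreq n N j * (1 - frac n - u j / √(total n)) := by
  have hT := total_pos hn
  have hs := Real.sqrt_pos.mpr hT
  have hss : √(total n) * √(total n) = total n := Real.mul_self_sqrt hT.le
  have ha := frac_pos hn
  have ha1 := one_sub_frac_pos hn
  set a := frac n
  set s := √(total n)
  set w := colFreq n N
  have hwu : ∑ j, w j * u j = 0 := by
    simp only [h.stationary, Finset.sum_add_distrib, sum_diffAdj, sum_deviation hn hrow, add_zero]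
  set q : Fin 2 → Fin (m + 1) → ℝ := fun i j => if i = 0 then w j * (a + u j / s) / a else
    w j * (1 - a - u j / s) / (1 - a)
  have hq0 : ∀ j, q 0 j = w j * (a + u j / s) / a := fun j => by simp [q]
  have hq1 : ∀ j, q 1 j = w j * (1 - a - u j / s) / (1 - a) := fun j => by simp [q]
  have hq : ∀ i j, 0 < q i j := by
    intro i j
    fin_cases i
    · exact (hq0 j).symm ▸ div_pos (mul_pos (hw j) (hpos j)) ha
    · exact (hq1 j).symm ▸ div_pos (mul_pos (hw j) (hlt j)) ha1
  have hsum : ∀ i, ∑ j, q i j = 1 := by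
    intro i
    have hw1 : ∑ j, w j = 1 := sum_colFreq hn hrow
    have e0 : ∑ j, w j * (a + u j / s) = a := by
      calc ∑ j, w j * (a + u j / s) = ∑ j, (a * w j + s⁻¹ * (w j * u j)) :=
            Finset.sum_congr rfl fun j _ => by field_simp
        _ = a := by
            rw [Finset.sum_add_distrib, ← Finset.mul_sum, ← Finset.mul_sum, hwu, hw1]
            ring
    have e1 : ∑ j, w j * (1 - a - u j / s) = 1 - a := by
      calc ∑ j, w j * (1 - a - u j / s) = ∑ j, (w j - w j * (a + u j / s)) :=
            Finset.sum_congr rfl fun j _ => by ring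
        _ = 1 - a := by rw [Finset.sum_sub_distrib, e0, hw1]
    fin_cases i
    · change ∑ j, q 0 j = 1
      simp only [hq0, ← Finset.sum_div, e0, div_self ha.ne']
    · change ∑ j, q 1 j = 1
      simp only [hq1, ← Finset.sum_div, e1, div_self ha1.ne']
  obtain ⟨θ, hθ, hθ2⟩ := exists_param hq hsum
  have hn0 : (n 0 : ℝ) = total n * a := by
    simp only [a, frac]
    field_simp
  have hn1 : (n 1 : ℝ) = total n * (1 - a) := by
    rw [one_sub_frac hn]
    field_simp
  -- The logit of `a + u j / s`, up to an additive constant.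
  have hlogit : ∀ j, extendZero θ.2 j = Real.log (a + u j / s) - Real.log (1 - a - u j / s) -
      (Real.log (a + u (Fin.last m) / s) - Real.log (1 - a - u (Fin.last m) / s)) := by
    intro j
    have hl : ∀ j, Real.log (q 0 j) - Real.log (q 1 j) = Real.log (a + u j / s) -
        Real.log (1 - a - u j / s) - Real.log a + Real.log (1 - a) := by
      intro j
      rw [hq0, hq1, Real.log_div (mul_pos (hw j) (hpos j)).ne' ha.ne',
        Real.log_div (mul_pos (hw j) (hlt j)).ne' ha1.ne', Real.log_mul (hw j).ne' (hpos j).ne',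
        Real.log_mul (hw j).ne' (hlt j).ne']
      ring
    rw [hθ2, hl, hl]
    ring
  have hK : θ ∈ orderSpace m := by
    intro l
    rw [constraint_eq_diffOp, diffOp, hlogit, hlogit]
    have hul : u l.succ / s ≤ u l.castSucc / s :=
      div_le_div_of_nonneg_right (sub_nonneg.mp (h.primal l)) hs.le
    have h1 := Real.log_le_log (hpos l.succ) (add_le_add_right hul a)
    have h2 := Real.log_le_log (hlt l.castSucc) (sub_le_sub_left hul (1 - a))
    linarith
  have hres : ∀ j, (N 0 j : ℝ) - n 0 * condProb θ 0 j = -(s * diffAdj lam j) := by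
    intro j
    rw [cell_zero hn j, hθ, hq0, hn0]
    have e : total n * a * (w j * (a + u j / s) / a) = total n * (a * w j) + s * (w j * u j) := by
      rw [← hss]
      field_simp
    rw [e, h.stationary j]
    ring
  have hcol : ∀ j, ∑ i, (n i : ℝ) * condProb θ i j = ∑ i, (N i j : ℝ) := by
    intro j
    have h2 : (n 1 : ℝ) * condProb θ 1 j = total n * (w j * (1 - a - u j / s)) := by
      rw [hθ, hq1, hn1]
      field_simp
    have h3 : (n 0 : ℝ) * condProb θ 0 j = total n * (w j * (a + u j / s)) := by
      rw [hθ, hq0, hn0]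
      field_simp
    rw [Fin.sum_univ_two, Fin.sum_univ_two, h2, h3, cell_zero hn j, cell_one hn j]
    ring
  have hfit := isMLE_of_variational hn hrow hK hcol fun θ' hθ' => by
    have e : ∑ j, ((N 0 j : ℝ) - n 0 * condProb θ 0 j) * (extendZero θ'.2 j - extendZero θ.2 j) =
        -(s * (∑ l, lam l * constraint θ' l - ∑ l, lam l * diffOp (extendZero θ.2) l)) := by
      rw [constraint_eq_diffOp, ← sum_diffAdj_mul, ← sum_diffAdj_mul, ← Finset.sum_sub_distrib,
        Finset.mul_sum, ← Finset.sum_neg_distrib]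
      exact Finset.sum_congr rfl fun j _ => by rw [hres]; ring
    have e2 : ∑ l, lam l * diffOp (extendZero θ.2) l = 0 := by
      refine Finset.sum_eq_zero fun l _ => ?_
      rcases mul_eq_zero.mp (h.compl l) with h1 | h1
      · rw [h1, zero_mul]
      · rw [diffOp, hlogit, hlogit, sub_eq_zero.mp h1]
        ring
    rw [e, e2, sub_zero, neg_nonpos]
    exact mul_nonneg hs.le (Finset.sum_nonneg fun l _ => mul_nonneg (h.nonneg l) (hθ' l))
  have hcond := hfit.2 _ (hest n N ⟨θ, hfit.1⟩)
  constructor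
  · rw [jointProb, hcond, hθ, hq0]
    change a * _ = _
    field_simp
  · rw [jointProb, hcond, hθ, hq1, ← one_sub_frac hn]
    change (1 - a) * _ = _
    field_simp

/-- The maximum likelihood estimate under homogeneity pools the two rows. -/
theorem jointProb_mle_null (hw : ∀ j, 0 < colFreq n N j)
    {est : (Fin 2 → ℕ) → Table m → Param m} (hest : IsMLEstimator (nullSpace m) est)
    (j : Fin (m + 1)) :
    jointProb n (est n N) 0 j = colFreq n N j * frac n ∧
      jointProb n (est n N) 1 j = colFreq n N j * (1 - frac n) := by
  have hT := total_pos hn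
  have ha := frac_pos hn
  have ha1 := one_sub_frac_pos hn
  obtain ⟨θ, hθ, hθ2⟩ := exists_param (q := fun _ => colFreq n N) (fun _ => hw)
    (fun _ => sum_colFreq hn hrow)
  have hz : extendZero θ.2 = fun _ => 0 := by
    ext j
    rw [hθ2]
    ring
  have hn0 : (n 0 : ℝ) = total n * frac n := by
    simp only [frac]
    field_simp
  have hn1 : (n 1 : ℝ) = total n * (1 - frac n) := by
    rw [one_sub_frac hn]
    field_simp
  have hK : θ ∈ nullSpace m := by
    intro l
    rw [constraint_eq_diffOp, hz]
    simp [diffOp]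
  have hcol : ∀ j, ∑ i, (n i : ℝ) * condProb θ i j = ∑ i, (N i j : ℝ) := by
    intro j
    rw [Fin.sum_univ_two, Fin.sum_univ_two, hθ, cell_zero hn j, cell_one hn j, hn0, hn1]
    ring
  have hfit := isMLE_of_variational hn hrow hK hcol fun θ' hθ' => by
    have e : ∀ j, (N 0 j : ℝ) - n 0 * condProb θ 0 j = √(total n) *
        diffAdj (fun l => ∑ i, if i ≤ l.castSucc then deviation n N i else 0) j := by
      intro j
      rw [diffAdj_partialSum (sum_deviation hn hrow), cell_zero hn j, hθ, hn0]
      ring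
    simp only [e, hz, sub_zero, mul_assoc, ← Finset.mul_sum, sum_diffAdj_mul]
    rw [← constraint_eq_diffOp]
    refine le_of_eq ?_
    rw [Finset.sum_eq_zero fun l _ => by rw [hθ' l, mul_zero], mul_zero]
  have hcond := hfit.2 _ (hest n N ⟨θ, hfit.1⟩)
  constructor
  · rw [jointProb, hcond, hθ, mul_comm]
    rfl
  · rw [jointProb, hcond, hθ, ← one_sub_frac hn, mul_comm]

end Fit

end MLE

/-! ### The statistics along convergent tables -/

section Limit

variable {m : ℕ}

/-- The second order expansion of `φ` at `1`.  The junk value of `deriv` does not interfere: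
`deriv φ` has a nonzero derivative at `1`, so it does not vanish, and `φ` is differentiable, at the
other points near `1`. -/
theorem IsPhi.isLittleO {φ : ℝ → ℝ} (hφ : IsPhi φ) :
    (fun t => φ (1 + t) - deriv (deriv φ) 1 / 2 * t ^ 2) =o[𝓝 0] fun t => t ^ 2 := by
  set c := deriv (deriv φ) 1
  have hc : 0 < c := hφ.deriv_two_pos
  have hd : HasDerivAt (deriv φ) c 1 :=
    (differentiableAt_of_deriv_ne_zero hc.ne').hasDerivAt
  have hd1 : deriv φ 1 = 0 := hφ.deriv_one.deriv
  rw [Asymptotics.isLittleO_iff]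
  intro ε hε
  have h1 := (hasDerivAt_iff_isLittleO.mp hd).bound (half_pos hc)
  have h2 := (hasDerivAt_iff_isLittleO.mp hd).bound hε
  obtain ⟨δ, hδ, hball⟩ := Metric.eventually_nhds_iff.mp (h1.and h2)
  refine Metric.eventually_nhds_iff.mpr ⟨δ, hδ, fun t ht => ?_⟩
  rw [Real.dist_eq, sub_zero] at ht
  have hder : ∀ y ∈ Metric.closedBall (1 : ℝ) |t|, HasDerivWithinAt
      (fun x => φ x - c / 2 * (x - 1) ^ 2) (deriv φ y - c * (y - 1))
      (Metric.closedBall (1 : ℝ) |t|) y := by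
    intro y hy
    have hy' : dist y 1 < δ := lt_of_le_of_lt hy ht
    have hφd : HasDerivAt φ (deriv φ y) y := by
      rcases eq_or_ne y 1 with rfl | hne
      · rw [hd1]
        exact hφ.deriv_one
      · refine (differentiableAt_of_deriv_ne_zero fun h0 => ?_).hasDerivAt
        have := (hball hy').1
        rw [h0, hd1, sub_zero, zero_sub, norm_neg, norm_smul, Real.norm_eq_abs c,
          abs_of_pos hc] at this
        have hp : 0 < ‖y - 1‖ := norm_pos_iff.mpr (sub_ne_zero.mpr hne)
        nlinarith
    have h3 : HasDerivAt (fun x : ℝ => c / 2 * (x - 1) ^ 2) (c * (y - 1)) y := by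
      have := (((hasDerivAt_id y).sub_const 1).pow 2).const_mul (c / 2)
      refine this.congr_deriv ?_
      simp
      ring
    exact (hφd.sub h3).hasDerivWithinAt
  have hb := Convex.norm_image_sub_le_of_norm_hasDerivWithin_le (C := ε * |t|) hder
    (fun y hy => by
      have hy1 : |y - 1| ≤ |t| := hy
      have := (hball (lt_of_le_of_lt hy ht)).2
      rw [hd1, sub_zero, smul_eq_mul, mul_comm (y - 1) c] at this
      exact this.trans (mul_le_mul_of_nonneg_left hy1 hε.le))
    (convex_closedBall 1 |t|) (x := 1) (y := 1 + t)
    (Metric.mem_closedBall_self (abs_nonneg _)) (by simp)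
  simp only [hφ.map_one, add_sub_cancel_left, sub_self] at hb
  rw [Real.norm_eq_abs (t ^ 2), abs_pow]
  refine le_trans (le_of_eq ?_) (hb.trans (le_of_eq ?_))
  · congr 1
    ring
  · rw [Real.norm_eq_abs]
    ring

/-- The second order expansion of `φ` at `1`, for sequences. -/
theorem IsPhi.tendsto_sq_mul {φ : ℝ → ℝ} (hφ : IsPhi φ) {I : Type*} {l : Filter I}
    {s t : I → ℝ} {τ : ℝ} (hs : Tendsto s l atTop) (hst : Tendsto (fun k => s k * t k) l (𝓝 τ)) :
    Tendsto (fun k => s k ^ 2 * φ (1 + t k)) l (𝓝 (deriv (deriv φ) 1 / 2 * τ ^ 2)) := by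
  have ht : Tendsto t l (𝓝 0) := by
    have h1 : Tendsto (fun k => (s k)⁻¹ * (s k * t k)) l (𝓝 (0 * τ)) :=
      (tendsto_inv_atTop_zero.comp hs).mul hst
    rw [zero_mul] at h1
    refine h1.congr' ?_
    filter_upwards [hs.eventually_gt_atTop 0] with k hk
    rw [inv_mul_cancel_left₀ hk.ne']
  have ho := hφ.isLittleO.comp_tendsto ht
  have ho2 : Tendsto (fun k => s k ^ 2 * (φ (1 + t k) - deriv (deriv φ) 1 / 2 * t k ^ 2)) l
      (𝓝 0) := by
    have h1 := (Asymptotics.isBigO_refl (fun k => s k ^ 2) l).mul_isLittleO ho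
    have h2 : (fun k => s k ^ 2 * ((fun t : ℝ => t ^ 2) ∘ t) k) =O[l] fun _ => (1 : ℝ) := by
      have := (hst.pow 2).isBigO_one ℝ
      refine this.congr_left fun k => ?_
      simp only [Function.comp]
      ring
    exact (Asymptotics.isLittleO_one_iff ℝ).mp (h1.trans_isBigO h2)
  have h3 := ho2.add ((hst.pow 2).const_mul (deriv (deriv φ) 1 / 2))
  rw [zero_add] at h3
  refine h3.congr fun k => ?_
  ring

/-- The partial sums of the deviations. -/
noncomputable def cumDev (n : Fin 2 → ℕ) (N : Table m) (l : Fin m) : ℝ :=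
  ∑ i, if i ≤ l.castSucc then deviation n N i else 0

theorem phiDiv_of_pos {φ : ℝ → ℝ} {p q : Fin 2 → Fin (m + 1) → ℝ} (hq : ∀ i j, 0 < q i j) :
    phiDiv φ p q = ∑ j, (q 0 j * φ (p 0 j / q 0 j) + q 1 j * φ (p 1 j / q 1 j)) := by
  simp only [phiDiv, if_neg (hq _ _).ne', Fin.sum_univ_two, Finset.sum_add_distrib]

/-- If all the partial sums of the deviations are nonpositive, the order restricted estimate is the
null estimate: isotonic regression then fits a constant. -/
theorem stat_eq_zero_of_cumDev_nonpos {φ : ℝ → ℝ} (hφ : IsPhi φ) {n : Fin 2 → ℕ}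
    (hn : ∀ i, 0 < n i) {N : Table m} (hrow : ∀ i, ∑ j, N i j = n i)
    (hw : ∀ j, 0 < colFreq n N j) (hL : ∀ l, cumDev n N l ≤ 0)
    {θhat θtilde : (Fin 2 → ℕ) → Table m → Param m}
    (hhat : IsMLEstimator (nullSpace m) θhat) (htilde : IsMLEstimator (orderSpace m) θtilde) :
    statS φ n (θtilde n N) (θhat n N) = 0 ∧ statT φ n N (θtilde n N) (θhat n N) = 0 := by
  have hiso : IsIsotonic (colFreq n N) (deviation n N) (fun _ => 0) (-cumDev n N) := by
    refine ⟨fun j => ?_, fun l => ?_, fun l => ?_, fun l => ?_⟩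
    · have h : diffAdj (-cumDev n N) j = -deviation n N j :=
        diffAdj_neg_partialSum (sum_deviation hn hrow) j
      rw [h]
      ring
    · exact neg_nonneg.mpr (hL l)
    · simp [diffOp]
    · simp [diffOp]
  have ht := jointProb_mle_order hn hrow hw hiso (by simpa using frac_pos hn)
    (by simpa using one_sub_frac_pos hn) htilde
  have hh := jointProb_mle_null hn hrow hw hhat
  have heq : jointProb n (θtilde n N) = jointProb n (θhat n N) := by
    ext i j
    fin_cases i
    · exact (ht j).1.trans ((hh j).1.trans (by ring)).symm
    · exact (ht j).2.trans ((hh j).2.trans (by ring)).symm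
  constructor
  · rw [statS, heq, phiDiv_of_pos fun i j => jointProb_pos n hn _ i j]
    simp [div_self (jointProb_pos n hn (θhat n N) _ _).ne', hφ.map_one]
  · rw [statT, heq, sub_self, mul_zero]

/-- The ratio of an observed to a fitted proportion, as `1` plus a term of order `1 / s`. -/
theorem div_fitted_eq {w V s a u ρ : ℝ} (hw : w ≠ 0) (hs : s ≠ 0) (hρ : ρ ≠ 0)
    (h : ρ = a + u / s) :
    (a * w + V / s) / (w * ρ) = 1 + (V - w * u) / (w * ρ) / s := by
  have hu : u = s * (ρ - a) := by
    rw [h]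
    field_simp
    ring
  rw [hu]
  field_simp
  ring

/-- Isotonic regression is continuous in the weights and the data: this holds along ultrafilters by
compactness, since the limit satisfies the Karush-Kuhn-Tucker conditions. -/
theorem exists_tendsto_isIsotonic {I : Type*} (F : Ultrafilter I)
    {w V u : I → Fin (m + 1) → ℝ} {lam : I → Fin m → ℝ}
    (h : ∀ᶠ k in (F : Filter I), IsIsotonic (w k) (V k) (u k) (lam k))
    {q v : Fin (m + 1) → ℝ} (hq : ∀ j, 0 < q j)
    (hw : ∀ j, Tendsto (fun k => w k j) F (𝓝 (q j)))
    (hV : ∀ j, Tendsto (fun k => V k j) F (𝓝 (v j))) :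
    ∃ u' lam', IsIsotonic q v u' lam' ∧ ∀ j, Tendsto (fun k => u k j) F (𝓝 (u' j)) := by
  have hwpos : ∀ᶠ k in (F : Filter I), ∀ j, 0 < w k j :=
    eventually_all.mpr fun j => (hw j).eventually_const_lt (hq j)
  have hB : ∀ i, Tendsto (fun k => (∑ j, V k j ^ 2 / w k j) / w k i) F
      (𝓝 ((∑ j, v j ^ 2 / q j) / q i)) := fun i =>
    (tendsto_finsetSum _ fun j _ => ((hV j).pow 2).div (hw j) (hq j).ne').div (hw i) (hq i).ne'
  have hub : ∀ i, ∀ᶠ k in (F : Filter I), u k i ^ 2 ≤ (∑ j, v j ^ 2 / q j) / q i + 1 := by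
    intro i
    filter_upwards [h, hwpos, (hB i).eventually_lt_const (lt_add_one _)] with k hk hp hlt
    refine le_trans ?_ hlt.le
    rw [le_div_iff₀ (hp i)]
    have h1 := hk.sum_mul_sq
    have h2 : ∑ j, V k j * u k j ≤ ∑ j, (V k j ^ 2 / w k j / 2 + w k j * u k j ^ 2 / 2) := by
      refine Finset.sum_le_sum fun j _ => ?_
      have hp' := hp j
      have : V k j ^ 2 / w k j / 2 + w k j * u k j ^ 2 / 2 - V k j * u k j =
          (V k j - w k j * u k j) ^ 2 / (2 * w k j) := by
        field_simp
        ring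
      have : 0 ≤ (V k j - w k j * u k j) ^ 2 / (2 * w k j) := by positivity
      linarith
    rw [Finset.sum_add_distrib, ← Finset.sum_div, ← Finset.sum_div] at h2
    have h3 : w k i * u k i ^ 2 ≤ ∑ j, w k j * u k j ^ 2 :=
      Finset.single_le_sum (f := fun j => w k j * u k j ^ 2)
        (fun j _ => mul_nonneg (hp j).le (sq_nonneg _)) (Finset.mem_univ i)
    linarith
  have hlim : ∀ i, ∃ x, Tendsto (fun k => u k i) F (𝓝 x) := by
    intro i
    set M := (∑ j, v j ^ 2 / q j) / q i + 1
    obtain ⟨x, -, hx⟩ := (isCompact_Icc (a := -√M) (b := √M)).ultrafilter_le_nhds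
      (F.map fun k => u k i) (by
        rw [le_principal_iff]
        exact (hub i).mono fun k hk => abs_le.mp (Real.abs_le_sqrt hk))
    exact ⟨x, hx⟩
  choose u' hu using hlim
  have hlam : ∀ l, Tendsto (fun k => lam k l) F
      (𝓝 (∑ j, (q j * u' j - v j) * (if j ≤ l.castSucc then 1 else 0))) := by
    intro l
    have h1 : Tendsto (fun k => ∑ j, (w k j * u k j - V k j) *
        (if j ≤ l.castSucc then (1 : ℝ) else 0)) F
        (𝓝 (∑ j, (q j * u' j - v j) * (if j ≤ l.castSucc then 1 else 0))) :=
      tendsto_finsetSum _ fun j _ => (((hw j).mul (hu j)).sub (hV j)).mul_const _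
    refine h1.congr' ?_
    filter_upwards [h] with k hk
    exact (hk.multiplier_eq l).symm
  set lam' : Fin m → ℝ := fun l => ∑ j, (q j * u' j - v j) * (if j ≤ l.castSucc then 1 else 0)
  have hdiff : ∀ l, Tendsto (fun k => diffOp (u k) l) F (𝓝 (diffOp u' l)) := fun l =>
    (hu l.castSucc).sub (hu l.succ)
  refine ⟨u', lam', ⟨fun j => ?_, fun l => ?_, fun l => ?_, fun l => ?_⟩, hu⟩
  · have h1 : Tendsto (fun k => V k j + diffAdj (lam k) j) F (𝓝 (v j + diffAdj lam' j)) :=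
      (hV j).add (((continuous_diffAdj j).tendsto lam').comp (tendsto_pi_nhds.mpr hlam))
    refine tendsto_nhds_unique ((hw j).mul (hu j)) (h1.congr' ?_)
    filter_upwards [h] with k hk
    exact (hk.stationary j).symm
  · exact ge_of_tendsto (hlam l) (h.mono fun k hk => hk.nonneg l)
  · exact ge_of_tendsto (hdiff l) (h.mono fun k hk => hk.primal l)
  · refine tendsto_nhds_unique ((hlam l).mul (hdiff l)) (tendsto_const_nhds.congr' ?_)
    filter_upwards [h] with k hk
    exact (hk.compl l).symm

open Matrix in
/-- Along tables with convergent column proportions and convergent normalized deviations, both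
statistics converge to the squared norm of the projection. -/
theorem tendsto_stat {φ : ℝ → ℝ} (hφ : IsPhi φ) {I : Type*} (F : Ultrafilter I)
    {n : I → Fin 2 → ℕ} {N : I → Table m} (hn : ∀ i, Tendsto (fun k => n k i) F atTop)
    {ν : Fin 2 → ℝ} (hν_pos : ∀ i, 0 < ν i)
    (hν : ∀ i, Tendsto (fun k => (n k i : ℝ) / total (n k)) F (𝓝 (ν i)))
    (hrow : ∀ᶠ k in (F : Filter I), ∀ i, ∑ j, N k i j = n k i)
    {q : Fin (m + 1) → ℝ} (hq : ∀ j, 0 < q j)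
    (hw : ∀ j, Tendsto (fun k => colFreq (n k) (N k) j) F (𝓝 (q j)))
    {L : Fin m → ℝ} (hL : ∀ l, Tendsto (fun k => cumDev (n k) (N k) l) F (𝓝 (L l)))
    {θhat θtilde : (Fin 2 → ℕ) → Table m → Param m}
    (hhat : IsMLEstimator (nullSpace m) θhat) (htilde : IsMLEstimator (orderSpace m) θtilde) :
    Tendsto (fun k => statS φ (n k) (θtilde (n k) (N k)) (θhat (n k) (N k))) F
        (𝓝 (projNormSq (matH ν q) (matH ν q *ᵥ L))) ∧
      Tendsto (fun k => statT φ (n k) (N k) (θtilde (n k) (N k)) (θhat (n k) (N k))) F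
        (𝓝 (projNormSq (matH ν q) (matH ν q *ᵥ L))) := by
  have hnpos : ∀ᶠ k in (F : Filter I), ∀ i, 0 < n k i :=
    eventually_all.mpr fun i => (hn i).eventually_gt_atTop 0
  have hwpos : ∀ᶠ k in (F : Filter I), ∀ j, 0 < colFreq (n k) (N k) j :=
    eventually_all.mpr fun j => (hw j).eventually_const_lt (hq j)
  set a : I → ℝ := fun k => frac (n k)
  set s : I → ℝ := fun k => √(total (n k))
  have ha : Tendsto a F (𝓝 (ν 0)) := hν 0
  have ha1 : Tendsto (fun k => 1 - a k) F (𝓝 (ν 1)) := by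
    refine (hν 1).congr' ?_
    filter_upwards [hnpos] with k hk
    exact (one_sub_frac hk).symm
  have hν1 : ν 0 + ν 1 = 1 := by
    have := tendsto_nhds_unique ha1 (ha.const_sub 1)
    linarith
  have htot : Tendsto (fun k => total (n k)) F atTop := by
    simp only [total, Fin.sum_univ_two]
    exact tendsto_atTop_mono (fun k => le_add_of_nonneg_right (Nat.cast_nonneg _))
      (tendsto_natCast_atTop_atTop.comp (hn 0))
  have hs : Tendsto s F atTop := Real.tendsto_sqrt_atTop.comp htot
  have hV : ∀ j, Tendsto (fun k => deviation (n k) (N k) j) F (𝓝 (diffAdj L j)) := by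
    intro j
    have h1 := ((continuous_diffAdj j).tendsto L).comp (tendsto_pi_nhds.mpr hL)
    refine h1.congr' ?_
    filter_upwards [hnpos, hrow] with k hk hr
    exact diffAdj_partialSum (sum_deviation hk hr) j
  have hex : ∀ k, ∃ p : (Fin (m + 1) → ℝ) × (Fin m → ℝ), (∀ j, 0 < colFreq (n k) (N k) j) →
      IsIsotonic (colFreq (n k) (N k)) (deviation (n k) (N k)) p.1 p.2 := by
    intro k
    by_cases hk : ∀ j, 0 < colFreq (n k) (N k) j
    · obtain ⟨u, lam, h⟩ := exists_isIsotonic hk (deviation (n k) (N k))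
      exact ⟨(u, lam), fun _ => h⟩
    · exact ⟨(0, 0), fun h => absurd h hk⟩
  choose p hp using hex
  set u : I → Fin (m + 1) → ℝ := fun k => (p k).1
  obtain ⟨u', lam', hiso, hu⟩ :=
    exists_tendsto_isIsotonic F (hwpos.mono fun k hk => hp k hk) hq hw hV
  have hu : ∀ j, Tendsto (fun k => u k j) F (𝓝 (u' j)) := hu
  have hu0 : ∀ j, Tendsto (fun k => u k j / s k) F (𝓝 0) := fun j => (hu j).div_atTop hs
  have hρ : ∀ j, Tendsto (fun k => a k + u k j / s k) F (𝓝 (ν 0)) := by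
    intro j
    simpa using ha.add (hu0 j)
  have hρ1 : ∀ j, Tendsto (fun k => 1 - a k - u k j / s k) F (𝓝 (ν 1)) := by
    intro j
    simpa using ha1.sub (hu0 j)
  have hgood : ∀ᶠ k in (F : Filter I), (∀ i, 0 < n k i) ∧ (∀ j, 0 < colFreq (n k) (N k) j) ∧
      (∀ j, 0 < a k + u k j / s k) ∧ (∀ j, 0 < 1 - a k - u k j / s k) ∧
      (∀ i, ∑ j, N k i j = n k i) := by
    filter_upwards [hnpos, hwpos, hrow,
      eventually_all.mpr fun j => (hρ j).eventually_const_lt (hν_pos 0),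
      eventually_all.mpr fun j => (hρ1 j).eventually_const_lt (hν_pos 1)] with k h1 h2 h3 h4 h5
    exact ⟨h1, h2, h4, h5, h3⟩
  set c := deriv (deriv φ) 1
  have hc : 0 < c := hφ.deriv_two_pos
  have hv0 := hν_pos 0
  have hv1 := hν_pos 1
  -- One cell contributes `s ^ 2 x φ (1 + t)`, where `x` is the fitted probability.
  have hcell : ∀ {x t : I → ℝ} {ξ τ : ℝ}, Tendsto x F (𝓝 ξ) →
      Tendsto (fun k => s k * t k) F (𝓝 τ) →
      Tendsto (fun k => 2 / c * (x k * (s k ^ 2 * φ (1 + t k)))) F (𝓝 (ξ * τ ^ 2)) := by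
    intro x t ξ τ hx ht
    have h := (hx.mul (hφ.tendsto_sq_mul hs ht)).const_mul (2 / c)
    convert h using 2
    change _ = 2 / c * (ξ * (c / 2 * τ ^ 2))
    field_simp
  have hcancel : ∀ {y z : I → ℝ} {η ζ : ℝ}, Tendsto y F (𝓝 η) → Tendsto z F (𝓝 ζ) → ζ ≠ 0 →
      Tendsto (fun k => s k * (y k / z k / s k)) F (𝓝 (η / ζ)) := by
    intro y z η ζ hy hz hζ
    refine (hy.div hz hζ).congr' ?_
    filter_upwards [hs.eventually_gt_atTop 0] with k hk
    rw [Pi.div_apply, mul_div_cancel₀ _ hk.ne']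
  have hval := hiso.projNormSq_eq hν_pos hq
  rw [hval]
  constructor
  · have hlim := tendsto_finsetSum (Finset.univ : Finset (Fin (m + 1))) fun j _ =>
      (hcell ((hw j).mul ha) (hcancel (hu j) ha hv0.ne')).add
        (hcell ((hw j).mul ha1) (hcancel (hu j).neg ha1 hv1.ne'))
    have e : ∑ j, (q j * ν 0 * (u' j / ν 0) ^ 2 + q j * ν 1 * (-u' j / ν 1) ^ 2) =
        1 / (ν 0 * ν 1) * ∑ j, q j * u' j ^ 2 := by
      rw [Finset.mul_sum]
      refine Finset.sum_congr rfl fun j _ => ?_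
      field_simp
      linear_combination (u' j ^ 2 * q j) * hν1
    rw [e] at hlim
    refine hlim.congr' ?_
    filter_upwards [hgood] with k ⟨h1, h2, h3, h4, h5⟩
    have ht := jointProb_mle_order h1 h5 h2 (hp k h2) h3 h4 htilde
    have hh := jointProb_mle_null h1 h5 h2 hhat
    have hT := total_pos h1
    have hsp : 0 < s k := Real.sqrt_pos.mpr hT
    have hss : s k ^ 2 = total (n k) := Real.sq_sqrt hT.le
    have hak : 0 < a k := frac_pos h1
    have hak1 : 0 < 1 - a k := one_sub_frac_pos h1
    rw [statS, phiDiv_of_pos fun i j => jointProb_pos (n k) h1 _ i j, Finset.mul_sum]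
    refine Finset.sum_congr rfl fun j _ => ?_
    rw [(ht j).1, (ht j).2, (hh j).1, (hh j).2, hss]
    have hwj := h2 j
    change _ = 2 * total (n k) / c * (colFreq (n k) (N k) j * a k *
      φ (colFreq (n k) (N k) j * (a k + u k j / s k) / (colFreq (n k) (N k) j * a k)) +
      colFreq (n k) (N k) j * (1 - a k) *
      φ (colFreq (n k) (N k) j * (1 - a k - u k j / s k) / (colFreq (n k) (N k) j * (1 - a k))))
    have e1 : colFreq (n k) (N k) j * (a k + u k j / s k) / (colFreq (n k) (N k) j * a k) =
        1 + u k j / a k / s k := by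
      field_simp
    have e2 : colFreq (n k) (N k) j * (1 - a k - u k j / s k) /
        (colFreq (n k) (N k) j * (1 - a k)) = 1 + -u k j / (1 - a k) / s k := by
      field_simp
      ring
    rw [e1, e2]
    ring
  · have hq0 : ∀ j, q j * ν 0 ≠ 0 := fun j => (mul_pos (hq j) hv0).ne'
    have hq1 : ∀ j, q j * ν 1 ≠ 0 := fun j => (mul_pos (hq j) hv1).ne'
    have hR : ∀ j, Tendsto (fun k => deviation (n k) (N k) j - colFreq (n k) (N k) j * u k j) F
        (𝓝 (diffAdj L j - q j * u' j)) := fun j => (hV j).sub ((hw j).mul (hu j))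
    have hlim := tendsto_finsetSum (Finset.univ : Finset (Fin (m + 1))) fun j _ =>
      ((hcell ((hw j).mul ha) (hcancel (hV j) ((hw j).mul ha) (hq0 j))).add
        (hcell ((hw j).mul ha1) (hcancel (hV j).neg ((hw j).mul ha1) (hq1 j)))).sub
      ((hcell ((hw j).mul (hρ j)) (hcancel (hR j) ((hw j).mul (hρ j)) (hq0 j))).add
        (hcell ((hw j).mul (hρ1 j)) (hcancel (hR j).neg ((hw j).mul (hρ1 j)) (hq1 j))))
    have e : ∑ j, (q j * ν 0 * (diffAdj L j / (q j * ν 0)) ^ 2 +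
        q j * ν 1 * (-diffAdj L j / (q j * ν 1)) ^ 2 -
        (q j * ν 0 * ((diffAdj L j - q j * u' j) / (q j * ν 0)) ^ 2 +
        q j * ν 1 * (-(diffAdj L j - q j * u' j) / (q j * ν 1)) ^ 2)) =
        1 / (ν 0 * ν 1) * ∑ j, q j * u' j ^ 2 := by
      have h2 : ∑ j, q j * u' j ^ 2 = ∑ j, (2 * (diffAdj L j * u' j) - q j * u' j ^ 2) := by
        rw [Finset.sum_sub_distrib, ← Finset.mul_sum, ← hiso.sum_mul_sq]
        ring
      rw [h2, Finset.mul_sum]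
      refine Finset.sum_congr rfl fun j _ => ?_
      have := hq j
      field_simp
      linear_combination q j * (2 * diffAdj L j * u' j - q j * u' j ^ 2) * hν1
    rw [e] at hlim
    refine hlim.congr' ?_
    filter_upwards [hgood] with k ⟨h1, h2, h3, h4, h5⟩
    have ht := jointProb_mle_order h1 h5 h2 (hp k h2) h3 h4 htilde
    have hh := jointProb_mle_null h1 h5 h2 hhat
    have hT := total_pos h1
    have hsp : 0 < s k := Real.sqrt_pos.mpr hT
    have hss : s k ^ 2 = total (n k) := Real.sq_sqrt hT.le
    have hak : 0 < a k := frac_pos h1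
    have hak1 : 0 < 1 - a k := one_sub_frac_pos h1
    rw [statT, phiDiv_of_pos fun i j => jointProb_pos (n k) h1 _ i j,
      phiDiv_of_pos fun i j => jointProb_pos (n k) h1 _ i j, ← Finset.sum_sub_distrib,
      Finset.mul_sum]
    refine Finset.sum_congr rfl fun j _ => ?_
    have hwj := h2 j
    have h3j := h3 j
    have h4j := h4 j
    set wj := colFreq (n k) (N k) j
    set Vj := deviation (n k) (N k) j
    have r0 : relFreq (n k) (N k) 0 j = a k * wj + Vj / s k := by
      rw [relFreq, cell_zero h1 j, div_eq_iff hT.ne']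
      change total (n k) * (a k * wj) + s k * Vj = _
      rw [← hss]
      field_simp
    have r1 : relFreq (n k) (N k) 1 j = (1 - a k) * wj - Vj / s k := by
      rw [relFreq, cell_one h1 j, div_eq_iff hT.ne']
      change total (n k) * ((1 - a k) * wj) - s k * Vj = _
      rw [← hss]
      field_simp
    rw [(ht j).1, (ht j).2, (hh j).1, (hh j).2, r0, r1, hss]
    change _ = 2 * total (n k) / c * (wj * a k * φ ((a k * wj + Vj / s k) / (wj * a k)) +
      wj * (1 - a k) * φ (((1 - a k) * wj - Vj / s k) / (wj * (1 - a k))) -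
      (wj * (a k + u k j / s k) * φ ((a k * wj + Vj / s k) / (wj * (a k + u k j / s k))) +
      wj * (1 - a k - u k j / s k) *
        φ (((1 - a k) * wj - Vj / s k) / (wj * (1 - a k - u k j / s k)))))
    have e1 : (a k * wj + Vj / s k) / (wj * a k) = 1 + Vj / (wj * a k) / s k := by
      field_simp
    have e2 : ((1 - a k) * wj - Vj / s k) / (wj * (1 - a k)) =
        1 + -Vj / (wj * (1 - a k)) / s k := by
      field_simp
      ring
    have e3 : (a k * wj + Vj / s k) / (wj * (a k + u k j / s k)) =
        1 + (Vj - wj * u k j) / (wj * (a k + u k j / s k)) / s k := by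
      exact div_fitted_eq hwj.ne' hsp.ne' h3j.ne' rfl
    have e4 : ((1 - a k) * wj - Vj / s k) / (wj * (1 - a k - u k j / s k)) =
        1 + -(Vj - wj * u k j) / (wj * (1 - a k - u k j / s k)) / s k := by
      have := div_fitted_eq (a := 1 - a k) (V := -Vj) (u := -u k j) hwj.ne' hsp.ne' h4j.ne'
        (by ring)
      rw [neg_div, ← sub_eq_add_neg] at this
      rw [this]
      ring
    rw [e1, e2, e3, e4]
    ring

end Limit

/-! ### Characteristic functions of multinomial vectors -/

open Complex in
/-- `Complex.tendsto_one_add_pow_exp_of_tendsto` along a general filter. -/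
theorem tendsto_one_add_pow_exp {K : Type*} {l : Filter K} {M : K → ℕ} {g : K → ℂ} {t : ℂ}
    (hM : Tendsto M l atTop) (hg : Tendsto (fun k => (M k : ℂ) * g k) l (𝓝 t)) :
    Tendsto (fun k => (1 + g k) ^ M k) l (𝓝 (exp t)) := by
  have hinv : Tendsto (fun k => ((M k : ℂ))⁻¹) l (𝓝 0) :=
    (tendsto_inv_atTop_nhds_zero_nat (𝕜 := ℂ)).comp hM
  have hg0 : Tendsto g l (𝓝 0) := by
    have h1 := hinv.mul hg
    rw [zero_mul] at h1
    refine h1.congr' ?_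
    filter_upwards [hM.eventually_gt_atTop 0] with k hk
    rw [inv_mul_cancel_left₀ (Nat.cast_ne_zero.mpr hk.ne')]
  have hlog : Tendsto (fun k => (M k : ℂ) * (log (1 + g k) - g k)) l (𝓝 0) := by
    have h1 := (Asymptotics.isBigO_refl (fun k => (M k : ℂ)) l).mul
      (log_sub_self_isBigO.comp_tendsto hg0)
    refine h1.trans_tendsto ?_
    have h2 := hg.mul hg0
    rw [mul_zero] at h2
    refine h2.congr fun k => ?_
    simp only [Function.comp_apply]
    ring
  have hsum := hlog.add hg
  rw [zero_add] at hsum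
  refine ((continuous_exp.tendsto _).comp hsum).congr' ?_
  have hne : ∀ᶠ k in l, 1 + g k ≠ 0 := by
    have h1 : Tendsto (fun k => 1 + g k) l (𝓝 (1 + 0)) := tendsto_const_nhds.add hg0
    exact h1.eventually_ne (by simp)
  filter_upwards [hne] with k hk
  rw [Function.comp_apply, ← mul_add, sub_add_cancel, exp_nat_mul, exp_log hk]

open Complex in
/-- The second order expansion of `exp (b * I)`, for arrays. -/
theorem tendsto_mul_exp_sub {K : Type*} {l : Filter K} {M : K → ℕ} {b : K → ℝ} {γ : ℝ}
    (hM : Tendsto M l atTop) (hb : Tendsto (fun k => √(M k) * b k) l (𝓝 γ)) :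
    Tendsto (fun k => (M k : ℂ) * (exp (b k * I) - 1 - b k * I)) l (𝓝 (-(γ ^ 2 / 2 : ℝ))) := by
  have hMr : Tendsto (fun k => √(M k : ℝ)) l atTop :=
    Real.tendsto_sqrt_atTop.comp (tendsto_natCast_atTop_atTop.comp hM)
  have hb0 : Tendsto b l (𝓝 0) := by
    have h1 := (tendsto_inv_atTop_zero.comp hMr).mul hb
    rw [zero_mul] at h1
    refine h1.congr' ?_
    filter_upwards [hMr.eventually_gt_atTop 0] with k hk
    rw [Function.comp_apply, inv_mul_cancel_left₀ hk.ne']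
  have hsq : Tendsto (fun k => (M k : ℝ) * b k ^ 2) l (𝓝 (γ ^ 2)) := by
    refine (hb.pow 2).congr fun k => ?_
    rw [mul_pow, Real.sq_sqrt (Nat.cast_nonneg _)]
  have hb0' : Tendsto (fun k => (b k : ℂ) * I) l (𝓝 0) := by
    have h1 : Tendsto (fun k => (b k : ℂ) * I) l (𝓝 (((0 : ℝ) : ℂ) * I)) :=
      ((continuous_ofReal.tendsto 0).comp hb0).mul_const I
    simpa using h1
  have hR : Tendsto (fun k => (M k : ℂ) *
      (exp (b k * I) - ∑ i ∈ Finset.range 3, (b k * I : ℂ) ^ i / (i.factorial : ℂ))) l (𝓝 0) := by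
    have h1 := (Asymptotics.isBigO_refl (fun k => (M k : ℂ)) l).mul
      ((exp_sub_sum_range_isBigO_pow 3).comp_tendsto hb0')
    refine h1.trans_tendsto ?_
    have h2 := ((continuous_ofReal.tendsto _).comp (hsq.mul hb0)).mul_const (-I)
    rw [mul_zero, ofReal_zero, zero_mul] at h2
    refine h2.congr fun k => ?_
    simp only [Function.comp_apply, mul_pow, I_pow_three]
    push_cast
    ring
  have hlim := hR.add ((continuous_ofReal.tendsto _).comp (hsq.div_const 2).neg)
  rw [zero_add] at hlim
  rw [← ofReal_neg]
  refine hlim.congr fun k => ?_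
  simp only [Function.comp_apply, Finset.sum_range_succ, Finset.sum_range_zero, pow_zero, pow_one,
    Nat.factorial, mul_pow, I_sq]
  push_cast
  ring

open Complex in
/-- The limit of the characteristic function of a sum of independent, identically distributed
variables with a finite number of values, for arrays. -/
theorem tendsto_sum_exp_pow {ι K : Type*} [Fintype ι] {l : Filter K} {M : K → ℕ}
    (hM : Tendsto M l atTop) {q : ι → ℝ} (hq : ∑ j, q j = 1) {b : K → ι → ℝ} {A : ℝ} {γ : ι → ℝ}
    (hA : Tendsto (fun k => ∑ j, q j * (M k * b k j)) l (𝓝 A))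
    (hγ : ∀ j, Tendsto (fun k => √(M k) * b k j) l (𝓝 (γ j))) :
    Tendsto (fun k => (∑ j, (q j : ℂ) * exp (b k j * I)) ^ M k) l
      (𝓝 (exp (A * I + (-(∑ j, q j * γ j ^ 2) / 2 : ℝ)))) := by
  have h1 : ∀ k, ∑ j, (q j : ℂ) * exp (b k j * I) =
      1 + ∑ j, (q j : ℂ) * (exp (b k j * I) - 1) := by
    intro k
    have hq' : ∑ j, (q j : ℂ) = 1 := by
      rw [← ofReal_sum, hq, ofReal_one]
    simp only [mul_sub, mul_one, Finset.sum_sub_distrib, hq']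
    ring
  simp only [h1]
  refine tendsto_one_add_pow_exp hM ?_
  have h2 := ((continuous_ofReal.tendsto _).comp hA).mul_const I |>.add
    (tendsto_finsetSum Finset.univ fun j _ => (tendsto_mul_exp_sub hM (hγ j)).const_mul (q j : ℂ))
  have e : (∑ j, (q j : ℂ) * (-((γ j ^ 2 / 2 : ℝ) : ℂ))) =
      ((-(∑ j, q j * γ j ^ 2) / 2 : ℝ) : ℂ) := by
    push_cast
    rw [neg_div, Finset.sum_div, ← Finset.sum_neg_distrib]
    exact Finset.sum_congr rfl fun j _ => by ring
  rw [e] at h2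
  refine h2.congr fun k => ?_
  simp only [Function.comp_apply]
  push_cast
  rw [Finset.sum_mul, Finset.mul_sum, ← Finset.sum_add_distrib]
  exact Finset.sum_congr rfl fun j _ => by ring

section Multinomial

variable {m : ℕ} {q : Fin (m + 1) → ℝ}

theorem isProbabilityMeasure_categorical {ι : Type*} [Fintype ι] [MeasurableSpace ι]
    {q : ι → ℝ} (hq : ∀ j, 0 ≤ q j) (hsum : ∑ j, q j = 1) :
    IsProbabilityMeasure (categorical q) := by
  refine ⟨?_⟩
  rw [categorical, Measure.finsetSum_apply]
  simp only [Measure.smul_apply, measure_univ, smul_eq_mul, mul_one]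
  rw [← ENNReal.ofReal_sum_of_nonneg fun j _ => hq j, hsum, ENNReal.ofReal_one]

theorem integral_categorical {ι : Type*} [Fintype ι] [MeasurableSpace ι]
    [MeasurableSingletonClass ι] {q : ι → ℝ} (hq : ∀ j, 0 ≤ q j) (f : ι → ℂ) :
    ∫ y, f y ∂categorical q = ∑ j, (q j : ℂ) * f j := by
  rw [categorical, integral_finsetSum_measure]
  · refine Finset.sum_congr rfl fun j _ => ?_
    rw [integral_smul_measure, integral_dirac, ENNReal.toReal_ofReal (hq j)]
    rfl
  · intro j _
    exact (Integrable.of_finite).smul_measure ENNReal.ofReal_ne_top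

open Complex in
/-- The characteristic function of the multinomial distribution. -/
theorem integral_exp_multinomial (n : ℕ) (hq : ∀ j, 0 ≤ q j) (hsum : ∑ j, q j = 1)
    (b : Fin (m + 1) → ℝ) :
    ∫ x, exp (((∑ j, b j * (x j : ℝ) : ℝ) : ℂ) * I) ∂multinomial n q =
      (∑ j, (q j : ℂ) * exp (b j * I)) ^ n := by
  have := isProbabilityMeasure_categorical hq hsum
  rw [multinomial, integral_map (Measurable.of_discrete).aemeasurable
    (Measurable.of_discrete).aestronglyMeasurable]
  have h1 : ∀ y : Fin n → Fin (m + 1),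
      exp (((∑ j, b j * (((Finset.univ.filter fun a => y a = j).card : ℕ) : ℝ) : ℝ) : ℂ) * I) =
        ∏ a, exp (b (y a) * I) := by
    intro y
    rw [← exp_sum, ← Finset.sum_mul, ← ofReal_sum,
      ← Finset.sum_fiberwise_of_maps_to (s := Finset.univ) (t := Finset.univ) (g := y)
        (fun _ _ => Finset.mem_univ _)]
    congr 3
    refine Finset.sum_congr rfl fun j _ => ?_
    rw [Finset.sum_congr rfl (g := fun _ => b j) fun a ha => by rw [(Finset.mem_filter.mp ha).2],
      Finset.sum_const, nsmul_eq_mul, mul_comm]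
  simp only [h1]
  rw [integral_fintype_prod_eq_pow (fun y : Fin (m + 1) => exp (b y * I)),
    integral_categorical hq, Fintype.card_fin]

theorem ae_sum_multinomial (n : ℕ) : ∀ᵐ x ∂multinomial n q, ∑ j, x j = n := by
  rw [multinomial, ae_map_iff (Measurable.of_discrete).aemeasurable (MeasurableSet.of_discrete)]
  refine Eventually.of_forall fun y => ?_
  rw [← Finset.card_eq_sum_card_fiberwise (f := y)
    (fun _ _ => Finset.mem_coe.mpr (Finset.mem_univ _))]
  simp

end Multinomial

/-! ### The limit law of the score -/

open Matrix

/-- If the local odds ratios are `1`, the rows have the same distribution. -/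
theorem condProb_eq_of_localOddsRatio_eq_one {m : ℕ} {θ : Param m}
    (h : ∀ j, localOddsRatio (condProb θ) j = 1) (i : Fin 2) : condProb θ i = condProb θ 0 := by
  have hc : ∀ l, diffOp (extendZero θ.2) l = 0 := by
    intro l
    rw [← constraint_eq_diffOp, ← log_localOddsRatio, h l, Real.log_one]
  have h0 : ∀ j, extendZero θ.2 j = 0 := by
    intro j
    induction j using Fin.reverseInduction with
    | last => exact extendZero_last _
    | cast l ih =>
      have := hc l
      rw [diffOp, ih, sub_zero] at this
      exact this
  have hl : ∀ i j, linPred θ i j = linPred θ 0 j := fun i j => by simp [linPred, h0]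
  ext j
  simp only [condProb, hl i]

section Portmanteau

variable {Ω Ω' : Type*} [MeasurableSpace Ω] [MeasurableSpace Ω'] {P : Measure Ω}
  [IsProbabilityMeasure P] {μ : Measure Ω'} [IsProbabilityMeasure μ]
  {E : Type*} [TopologicalSpace E] [MeasurableSpace E] [BorelSpace E] [HasOuterApproxClosed E]
  {Y : ℕ → Ω → E} {Z : Ω' → E} (h : TendstoInDistribution Y atTop Z (fun _ => P) μ)

include h

theorem eventually_measureReal_closed_lt {F : Set E} (hF : IsClosed F) {δ : ℝ} (hδ : 0 < δ) :
    ∀ᶠ k in atTop, P.real {ω | Y k ω ∈ F} < μ.real {z | Z z ∈ F} + δ := by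
  have h1 := ProbabilityMeasure.limsup_measure_closed_le_of_tendsto h.tendsto hF
  simp only [ProbabilityMeasure.coe_mk,
    Measure.map_apply_of_aemeasurable h.aemeasurable_limit hF.measurableSet,
    Measure.map_apply_of_aemeasurable (h.forall_aemeasurable _) hF.measurableSet] at h1
  have h2 : μ (Z ⁻¹' F) < ENNReal.ofReal (μ.real (Z ⁻¹' F) + δ) := by
    rw [ENNReal.lt_ofReal_iff_toReal_lt (measure_ne_top _ _)]
    exact lt_add_of_pos_right _ hδ
  filter_upwards [eventually_lt_of_limsup_lt (h1.trans_lt h2)] with k hk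
  rw [ENNReal.lt_ofReal_iff_toReal_lt (measure_ne_top _ _)] at hk
  exact hk

theorem eventually_lt_measureReal_open {G : Set E} (hG : IsOpen G) {δ : ℝ} (hδ : 0 < δ) :
    ∀ᶠ k in atTop, μ.real {z | Z z ∈ G} - δ < P.real {ω | Y k ω ∈ G} := by
  filter_upwards [eventually_measureReal_closed_lt h hG.isClosed_compl hδ] with k hk
  have e : μ.real {z | Z z ∈ Gᶜ} = 1 - μ.real {z | Z z ∈ G} :=
    probReal_compl_eq_one_sub₀ (h.aemeasurable_limit.nullMeasurableSet_preimage hG.measurableSet)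
  rw [e] at hk
  have hle : (1 : ℝ) ≤ P.real {ω | Y k ω ∈ G} + P.real {ω | Y k ω ∈ Gᶜ} := by
    rw [← probReal_univ (μ := P)]
    refine (measureReal_mono fun ω _ => ?_).trans (measureReal_union_le _ _)
    exact em (Y k ω ∈ G)
  linarith

end Portmanteau

section Table

variable {m : ℕ} {Ω : Type*} [MeasurableSpace Ω] {P : Measure Ω}
  {q : Fin (m + 1) → ℝ} (hq : ∀ j, 0 < q j) (hsum : ∑ j, q j = 1)

theorem aemeasurable_comp_table {E : Type*} [MeasurableSpace E] {N : Fin 2 → Ω → Fin (m + 1) → ℕ}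
    (hN : ∀ i, AEMeasurable (N i) P) (f : Table m → E) :
    AEMeasurable (fun ω => f fun i => N i ω) P :=
  (measurable_of_countable f).comp_aemeasurable (aemeasurable_pi_iff.mpr hN)

theorem ae_sum_eq {n : Fin 2 → ℕ} {N : Fin 2 → Ω → Fin (m + 1) → ℕ}
    (hlaw : ∀ i, HasLaw (N i) (multinomial (n i) q) P) : ∀ᵐ ω ∂P, ∀ i, ∑ j, N i ω j = n i := by
  refine ae_all_iff.mpr fun i => ?_
  have h := ae_sum_multinomial (q := q) (n i)
  rw [← (hlaw i).map_eq] at h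
  exact ae_of_ae_map (hlaw i).aemeasurable h

open Complex in
include hq hsum in
theorem integral_exp_table {n : Fin 2 → ℕ} {N : Fin 2 → Ω → Fin (m + 1) → ℕ}
    (hlaw : ∀ i, HasLaw (N i) (multinomial (n i) q) P) (hind : IndepFun (N 0) (N 1) P)
    (b : Fin 2 → Fin (m + 1) → ℝ) :
    ∫ ω, exp (((∑ i, ∑ j, b i j * (N i ω j : ℝ) : ℝ) : ℂ) * I) ∂P =
      ∏ i, (∑ j, (q j : ℂ) * exp (b i j * I)) ^ n i := by
  have h1 : ∀ i, ∫ ω, exp (((∑ j, b i j * (N i ω j : ℝ) : ℝ) : ℂ) * I) ∂P =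
      (∑ j, (q j : ℂ) * exp (b i j * I)) ^ n i := by
    intro i
    rw [← integral_exp_multinomial (n i) (fun j => (hq j).le) hsum (b i), ← (hlaw i).map_eq,
      integral_map (hlaw i).aemeasurable (measurable_of_countable _).aestronglyMeasurable]
  rw [Fin.prod_univ_two, ← h1 0, ← h1 1,
    ← hind.integral_fun_comp_mul_comp (hlaw 0).aemeasurable (hlaw 1).aemeasurable
      (f := fun x => exp (((∑ j, b 0 j * (x j : ℝ) : ℝ) : ℂ) * I))
      (g := fun x => exp (((∑ j, b 1 j * (x j : ℝ) : ℝ) : ℂ) * I))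
      (measurable_of_countable _).aestronglyMeasurable
      (measurable_of_countable _).aestronglyMeasurable]
  refine integral_congr_ae (Eventually.of_forall fun ω => ?_)
  simp only [Fin.sum_univ_two]
  rw [← exp_add, ← add_mul]
  push_cast
  rfl

omit [MeasurableSpace Ω] in
theorem add_eq_one_of_tendsto {n : ℕ → Fin 2 → ℕ}
    (hn : ∀ i, Tendsto (fun k => n k i) atTop atTop) {ν : Fin 2 → ℝ}
    (hν : ∀ i, Tendsto (fun k => (n k i : ℝ) / total (n k)) atTop (𝓝 (ν i))) : ν 0 + ν 1 = 1 := by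
  refine tendsto_nhds_unique ((hν 0).add (hν 1)) (tendsto_const_nhds.congr' ?_)
  filter_upwards [(hn 0).eventually_gt_atTop 0] with k hk
  have h : 0 < total (n k) := by
    rw [total, Fin.sum_univ_two]
    positivity
  rw [← add_div, eq_comm, div_eq_one_iff_eq h.ne', total, Fin.sum_univ_two]

variable {n : ℕ → Fin 2 → ℕ} (hn : ∀ i, Tendsto (fun k => n k i) atTop atTop)
  {N : ℕ → Fin 2 → Ω → Fin (m + 1) → ℕ}
  (hlaw : ∀ k i, HasLaw (N k i) (multinomial (n k i) q) P)
  (hind : ∀ k, IndepFun (N k 0) (N k 1) P)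

include hq hsum hn hlaw hind

open Complex in
theorem tendsto_integral_exp_table {b : ℕ → Fin 2 → Fin (m + 1) → ℝ} {A : Fin 2 → ℝ}
    {γ : Fin 2 → Fin (m + 1) → ℝ}
    (hA : ∀ i, Tendsto (fun k => ∑ j, q j * (n k i * b k i j)) atTop (𝓝 (A i)))
    (hγ : ∀ i j, Tendsto (fun k => √(n k i) * b k i j) atTop (𝓝 (γ i j))) :
    Tendsto (fun k => ∫ ω, exp (((∑ i, ∑ j, b k i j * (N k i ω j : ℝ) : ℝ) : ℂ) * I) ∂P) atTop
      (𝓝 (∏ i, exp (A i * I + (-(∑ j, q j * γ i j ^ 2) / 2 : ℝ)))) := by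
  simp only [integral_exp_table hq hsum (hlaw _) (hind _)]
  exact tendsto_finsetProd _ fun i _ => tendsto_sum_exp_pow (hn i) hsum (hA i) (hγ i)

variable {ν : Fin 2 → ℝ} (hν : ∀ i, Tendsto (fun k => (n k i : ℝ) / total (n k)) atTop (𝓝 (ν i)))
  [IsProbabilityMeasure P]

include hν in
/-- The law of large numbers for the column frequencies. -/
theorem tendsto_measure_colFreq (j : Fin (m + 1)) {ε : ℝ} (hε : 0 < ε) :
    Tendsto (fun k => P.real {ω | ε ≤ |colFreq (n k) (fun i => N k i ω) j - q j|}) atTop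
      (𝓝 0) := by
  have hY : ∀ k, AEMeasurable (fun ω => colFreq (n k) (fun i => N k i ω) j) P := fun k =>
    aemeasurable_comp_table (fun i => (hlaw k i).aemeasurable) fun T => colFreq (n k) T j
  have hν1 := add_eq_one_of_tendsto hn hν
  have hconv : TendstoInDistribution (fun k ω => colFreq (n k) (fun i => N k i ω) j) atTop id
      (fun _ => P) (Measure.dirac (q j)) := by
    refine ⟨hY, by fun_prop, ProbabilityMeasure.tendsto_of_tendsto_charFun fun t => ?_⟩
    simp only [ProbabilityMeasure.coe_mk, Measure.map_id]
    have hlim := tendsto_integral_exp_table hq hsum hn hlaw hind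
      (b := fun k _ j' => if j' = j then t / total (n k) else 0) (A := fun i => q j * t * ν i)
      (γ := fun _ _ => 0) (fun i => ?_) (fun i j' => ?_)
    · convert! hlim using 1
      · ext k
        rw [charFun_apply_real, integral_map (hY k) (by fun_prop)]
        refine integral_congr_ae (Eventually.of_forall fun ω => ?_)
        simp only [ite_mul, zero_mul, Finset.sum_ite_eq', Finset.mem_univ, if_true, colFreq,
          Fin.sum_univ_two]
        congr 2
        push_cast
        ring
      · rw [charFun_dirac, Fin.prod_univ_two, ← Complex.exp_add]
        have e : ν 1 = 1 - ν 0 := by linarith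
        congr 2
        simp only [e, RCLike.inner_apply, conj_trivial]
        push_cast
        simp
        ring
    · have h1 := (hν i).const_mul (q j * t)
      refine h1.congr fun k => ?_
      simp only [mul_ite, mul_zero, Finset.sum_ite_eq', Finset.mem_univ, if_true]
      ring
    · have hs : Tendsto (fun k => √(n k i : ℝ)) atTop atTop :=
        Real.tendsto_sqrt_atTop.comp (tendsto_natCast_atTop_atTop.comp (hn i))
      have h1 := ((tendsto_inv_atTop_zero.comp hs).mul (hν i)).mul_const (if j' = j then t else 0)
      rw [zero_mul, zero_mul] at h1
      refine h1.congr' ?_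
      filter_upwards [hs.eventually_gt_atTop 0] with k hk
      have e : (n k i : ℝ) = √(n k i : ℝ) * √(n k i : ℝ) :=
        (Real.mul_self_sqrt (Nat.cast_nonneg _)).symm
      simp only [Function.comp_apply]
      split_ifs
      · nth_rewrite 2 [e]
        field_simp
      · simp
  have hF : IsClosed {x : ℝ | ε ≤ |x - q j|} :=
    isClosed_le continuous_const (by fun_prop)
  rw [tendsto_order]
  refine ⟨fun a ha => Eventually.of_forall fun k => ha.trans_le measureReal_nonneg, fun δ hδ => ?_⟩
  filter_upwards [eventually_measureReal_closed_lt hconv hF hδ] with k hk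
  have e : (Measure.dirac (q j)).real {x : ℝ | ε ≤ |x - q j|} = 0 := by
    rw [measureReal_def, Measure.dirac_apply' _ hF.measurableSet]
    simp [hε]
  simp only [id_eq] at hk
  rwa [e, zero_add] at hk

/-- The normalized partial sums in the coordinates where they have covariance `H` in the limit: for
`H = matH ν q` this is `H` times the partial sums of the deviations. -/
noncomputable def score (H : Matrix (Fin m) (Fin m) ℝ) (n : Fin 2 → ℕ) (N : Table m) :
    EuclideanSpace ℝ (Fin m) :=
  WithLp.toLp 2 (H *ᵥ cumDev n N)

omit hsum hn hlaw hind [IsProbabilityMeasure P] in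
/-- The linear forms in the score are linear in the cells of the table. -/
theorem inner_score {n : Fin 2 → ℕ} (hn : ∀ i, 0 < n i) {N : Table m}
    (hrow : ∀ i, ∑ j, N i j = n i) (ν : Fin 2 → ℝ) (t : EuclideanSpace ℝ (Fin m)) :
    inner ℝ (score (matH ν q) n N) t =
      ∑ j, 1 / (ν 0 * ν 1) * (diffAdj t.ofLp j / q j) * deviation n N j := by
  rw [EuclideanSpace.inner_eq_star_dotProduct, star_trivial, score, dotProduct_matH_mulVec ν hq,
    Finset.mul_sum]
  refine Finset.sum_congr rfl fun j _ => ?_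
  have h : diffAdj (cumDev n N) j = deviation n N j := diffAdj_partialSum (sum_deviation hn hrow) j
  rw [h]
  ring

omit hq hsum hn hind [IsProbabilityMeasure P] in
theorem aemeasurable_score (H : Matrix (Fin m) (Fin m) ℝ) (k : ℕ) :
    AEMeasurable (fun ω => score H (n k) fun i => N k i ω) P :=
  aemeasurable_comp_table (fun i => (hlaw k i).aemeasurable) fun T => score H (n k) T

include hν in
theorem tendsto_score (hν_pos : ∀ i, 0 < ν i) :
    TendstoInDistribution (fun k ω => score (matH ν q) (n k) fun i => N k i ω) atTop id
      (fun _ => P) (multivariateGaussian 0 (matH ν q)) := by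
  have hν1 := add_eq_one_of_tendsto hn hν
  have h0 := hν_pos 0
  have h1 := hν_pos 1
  have hY := aemeasurable_score hlaw (matH ν q)
  refine ⟨hY, by fun_prop, ProbabilityMeasure.tendsto_of_tendsto_charFun fun t => ?_⟩
  simp only [ProbabilityMeasure.coe_mk, Measure.map_id]
  set g : Fin (m + 1) → ℝ := fun j => 1 / (ν 0 * ν 1) * (diffAdj t.ofLp j / q j) with hg
  have hqg : ∑ j, q j * g j = 0 := by
    have e : ∀ j, q j * g j = 1 / (ν 0 * ν 1) * diffAdj t.ofLp j := fun j => by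
      have := (hq j).ne'
      simp only [hg]
      field_simp
    simp only [e, ← Finset.mul_sum, sum_diffAdj, mul_zero]
  -- `g j * c k i` is the coefficient of the cell `(i, j)` in the linear form `t` in the score.
  set c : ℕ → Fin 2 → ℝ := fun k i =>
    (if i = 0 then 1 - frac (n k) else -frac (n k)) / √(total (n k)) with hc
  have hfrac : Tendsto (fun k => frac (n k)) atTop (𝓝 (ν 0)) := hν 0
  have hlim := tendsto_integral_exp_table hq hsum hn hlaw hind
    (b := fun k i j => g j * c k i) (A := fun _ => 0)
    (γ := fun i j => √(ν i) * (if i = 0 then ν 1 else -ν 0) * g j) (fun i => ?_) (fun i j => ?_)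
  · have hval : charFun (multivariateGaussian 0 (matH ν q)) t =
        ∏ i, Complex.exp (((0 : ℝ) : ℂ) * Complex.I + (-(∑ j, q j *
          (√(ν i) * (if i = 0 then ν 1 else -ν 0) * g j) ^ 2) / 2 : ℝ)) := by
      rw [charFun_multivariateGaussian (posDef_matH hν_pos hq).posSemidef,
        dotProduct_matH_mulVec ν hq, Fin.prod_univ_two, ← Complex.exp_add]
      have e : (1 / (ν 0 * ν 1) * ∑ j, diffAdj t.ofLp j * diffAdj t.ofLp j / q j) =
          ∑ j, q j * (√(ν 0) * ν 1 * g j) ^ 2 + ∑ j, q j * (√(ν 1) * -ν 0 * g j) ^ 2 := by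
        rw [Finset.mul_sum, ← Finset.sum_add_distrib]
        refine Finset.sum_congr rfl fun j _ => ?_
        have e1 : (√(ν 0) * ν 1 * g j) ^ 2 = ν 0 * ν 1 ^ 2 * g j ^ 2 := by
          rw [mul_pow, mul_pow, Real.sq_sqrt h0.le]
        have e2 : (√(ν 1) * -ν 0 * g j) ^ 2 = ν 1 * ν 0 ^ 2 * g j ^ 2 := by
          rw [mul_pow, mul_pow, Real.sq_sqrt h1.le, neg_sq]
        have e3 : ν 0 * ν 1 ^ 2 * g j ^ 2 + ν 1 * ν 0 ^ 2 * g j ^ 2 =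
            (ν 0 + ν 1) * (ν 0 * ν 1) * g j ^ 2 := by ring
        have := (hq j).ne'
        rw [e1, e2, ← mul_add, e3, hν1]
        simp only [hg]
        field_simp
      rw [e]
      simp only [inner_zero_right, if_true, one_ne_zero, if_false]
      congr 1
      push_cast
      ring
    rw [hval]
    refine hlim.congr' ?_
    filter_upwards [(hn 0).eventually_gt_atTop 0, (hn 1).eventually_gt_atTop 0] with k hk0 hk1
    have hk : ∀ i, 0 < n k i := Fin.forall_fin_two.mpr ⟨hk0, hk1⟩
    rw [charFun_apply, integral_map (hY k) (by fun_prop)]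
    refine integral_congr_ae ?_
    filter_upwards [ae_sum_eq (hlaw k)] with ω hω
    have e : ∑ i, ∑ j, g j * c k i * (N k i ω j : ℝ) =
        inner ℝ (score (matH ν q) (n k) fun i => N k i ω) t := by
      rw [inner_score hq hk hω, Fin.sum_univ_two, ← Finset.sum_add_distrib]
      refine Finset.sum_congr rfl fun j _ => ?_
      simp only [hc, hg, deviation, if_true, one_ne_zero, if_false]
      ring
    rw [e]
  · refine (tendsto_const_nhds (x := (0 : ℝ))).congr fun k => ?_
    have e : ∀ j, q j * (n k i * (g j * c k i)) = n k i * c k i * (q j * g j) := fun j => by ring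
    simp only [e, ← Finset.mul_sum, hqg, mul_zero]
  · have h2 : Tendsto (fun k => if i = 0 then 1 - frac (n k) else -frac (n k)) atTop
        (𝓝 (if i = 0 then ν 1 else -ν 0)) := by
      split_ifs
      · rw [show ν 1 = 1 - ν 0 by linarith]
        exact hfrac.const_sub 1
      · exact hfrac.neg
    have h3 := ((hν i).sqrt.mul h2).mul_const (g j)
    refine h3.congr fun k => ?_
    rw [Real.sqrt_div (Nat.cast_nonneg _)]
    simp only [hc]
    ring

end Table

/-! ### The limit law of the statistics -/

section Approximation

variable {m : ℕ}

/-- The statistics are uniformly close to the squared norm of the projection of the score, over the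
large tables with column frequencies near `q` and a bounded score.  Otherwise there would be a sequence of
counterexamples, along which the score converges for some ultrafilter. -/
theorem exists_stat_close {φ : ℝ → ℝ} (hφ : IsPhi φ)
    {n : ℕ → Fin 2 → ℕ} (hn : ∀ i, Tendsto (fun k => n k i) atTop atTop)
    {ν : Fin 2 → ℝ} (hν_pos : ∀ i, 0 < ν i)
    (hν : ∀ i, Tendsto (fun k => (n k i : ℝ) / total (n k)) atTop (𝓝 (ν i)))
    {q : Fin (m + 1) → ℝ} (hq : ∀ j, 0 < q j)
    {θhat θtilde : (Fin 2 → ℕ) → Table m → Param m}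
    (hhat : IsMLEstimator (nullSpace m) θhat) (htilde : IsMLEstimator (orderSpace m) θtilde)
    {ε : ℝ} (hε : 0 < ε) (R : ℝ) :
    ∃ δ > 0, ∃ K, ∀ k ≥ K, ∀ T : Table m, (∀ i, ∑ j, T i j = n k i) →
      (∀ j, |colFreq (n k) T j - q j| < δ) → ‖score (matH ν q) (n k) T‖ ≤ R →
      |statS φ (n k) (θtilde (n k) T) (θhat (n k) T) -
          projNormSq (matH ν q) (score (matH ν q) (n k) T).ofLp| < ε ∧
        |statT φ (n k) T (θtilde (n k) T) (θhat (n k) T) -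
          projNormSq (matH ν q) (score (matH ν q) (n k) T).ofLp| < ε := by
  by_contra! hcon
  choose κ hκ T hrow hcol hR hfar using fun i : ℕ => hcon (1 / ((i : ℝ) + 1)) (by positivity) i
  have hH := posDef_matH hν_pos hq
  have hdet : IsUnit (matH ν q).det := hH.det_pos.ne'.isUnit
  set F : Ultrafilter ℕ := Ultrafilter.of atTop
  have hF : (F : Filter ℕ) ≤ atTop := Ultrafilter.of_le atTop
  have hκF : Tendsto κ F atTop := (tendsto_atTop_mono hκ tendsto_id).mono_left hF
  have hw : ∀ j, Tendsto (fun i => colFreq (n (κ i)) (T i) j) F (𝓝 (q j)) := fun j => by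
    rw [tendsto_iff_norm_sub_tendsto_zero]
    refine squeeze_zero (fun _ => norm_nonneg _) (fun i => (hcol i j).le)
      (tendsto_one_div_add_atTop_nhds_zero_nat.mono_left hF)
  obtain ⟨y, -, hy⟩ := (isCompact_closedBall (0 : EuclideanSpace ℝ (Fin m)) R).ultrafilter_le_nhds'
    (F.map fun i => score (matH ν q) (n (κ i)) (T i))
    (eventually_map.mpr (Eventually.of_forall fun i => mem_closedBall_zero_iff.mpr (hR i)))
  replace hy : Tendsto (fun i => score (matH ν q) (n (κ i)) (T i)) F (𝓝 y) := hy
  have hL : ∀ l, Tendsto (fun i => cumDev (n (κ i)) (T i) l) F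
      (𝓝 (((matH ν q)⁻¹ *ᵥ y.ofLp) l)) := fun l => by
    have hc : Continuous fun y : EuclideanSpace ℝ (Fin m) => ((matH ν q)⁻¹ *ᵥ y.ofLp) l := by
      fun_prop
    refine ((hc.tendsto y).comp hy).congr fun i => ?_
    simp only [Function.comp_apply, score]
    rw [mulVec_mulVec, nonsing_inv_mul _ hdet, one_mulVec]
  have hlim := tendsto_stat hφ F (fun i => (hn i).comp hκF) hν_pos (fun i => (hν i).comp hκF)
    (Eventually.of_forall hrow) hq hw hL hhat htilde
  rw [mulVec_mulVec, mul_nonsing_inv _ hdet, one_mulVec] at hlim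
  have hP := ((continuous_projNormSq hH).tendsto y).comp hy
  have hS := Metric.tendsto_nhds.mp (hlim.1.sub hP) ε hε
  have hT := Metric.tendsto_nhds.mp (hlim.2.sub hP) ε hε
  obtain ⟨i, h1, h2⟩ := (hS.and hT).exists
  simp only [sub_self, Real.dist_eq, sub_zero] at h1 h2
  exact (hfar i h1).not_gt h2

end Approximation

section Limit

variable {m : ℕ} {Ω : Type*} [MeasurableSpace Ω] {P : Measure Ω} [IsProbabilityMeasure P]
  {n : ℕ → Fin 2 → ℕ} {q : Fin (m + 1) → ℝ}
  {N : ℕ → Fin 2 → Ω → Fin (m + 1) → ℕ}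
  (hlaw : ∀ k i, HasLaw (N k i) (multinomial (n k i) q) P)
  {H : Matrix (Fin m) (Fin m) ℝ} (hH : H.PosDef)
  (hY : TendstoInDistribution (fun k ω => score H (n k) fun i => N k i ω) atTop id
    (fun _ => P) (multivariateGaussian 0 H))
  (hcol : ∀ j, ∀ ε > 0, Tendsto
    (fun k => P.real {ω | ε ≤ |colFreq (n k) (fun i => N k i ω) j - q j|})
    atTop (𝓝 0))
  {s : ℕ → Table m → ℝ}
  (hs : ∀ ε > 0, ∀ R : ℝ, ∃ δ > 0, ∃ K, ∀ k ≥ K, ∀ T : Table m, (∀ i, ∑ j, T i j = n k i) →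
      (∀ j, |colFreq (n k) T j - q j| < δ) → ‖score H (n k) T‖ ≤ R →
      |s k T - projNormSq H (score H (n k) T).ofLp| < ε)

include hlaw hcol in
/-- With probability tending to one, the table has the prescribed row totals and column frequencies
close to their limits. -/
theorem tendsto_measure_irregular {δ : ℝ} (hδ : 0 < δ) :
    Tendsto (fun k => P.real {ω | ¬((∀ i, ∑ j, N k i ω j = n k i) ∧
      ∀ j, |colFreq (n k) (fun i => N k i ω) j - q j| < δ)}) atTop (𝓝 0) := by
  have h1 := tendsto_finsetSum (Finset.univ : Finset (Fin (m + 1))) fun j _ => hcol j δ hδ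
  rw [Finset.sum_const_zero] at h1
  refine squeeze_zero (fun _ => measureReal_nonneg) (fun k => ?_) h1
  have h0 : P.real {ω | ¬∀ i, ∑ j, N k i ω j = n k i} = 0 := by
    rw [measureReal_def, ae_iff.mp (ae_sum_eq (hlaw k)), ENNReal.toReal_zero]
  calc _ ≤ P.real ({ω | ¬∀ i, ∑ j, N k i ω j = n k i} ∪
        ⋃ j, {ω | δ ≤ |colFreq (n k) (fun i => N k i ω) j - q j|}) := by
        refine measureReal_mono fun ω hω => ?_
        rw [Set.mem_ofPred_eq, not_and_or] at hω
        refine hω.imp id fun h => ?_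
        push Not at h
        exact Set.mem_iUnion.mpr h
    _ ≤ _ := measureReal_union_le _ _
    _ ≤ _ := by
        rw [h0, zero_add]
        exact measureReal_iUnion_fintype_le _

include hY in
/-- The scores are asymptotically tight. -/
theorem exists_eventually_measure_score_lt {η : ℝ} (hη : 0 < η) :
    ∃ R, ∀ᶠ k in atTop, P.real {ω | R ≤ ‖score H (n k) fun i => N k i ω‖} < η := by
  have ht := tendsto_measure_norm_gt_of_isTightMeasureSet
    (isTightMeasureSet_singleton (μ := multivariateGaussian (0 : EuclideanSpace ℝ (Fin m)) H))
  simp only [Set.mem_singleton_iff, iSup_iSup_eq_left] at ht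
  obtain ⟨r, hr⟩ := (ht.eventually_lt_const (ENNReal.ofReal_pos.mpr (half_pos hη))).exists
  refine ⟨r + 1, ?_⟩
  have hF : IsClosed {x : EuclideanSpace ℝ (Fin m) | r + 1 ≤ ‖x‖} :=
    isClosed_le continuous_const continuous_norm
  filter_upwards [eventually_measureReal_closed_lt hY hF (half_pos hη)] with k hk
  have h1 : (multivariateGaussian 0 H).real {x : EuclideanSpace ℝ (Fin m) | r + 1 ≤ ‖x‖} ≤
      η / 2 := by
    refine (measureReal_mono (s₂ := {x | r < ‖x‖}) fun x hx => ?_).trans ?_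
    · exact (lt_add_one r).trans_le hx
    · exact ((ENNReal.lt_ofReal_iff_toReal_lt (measure_ne_top _ _)).mp hr).le
  refine hk.trans_le ?_
  simp only [id_eq]
  linarith

include hlaw hH hY hcol hs in
/-- The statistic converges in distribution to the squared norm of the projection of a Gaussian
vector. -/
theorem tendstoInDistribution_stat :
    TendstoInDistribution (fun k ω => s k fun i => N k i ω) atTop
      (fun η : EuclideanSpace ℝ (Fin m) => projNormSq H η.ofLp) (fun _ => P)
      (multivariateGaussian 0 H) := by
  have hcomp := hY.continuous_comp
    (g := fun η : EuclideanSpace ℝ (Fin m) => projNormSq H η.ofLp) (continuous_projNormSq hH)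
  refine tendstoInDistribution_of_tendstoInMeasure_sub _ _ hcomp ?_
    fun k => aemeasurable_comp_table (fun i => (hlaw k i).aemeasurable) (s k)
  rw [tendstoInMeasure_iff_measureReal_norm]
  intro ε hε
  rw [tendsto_order]
  refine ⟨fun a ha => Eventually.of_forall fun k => ha.trans_le measureReal_nonneg, fun η hη => ?_⟩
  obtain ⟨R, hR⟩ := exists_eventually_measure_score_lt hY (half_pos hη)
  obtain ⟨δ, hδ, K, hK⟩ := hs ε hε R
  filter_upwards [hR, eventually_ge_atTop K,
    (tendsto_measure_irregular hlaw hcol hδ).eventually_lt_const (half_pos hη)] with k h1 h2 h3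
  calc _ ≤ P.real ({ω | R ≤ ‖score H (n k) fun i => N k i ω‖} ∪
        {ω | ¬((∀ i, ∑ j, N k i ω j = n k i) ∧
          ∀ j, |colFreq (n k) (fun i => N k i ω) j - q j| < δ)}) := by
        refine measureReal_mono fun ω hω => ?_
        by_contra hcon
        rw [Set.mem_union, not_or] at hcon
        have hreg := not_not.mp hcon.2
        have := hK k h2 (fun i => N k i ω) hreg.1 hreg.2 (not_le.mp hcon.1).le
        exact absurd this (not_lt.mpr (by simpa using hω))
    _ ≤ _ := measureReal_union_le _ _
    _ < η := by linarith

include hlaw hH hY hcol hs in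
/-- The distribution function of the statistic converges at every point.  The limit law has an atom
at `0`, where weak convergence only gives the upper bound; the lower bound comes from the tables
whose partial sums of deviations are all nonpositive, for which the statistic vanishes exactly. -/
theorem tendsto_measure_stat_le (hq : ∀ j, 0 < q j)
    (hzero : ∀ᶠ k in atTop, ∀ T : Table m, (∀ i, ∑ j, T i j = n k i) →
      (∀ j, 0 < colFreq (n k) T j) → (∀ l, cumDev (n k) T l ≤ 0) → s k T = 0) (x : ℝ) :
    Tendsto (fun k => P.real {ω | s k (fun i => N k i ω) ≤ x}) atTop
      (𝓝 (∑ j ∈ Finset.range (m + 1), weight H j * (chiSq (m - j)).real (Set.Iic x))) := by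
  have hdet : IsUnit H.det := hH.det_pos.ne'.isUnit
  have hD := tendstoInDistribution_stat hlaw hH hY hcol hs
  rw [← measure_projNormSq hH measurableSet_Iic, tendsto_order]
  refine ⟨fun a ha => ?_, fun a ha => ?_⟩
  · rcases lt_trichotomy x 0 with hx | rfl | hx
    · have h0 : (fun η : EuclideanSpace ℝ (Fin m) => projNormSq H η.ofLp) ⁻¹' Set.Iic x = ∅ := by
        ext η
        simpa using hx.trans_le (projNormSq_nonneg hH η.ofLp)
      rw [h0, measureReal_empty] at ha
      exact Eventually.of_forall fun k => ha.trans_le measureReal_nonneg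
    -- At `x = 0`, the limit is the probability of the interior of the polar cone.
    · obtain ⟨δ, hδ, hδq⟩ : ∃ δ > 0, ∀ j, δ ≤ q j := by
        obtain ⟨j, hj⟩ := Finite.exists_min q
        exact ⟨q j, hq j, hj⟩
      set O : Set (EuclideanSpace ℝ (Fin m)) := {η | ∀ i, (H⁻¹ *ᵥ η.ofLp) i < 0}
      have hO : IsOpen O := by
        simp only [O, Set.ofPred_forall]
        exact isOpen_iInter_of_finite fun i => isOpen_lt (by fun_prop) continuous_const
      have ha' : a < (multivariateGaussian 0 H).real O :=
        ha.trans_le (measure_projNormSq_nonpos hH)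
      set η := (multivariateGaussian 0 H).real O - a with hη
      have hηpos : 0 < η := sub_pos.mpr ha'
      filter_upwards [eventually_lt_measureReal_open hY hO (half_pos hηpos), hzero,
        (tendsto_measure_irregular hlaw hcol hδ).eventually_lt_const (half_pos hηpos)]
        with k h1 h2 h3
      have h4 : P.real {ω | (score H (n k) fun i => N k i ω) ∈ O} ≤
          P.real {ω | s k (fun i => N k i ω) ≤ 0} +
            P.real {ω | ¬((∀ i, ∑ j, N k i ω j = n k i) ∧
              ∀ j, |colFreq (n k) (fun i => N k i ω) j - q j| < δ)} := by
        refine (measureReal_mono fun ω hω => ?_).trans (measureReal_union_le _ _)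
        rw [Set.mem_union, or_iff_not_imp_right]
        intro hreg
        obtain ⟨hrow, hc⟩ := not_not.mp hreg
        refine (h2 _ hrow (fun j => ?_) fun l => ?_).le
        · have := (abs_lt.mp (hc j)).1
          linarith [hδq j]
        · have h5 : (H⁻¹ *ᵥ (H *ᵥ cumDev (n k) fun i => N k i ω)) l < 0 := hω l
          rw [mulVec_mulVec, nonsing_inv_mul _ hdet, one_mulVec] at h5
          exact h5.le
      simp only [id_eq, Set.ofPred_mem_eq] at h1
      linarith
    · have h0 : (multivariateGaussian 0 H).real
          ((fun η : EuclideanSpace ℝ (Fin m) => projNormSq H η.ofLp) ⁻¹' Set.Iic x) ≤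
          (multivariateGaussian 0 H).real {η | projNormSq H η.ofLp ∈ Set.Iio x} := by
        have h1 := measure_projNormSq_eq_zero hH hx
        refine (measureReal_mono (s₂ := {η | projNormSq H η.ofLp ∈ Set.Iio x} ∪
          {η | projNormSq H η.ofLp = x}) fun η hη => ?_).trans
          ((measureReal_union_le _ _).trans (by rw [h1, add_zero]))
        have h2 : projNormSq H η.ofLp ≤ x := hη
        exact lt_or_eq_of_le h2
      have ha' := ha.trans_le h0
      filter_upwards [eventually_lt_measureReal_open hD isOpen_Iio (sub_pos.mpr ha')] with k hk
      rw [sub_sub_cancel] at hk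
      refine hk.trans_le (measureReal_mono fun ω hω => ?_)
      have h2 : s k (fun i => N k i ω) < x := hω
      exact h2.le
  · filter_upwards [eventually_measureReal_closed_lt hD isClosed_Iic (sub_pos.mpr ha)] with k hk
    refine hk.trans_eq ?_
    exact add_sub_cancel _ _

end Limit

end LROrder

open LROrder
theorem theorem2 {m : ℕ}
    {Ω : Type*} [MeasurableSpace Ω] (P : Measure Ω) [IsProbabilityMeasure P]
    (φ : ℝ → ℝ) (hφ : IsPhi φ)
    (n : ℕ → Fin 2 → ℕ) (hn : ∀ i, Tendsto (fun k => n k i) atTop atTop)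
    (ν : Fin 2 → ℝ) (hν_pos : ∀ i, 0 < ν i)
    (hν : ∀ i, Tendsto (fun k => (n k i : ℝ) / total (n k)) atTop (𝓝 (ν i)))
    (θ₀ : Param m) (hH0 : ∀ j, localOddsRatio (condProb θ₀) j = 1)
    (N : ℕ → Fin 2 → Ω → Fin (m + 1) → ℕ)
    (hlaw : ∀ k i, HasLaw (N k i) (multinomial (n k i) (condProb θ₀ i)) P)
    (hind : ∀ k, IndepFun (N k 0) (N k 1) P)
    (θhat θtilde : (Fin 2 → ℕ) → Table m → Param m)
    (hhat : IsMLEstimator (nullSpace m) θhat)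
    (htilde : IsMLEstimator (orderSpace m) θtilde) :
    ∑ j ∈ Finset.range (m + 1), weight (matH ν (condProb θ₀ 0)) j = 1 ∧
    ∀ x : ℝ,
      Tendsto (fun k => P.real {ω | statS φ (n k)
          (θtilde (n k) (fun i => N k i ω)) (θhat (n k) (fun i => N k i ω)) ≤ x}) atTop
        (𝓝 (∑ j ∈ Finset.range (m + 1),
          weight (matH ν (condProb θ₀ 0)) j * (chiSq (m - j)).real (Set.Iic x))) ∧
      Tendsto (fun k => P.real {ω | statT φ (n k) (fun i => N k i ω)
          (θtilde (n k) (fun i => N k i ω)) (θhat (n k) (fun i => N k i ω)) ≤ x}) atTop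
        (𝓝 (∑ j ∈ Finset.range (m + 1),
          weight (matH ν (condProb θ₀ 0)) j * (chiSq (m - j)).real (Set.Iic x))) := by
  set q := condProb θ₀ 0
  have hq : ∀ j, 0 < q j := condProb_pos θ₀ 0
  have hsum : ∑ j, q j = 1 := sum_condProb θ₀ 0
  have hlaw' : ∀ k i, HasLaw (N k i) (multinomial (n k i) q) P := fun k i => by
    have h := hlaw k i
    rwa [condProb_eq_of_localOddsRatio_eq_one hH0 i] at h
  have hH := posDef_matH hν_pos hq
  have hY := tendsto_score hq hsum hn hlaw' hind hν hν_pos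
  have hcol := fun j ε (hε : ε > 0) => tendsto_measure_colFreq hq hsum hn hlaw' hind hν j hε
  have hclose := fun ε (hε : ε > 0) R =>
    exists_stat_close hφ hn hν_pos hν hq hhat htilde hε R
  have hpos : ∀ᶠ k in atTop, ∀ i, 0 < n k i :=
    eventually_all.mpr fun i => (hn i).eventually_gt_atTop 0
  refine ⟨sum_weight hH, fun x => ⟨?_, ?_⟩⟩
  · refine tendsto_measure_stat_le hlaw' hH hY hcol
      (s := fun k T => statS φ (n k) (θtilde (n k) T) (θhat (n k) T)) (fun ε hε R => ?_) hq ?_ x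
    · obtain ⟨δ, hδ, K, h⟩ := hclose ε hε R
      exact ⟨δ, hδ, K, fun k hk T h1 h2 h3 => (h k hk T h1 h2 h3).1⟩
    · filter_upwards [hpos] with k hk T h1 h2 h3
      exact (stat_eq_zero_of_cumDev_nonpos hφ hk h1 h2 h3 hhat htilde).1
  · refine tendsto_measure_stat_le hlaw' hH hY hcol
      (s := fun k T => statT φ (n k) T (θtilde (n k) T) (θhat (n k) T)) (fun ε hε R => ?_) hq ?_ x
    · obtain ⟨δ, hδ, K, h⟩ := hclose ε hε R
      exact ⟨δ, hδ, K, fun k hk T h1 h2 h3 => (h k hk T h1 h2 h3).2⟩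
    · filter_upwards [hpos] with k hk T h1 h2 h3
      exact (stat_eq_zero_of_cumDev_nonpos hφ hk h1 h2 h3 hhat htilde).2
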